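/- Let $\Bbbk$ be an uncountable algebraically closed field of characteristic different from $2$, and let $\rho,\theta\in\Bbbk^*$ be algebraically independent over the prime subfield of $\Bbbk$. Let $T=\mathbb P^1\times\mathbb P^1$ with coordinates $[x:y][z:w]$, put $u=x/y$, $v=z/w$, $K=\Bbbk(T)=\Bbbk(u,v)$, and let $\mathcal K$ be the constant sheaf $K$ on $T$. Let $\phi=\tau\sigma:T\dashrightarrow T$ be the birational map with $\sigma([x:y][z:w])=[xz:yw][z:w]$ and $\tau([x:y][z:w])=[(\rho+1)x+(\rho-1)y:(\rho-1)x+(\rho+1)y]\,[(\theta+1)z+(\theta-1)w:(\theta-1)z+(\theta+1)w]$. Write $f^{\phi}=f\circ\phi$ for $f\in K$, and $\varphi(f)=f^\phi$. For an invertible subsheaf $\mathcal M\subseteq\mathcal K$ and $m\ge0$, let $\mathcal M^{\phi^m}\subseteq\mathcal K$ be the unique invertible subsheaf which restricts to the pullback of $\mathcal M$ on the domain of definition of $\phi^m$. Let $E=\Bbbk+\Bbbk u+\Bbbk v+\Bbbk uv$ and let $R=\Bbbk\langle Et\rangle\subseteq K[t,t^{-1};\varphi]$ (with $ta=\varphi(a)t$),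 graded by $R_n=R\cap Kt^n$. Let $\mathcal L=\mathcal O_T(Y+W)\subseteq\mathcal K$ with $Y=\{y=0\}$, $W=\{w=0\}$. For $m,n\ge0$ let $\mathcal L_n^{\phi^m}=\mathcal L^{\phi^m}\mathcal L^{\phi^{m+1}}\cdots\mathcal L^{\phi^{m+n-1}}\subseteq\mathcal K$, let $\mathcal R_n^{\phi^m}\subseteq\mathcal L_n^{\phi^m}$ be the subsheaf generated by $(R_nt^{-n})^{\phi^m}=E^{\phi^m}E^{\phi^{m+1}}\cdots E^{\phi^{m+n-1}}$, and let $\mathcal I_n^{\phi^m}\subseteq\mathcal O_T$ be the base ideal of these sections, so that $\mathcal R_n^{\phi^m}=\mathcal I_n^{\phi^m}\mathcal L_n^{\phi^m}$. For $m=0$ write $\mathcal L_n$, $\mathcal R_n$, $\mathcal I_n$. Let $J^{(1)}\subseteq J^{(2)}\subseteq\cdots$ be an ascending chain of graded right ideals of $R$. Then there are $k\in\mathbb N$, a coherent ideal sheaf $\mathcal J\subseteq\mathcal I_k$ and an index $\ell_0$ such that for all $n\ge k$ and all $\ell\ge\ell_0$ the subsheaf of $\mathcal K$ generated by $J^{(\ell)}_nt^{-n}$,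 where $J^{(\ell)}_n=J^{(\ell)}\cap R_n$, is equal to $\mathcal J\,\mathcal L_k\cdot\mathcal R_{n-k}^{\phi^k}$. -/

import Mathlib

noncomputable section

namespace BirP1P1

open MvPolynomial

/-! ## The rational function field `𝕜(u, v)` and its automorphisms -/

section FunctionField

variable (𝕜 : Type*) [Field 𝕜]

/-- The field `K = 𝕜(u, v)` of rational functions on `T = ℙ¹ × ℙ¹`. -/
abbrev K : Type _ := FractionRing (MvPolynomial (Fin 2) 𝕜)

/-- The rational function `u = x / y`. -/
def u : K 𝕜 := algebraMap (MvPolynomial (Fin 2) 𝕜) (K 𝕜) (X 0)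

/-- The rational function `v = z / w`. -/
def v : K 𝕜 := algebraMap (MvPolynomial (Fin 2) 𝕜) (K 𝕜) (X 1)

variable {𝕜}

theorem algebraicIndependent_uv : AlgebraicIndependent 𝕜 ![u 𝕜, v 𝕜] := by
  rw [algebraicIndependent_iff_injective_aeval]
  have h : (aeval ![u 𝕜, v 𝕜] : MvPolynomial (Fin 2) 𝕜 →ₐ[𝕜] K 𝕜)
      = IsScalarTower.toAlgHom 𝕜 (MvPolynomial (Fin 2) 𝕜) (K 𝕜) := by
    apply MvPolynomial.algHom_ext
    intro i
    fin_cases i <;> simp [u, v]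
  rw [h]
  exact IsFractionRing.injective (MvPolynomial (Fin 2) 𝕜) (K 𝕜)

theorem eq_top_of_mem {L : IntermediateField 𝕜 (K 𝕜)} (hu : u 𝕜 ∈ L) (hv : v 𝕜 ∈ L) :
    L = ⊤ := by
  have key : ∀ p : MvPolynomial (Fin 2) 𝕜, algebraMap _ (K 𝕜) p ∈ L := by
    intro p
    induction p using MvPolynomial.induction_on with
    | C a =>
      have : algebraMap (MvPolynomial (Fin 2) 𝕜) (K 𝕜) (C a) = algebraMap 𝕜 (K 𝕜) a := by
        rw [← MvPolynomial.algebraMap_eq, ← IsScalarTower.algebraMap_apply]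
      rw [this]
      exact L.algebraMap_mem a
    | add p q hp hq => rw [map_add]; exact add_mem hp hq
    | mul_X p i hp =>
      rw [map_mul]
      refine mul_mem hp ?_
      fin_cases i
      · exact hu
      · exact hv
  rw [eq_top_iff]
  intro f _
  obtain ⟨p, q, -, rfl⟩ := IsFractionRing.div_surjective (MvPolynomial (Fin 2) 𝕜) f
  exact div_mem (key p) (key q)

theorem algebraicIndependent_of_mem {a b : K 𝕜}
    (hu : u 𝕜 ∈ IntermediateField.adjoin 𝕜 {a, b})
    (hv : v 𝕜 ∈ IntermediateField.adjoin 𝕜 {a, b}) : AlgebraicIndependent 𝕜 ![a, b] := by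
  have htop := eq_top_of_mem hu hv
  have hr : Set.range ![a, b] = {a, b} := by
    ext x
    simp [eq_comm, or_comm]
  have halg : Algebra.IsAlgebraic (Algebra.adjoin 𝕜 (Set.range ![a, b])) (K 𝕜) := by
    rw [hr]
    refine ⟨fun f => ?_⟩
    have hf : f ∈ IntermediateField.adjoin 𝕜 {a, b} := htop ▸ IntermediateField.mem_top
    obtain ⟨r, hr, s, hs, rfl⟩ := IntermediateField.mem_adjoin_iff_div.mp hf
    have h1 := isAlgebraic_algebraMap (R := Algebra.adjoin 𝕜 {a, b}) (A := K 𝕜) ⟨r, hr⟩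
    have h2 := isAlgebraic_algebraMap (R := Algebra.adjoin 𝕜 {a, b}) (A := K 𝕜) ⟨s, hs⟩
    rw [div_eq_mul_inv]
    exact h1.mul h2.inv
  have hle := (algebraicIndependent_uv (𝕜 := 𝕜)).lift_cardinalMk_le_trdeg
  exact (Algebra.IsAlgebraic.isTranscendenceBasis_of_lift_le_trdeg_of_finite 𝕜 ![a, b] hle).1

/-- The endomorphism of `K = 𝕜(u, v)` over `𝕜` with `u ↦ a` and `v ↦ b`, for algebraically
independent `a`, `b`. -/
def homOf (a b : K 𝕜) (h : AlgebraicIndependent 𝕜 ![a, b]) : K 𝕜 →ₐ[𝕜] K 𝕜 :=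
  IsFractionRing.liftAlgHom (g := aeval ![a, b]) (algebraicIndependent_iff_injective_aeval.mp h)

theorem homOf_u (a b : K 𝕜) (h) : homOf a b h (u 𝕜) = a := by
  simp [homOf, u]

theorem homOf_v (a b : K 𝕜) (h) : homOf a b h (v 𝕜) = b := by
  simp [homOf, v]

/-- The automorphism of `K = 𝕜(u, v)` over `𝕜` with `u ↦ a` and `v ↦ b`, for generators `a`, `b`
of `K`. -/
def autOf (a b : K 𝕜) (hu : u 𝕜 ∈ IntermediateField.adjoin 𝕜 {a, b})
    (hv : v 𝕜 ∈ IntermediateField.adjoin 𝕜 {a, b}) : K 𝕜 ≃ₐ[𝕜] K 𝕜 :=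
  AlgEquiv.ofBijective (homOf a b (algebraicIndependent_of_mem hu hv)) (by
    refine ⟨RingHom.injective _, fun f => ?_⟩
    have hle : IntermediateField.adjoin 𝕜 {a, b} ≤
        (homOf a b (algebraicIndependent_of_mem hu hv)).fieldRange := by
      rw [IntermediateField.adjoin_le_iff]
      rintro x (hx | hx)
      · exact ⟨u 𝕜, (homOf_u _ _ _).trans hx.symm⟩
      · exact ⟨v 𝕜, (homOf_v _ _ _).trans hx.symm⟩
    have hf : f ∈ IntermediateField.adjoin 𝕜 {a, b} :=
      eq_top_of_mem hu hv ▸ IntermediateField.mem_top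
    exact hle hf)

theorem autOf_u (a b : K 𝕜) (hu hv) : autOf a b hu hv (u 𝕜) = a :=
  homOf_u a b (algebraicIndependent_of_mem hu hv)

theorem autOf_v (a b : K 𝕜) (hu hv) : autOf a b hu hv (v 𝕜) = b :=
  homOf_v a b (algebraicIndependent_of_mem hu hv)

theorem u_ne_zero : u 𝕜 ≠ 0 := by
  simpa using (algebraicIndependent_uv (𝕜 := 𝕜)).ne_zero 0

theorem v_ne_zero : v 𝕜 ≠ 0 := by
  simpa using (algebraicIndependent_uv (𝕜 := 𝕜)).ne_zero 1

/-- Pullback of rational functions along `σ : [x:y][z:w] ↦ [xz:yw][z:w]`, that is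
`u ↦ u v`, `v ↦ v`. -/
def sigma : K 𝕜 ≃ₐ[𝕜] K 𝕜 :=
  autOf (u 𝕜 * v 𝕜) (v 𝕜)
    (by
      have h1 := IntermediateField.subset_adjoin 𝕜 {u 𝕜 * v 𝕜, v 𝕜} (Set.mem_insert _ _)
      have h2 := IntermediateField.subset_adjoin 𝕜 {u 𝕜 * v 𝕜, v 𝕜}
        (Set.mem_insert_of_mem _ rfl)
      have h3 : u 𝕜 * v 𝕜 / v 𝕜 = u 𝕜 := mul_div_cancel_right₀ (u 𝕜) v_ne_zero
      have h4 := (IntermediateField.adjoin 𝕜 {u 𝕜 * v 𝕜, v 𝕜}).div_mem h1 h2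
      rw [h3] at h4
      exact h4)
    (IntermediateField.subset_adjoin 𝕜 _ (Set.mem_insert_of_mem _ rfl))

/-- The fractional linear expression `((ρ + 1) f + (ρ - 1)) / ((ρ - 1) f + (ρ + 1))`. -/
def moebius (ρ : 𝕜) (f : K 𝕜) : K 𝕜 :=
  (algebraMap 𝕜 (K 𝕜) (ρ + 1) * f + algebraMap 𝕜 (K 𝕜) (ρ - 1)) /
    (algebraMap 𝕜 (K 𝕜) (ρ - 1) * f + algebraMap 𝕜 (K 𝕜) (ρ + 1))

theorem mem_of_moebius_mem [NeZero (2 : 𝕜)] (ρ : 𝕜ˣ) {f : K 𝕜} (hf : Transcendental 𝕜 f)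
    {L : IntermediateField 𝕜 (K 𝕜)} (h : moebius (ρ : 𝕜) f ∈ L) : f ∈ L := by
  set γ : K 𝕜 := algebraMap 𝕜 (K 𝕜) (ρ + 1) with hγ
  set δ : K 𝕜 := algebraMap 𝕜 (K 𝕜) (ρ - 1) with hδ
  have h2 : (2 : 𝕜) ≠ 0 := NeZero.ne 2
  have hγL : γ ∈ L := L.algebraMap_mem _
  have hδL : δ ∈ L := L.algebraMap_mem _
  have hdet : γ ^ 2 - δ ^ 2 ≠ 0 := by
    have : γ ^ 2 - δ ^ 2 = algebraMap 𝕜 (K 𝕜) (2 * 2 * ρ) := by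
      rw [hγ, hδ, ← map_pow, ← map_pow, ← map_sub]
      congr 1
      ring
    rw [this]
    exact (map_ne_zero _).mpr (mul_ne_zero (mul_ne_zero h2 h2) ρ.ne_zero)
  have hden : δ * f + γ ≠ 0 := by
    intro h0
    by_cases hd : δ = 0
    · have hg : γ = 0 := by simpa [hd] using h0
      exact hdet (by simp [hd, hg])
    · apply hf
      have : f = algebraMap 𝕜 (K 𝕜) (-(ρ + 1) / (ρ - 1)) := by
        rw [map_div₀, map_neg]
        change f = -γ / δ
        field_simp
        linear_combination h0
      rw [this]
      exact isAlgebraic_algebraMap _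
  have ha : moebius (ρ : 𝕜) f = (γ * f + δ) / (δ * f + γ) := rfl
  have hden2 : γ - δ * moebius (ρ : 𝕜) f = (γ ^ 2 - δ ^ 2) / (δ * f + γ) := by
    rw [ha]
    field_simp
    ring
  have hf' : f = (γ * moebius (ρ : 𝕜) f - δ) / (γ - δ * moebius (ρ : 𝕜) f) := by
    have hnum : γ * moebius (ρ : 𝕜) f - δ = f * (γ ^ 2 - δ ^ 2) / (δ * f + γ) := by
      rw [ha, eq_div_iff hden, sub_mul, mul_assoc, div_mul_cancel₀ _ hden]
      ring
    rw [hden2, hnum, div_div_div_cancel_right₀ hden, mul_div_cancel_right₀ _ hdet]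
  rw [hf']
  exact div_mem (sub_mem (mul_mem hγL h) hδL) (sub_mem hγL (mul_mem hδL h))

/-- Pullback of rational functions along the automorphism `τ(ρ, θ)` of `ℙ¹ × ℙ¹`
(for `𝕜` of characteristic other than `2`). -/
def tau [NeZero (2 : 𝕜)] (ρ θ : 𝕜ˣ) : K 𝕜 ≃ₐ[𝕜] K 𝕜 :=
  autOf (moebius (ρ : 𝕜) (u 𝕜)) (moebius (θ : 𝕜) (v 𝕜))
    (mem_of_moebius_mem ρ (by simpa using (algebraicIndependent_uv (𝕜 := 𝕜)).transcendental 0)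
      (IntermediateField.subset_adjoin 𝕜 _ (Set.mem_insert _ _)))
    (mem_of_moebius_mem θ (by simpa using (algebraicIndependent_uv (𝕜 := 𝕜)).transcendental 1)
      (IntermediateField.subset_adjoin 𝕜 _ (Set.mem_insert_of_mem _ rfl)))

/-- Pullback of rational functions along the birational map `φ = τ ∘ σ` of `T`:
`φ^* = σ^* ∘ τ^*`. -/
def phi [NeZero (2 : 𝕜)] (ρ θ : 𝕜ˣ) : K 𝕜 ≃ₐ[𝕜] K 𝕜 := (tau ρ θ).trans sigma

theorem phi_u [NeZero (2 : 𝕜)] (ρ θ : 𝕜ˣ) :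
    phi ρ θ (u 𝕜) = moebius (ρ : 𝕜) (u 𝕜 * v 𝕜) := by
  simp [phi, tau, autOf_u, moebius, sigma]

theorem phi_v [NeZero (2 : 𝕜)] (ρ θ : 𝕜ˣ) : phi ρ θ (v 𝕜) = moebius (θ : 𝕜) (v 𝕜) := by
  simp [phi, tau, autOf_v, moebius, sigma]

end FunctionField

/-! ## Skew Laurent rings `A[t, t⁻¹; φ]` -/

section SkewLaurent

variable {𝕜 A : Type*} [CommRing 𝕜] [CommRing A] [Algebra 𝕜 A]

/-- A copy of `A`, on which the infinite cyclic group `⟨t⟩` acts, `t` acting as `φ`. -/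
def Twisted (_φ : A ≃ₐ[𝕜] A) : Type _ := A

instance (φ : A ≃ₐ[𝕜] A) : CommRing (Twisted φ) := inferInstanceAs (CommRing A)

instance (φ : A ≃ₐ[𝕜] A) : Algebra 𝕜 (Twisted φ) := inferInstanceAs (Algebra 𝕜 A)

instance (φ : A ≃ₐ[𝕜] A) : MulSemiringAction (Multiplicative ℤ) (Twisted φ) where
  smul n a := (φ ^ n.toAdd) a
  one_smul _ := rfl
  mul_smul n m a := by
    change (φ ^ (n.toAdd + m.toAdd)) a = (φ ^ n.toAdd) ((φ ^ m.toAdd) a)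
    rw [zpow_add]
    rfl
  smul_zero n := map_zero (φ ^ n.toAdd)
  smul_add n := map_add (φ ^ n.toAdd)
  smul_one n := map_one (φ ^ n.toAdd)
  smul_mul n := map_mul (φ ^ n.toAdd)

instance (φ : A ≃ₐ[𝕜] A) : SMulCommClass (Multiplicative ℤ) 𝕜 (Twisted φ) :=
  ⟨fun n c a => map_smul (φ ^ n.toAdd) c a⟩

/-- The skew Laurent ring `A[t, t⁻¹; φ]`, with elements `∑ aₙ tⁿ` and `t a = φ(a) t`. -/
abbrev SkewLaurent (φ : A ≃ₐ[𝕜] A) : Type _ := SkewMonoidAlgebra (Twisted φ) (Multiplicative ℤ)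

/-- The element `a tⁿ`. -/
def monom (φ : A ≃ₐ[𝕜] A) (n : ℤ) (a : A) : SkewLaurent φ :=
  SkewMonoidAlgebra.single (k := Twisted φ) (Multiplicative.ofAdd n) a

/-- The coefficient of `tⁿ`. -/
def coeffAt (φ : A ≃ₐ[𝕜] A) (n : ℤ) (f : SkewLaurent φ) : A :=
  SkewMonoidAlgebra.coeff f (Multiplicative.ofAdd n)

theorem monom_mul_monom (φ : A ≃ₐ[𝕜] A) (n m : ℤ) (a b : A) :
    monom φ n a * monom φ m b = monom φ (n + m) (a * (φ ^ n) b) :=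
  SkewMonoidAlgebra.single_mul_single ..

end SkewLaurent

/-! ## The surface `T = ℙ¹ × ℙ¹` and subsheaves of its sheaf `𝒦` of rational functions

The base field is algebraically closed in the application, and `T` is treated as a classical
variety, through its closed points. -/

section Surface

variable (𝕜 : Type*) [Field 𝕜]

/-- The (closed) points `[x:y][z:w]` of `T = ℙ¹ × ℙ¹`. -/
abbrev T : Type _ := Projectivization 𝕜 (Fin 2 → 𝕜) × Projectivization 𝕜 (Fin 2 → 𝕜)

/-- Polynomials in the coordinates `x, y` (`Sum.inl 0`, `Sum.inl 1`) and
`z, w` (`Sum.inr 0`, `Sum.inr 1`). -/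
abbrev Coord : Type _ := MvPolynomial (Fin 2 ⊕ Fin 2) 𝕜

variable {𝕜}

/-- `F` is a bihomogeneous form of bidegree `d`. -/
def IsForm (F : Coord 𝕜) (d : ℕ × ℕ) : Prop :=
  IsWeightedHomogeneous (Sum.elim (fun _ => ((1, 0) : ℕ × ℕ)) (fun _ => ((0, 1) : ℕ × ℕ))) F d

/-- The value of a form on chosen homogeneous coordinates of the point `p`; whether it vanishes
does not depend on the choice. -/
def evalAt (p : T 𝕜) (F : Coord 𝕜) : 𝕜 := eval (Sum.elim p.1.rep p.2.rep) F

/-- Dehomogenization `F ↦ F(u, 1, v, 1)`, which for `F` of bidegree `(a, b)` is the rational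
function `F / (y ^ a * w ^ b)`. -/
def dehom : Coord 𝕜 →ₐ[𝕜] K 𝕜 := aeval (Sum.elim ![u 𝕜, 1] ![v 𝕜, 1])

/-- The local ring `𝒪_{T,p}`: all quotients `f = F / G` of forms of the same bidegree with
`G(p) ≠ 0`. -/
def localRing (p : T 𝕜) : Subalgebra 𝕜 (K 𝕜) where
  carrier := {f | ∃ (d : ℕ × ℕ) (F G : Coord 𝕜), IsForm F d ∧ IsForm G d ∧ evalAt p G ≠ 0 ∧
    f * dehom G = dehom F}
  mul_mem' := by
    rintro f f' ⟨d, F, G, hF, hG, hp, h⟩ ⟨d', F', G', hF', hG', hp', h'⟩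
    refine ⟨d + d', F * F', G * G', hF.mul hF', hG.mul hG', ?_, ?_⟩
    · simpa [evalAt] using ⟨hp, hp'⟩
    · rw [map_mul, map_mul, ← h, ← h']; ring
  add_mem' := by
    rintro f f' ⟨d, F, G, hF, hG, hp, h⟩ ⟨d', F', G', hF', hG', hp', h'⟩
    refine ⟨d + d', F * G' + G * F', G * G', (hF.mul hG').add (hG.mul hF'), hG.mul hG', ?_, ?_⟩
    · simpa [evalAt] using ⟨hp, hp'⟩
    · rw [map_add, map_mul, map_mul, map_mul, ← h, ← h']; ring
  algebraMap_mem' c := by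
    refine ⟨0, C c, 1, isWeightedHomogeneous_C _ _, isWeightedHomogeneous_one _ _, ?_, ?_⟩
    · simp [evalAt]
    · simp [dehom]

variable (𝕜) in
/-- A subsheaf of `𝒪_T`-modules of the constant sheaf `𝒦` with value `K`, recorded by its
stalks, which are submodules of `K` and determine the subsheaf.  Inclusion, equality and products
of subsheaves are those of all stalks. -/
abbrev Subsheaf : Type _ := (p : T 𝕜) → Submodule (localRing p) (K 𝕜)

/-- The subsheaf of `𝒦` generated by a set of rational functions. -/
def generated (S : Set (K 𝕜)) : Subsheaf 𝕜 := fun p => Submodule.span (localRing p) S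

/-- Coherence of a subsheaf of `𝒦`: every point has a basic open neighbourhood
`{q | G(q) ≠ 0}` on which the subsheaf is generated by finitely many sections. -/
def IsCoherent (M : Subsheaf 𝕜) : Prop :=
  ∀ p : T 𝕜, ∃ (d : ℕ × ℕ) (G : Coord 𝕜), IsForm G d ∧ evalAt p G ≠ 0 ∧
    ∃ S : Finset (K 𝕜), ∀ q : T 𝕜, evalAt q G ≠ 0 → M q = generated (S : Set (K 𝕜)) q

variable (𝕜) in
/-- A (coherent) sheaf of ideals of `𝒪_T`. In the type of subsheaves of `𝒦`, `1` is `𝒪_T`. -/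
structure IdealSheaf where
  /-- the underlying subsheaf of `𝒦` -/
  toSubsheaf : Subsheaf 𝕜
  coherent : IsCoherent toSubsheaf
  le_one : toSubsheaf ≤ 1

/-- The invertible subsheaf `𝒪_T(aY + bW)` of `𝒦`, where `Y = {y = 0}` and `W = {w = 0}`; its
elements at `p` are the `F / (G * y ^ a * w ^ b)` with `F`, `G` forms,
`bideg F = bideg G + (a, b)` and `G(p) ≠ 0`. -/
def twist (e : ℕ × ℕ) : Subsheaf 𝕜 := fun p =>
  { carrier := {f | ∃ (d : ℕ × ℕ) (F G : Coord 𝕜), IsForm F (d + e) ∧ IsForm G d ∧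
      evalAt p G ≠ 0 ∧ f * dehom G = dehom F}
    zero_mem' := ⟨0, 0, 1, isWeightedHomogeneous_zero _ _ _, isWeightedHomogeneous_one _ _,
      by simp [evalAt], by simp⟩
    add_mem' := by
      rintro f f' ⟨d, F, G, hF, hG, hp, h⟩ ⟨d', F', G', hF', hG', hp', h'⟩
      refine ⟨d + d', F * G' + G * F', G * G', ?_, hG.mul hG', ?_, ?_⟩
      · refine IsWeightedHomogeneous.add ?_ ?_
        · rw [add_right_comm]; exact hF.mul hG'
        · rw [add_assoc]; exact hG.mul hF'
      · simpa [evalAt] using ⟨hp, hp'⟩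
      · rw [map_add, map_mul, map_mul, map_mul, ← h, ← h']; ring
    smul_mem' := by
      rintro ⟨f, d, F, G, hF, hG, hp, h⟩ f' ⟨d', F', G', hF', hG', hp', h'⟩
      refine ⟨d + d', F * F', G * G', ?_, hG.mul hG', ?_, ?_⟩
      · rw [add_assoc]; exact hF.mul hF'
      · simpa [evalAt] using ⟨hp, hp'⟩
      · change f * f' * dehom (G * G') = dehom (F * F')
        rw [map_mul, map_mul, ← h, ← h']; ring }

/-- The birational self-map of `T` with pullback `ψ` on rational functions is defined at `p` and
maps it to `q`: pullback maps `𝒪_{T,q}` into `𝒪_{T,p}`. -/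
def MapsTo (ψ : K 𝕜 ≃ₐ[𝕜] K 𝕜) (p q : T 𝕜) : Prop :=
  ∀ f ∈ localRing q, ψ f ∈ localRing p

/-- The pullback of an invertible subsheaf `M` of `𝒦` along the birational self-map of `T` with
pullback `ψ` on rational functions.  If `U` is the domain of definition of that map, this is the
largest extension `j_* (ψ|_U)^* M` from `U` to `T` (`j : U → T` the inclusion): `f` lies in the
stalk at `p` iff there is a basic open neighbourhood `D` of `p` such that, at every `q ∈ D ∩ U`,
`f` lies in the stalk of `(ψ|_U)^* M`, which is `𝒪_{T,q} · ψ(M_r)` with `r` the image of `q`.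
As `M` is invertible, `T` is nonsingular and `T ∖ U` is finite, it is the unique invertible
subsheaf of `𝒦` whose restriction to `U` is `(ψ|_U)^* M`. -/
def pullback (ψ : K 𝕜 ≃ₐ[𝕜] K 𝕜) (M : Subsheaf 𝕜) : Subsheaf 𝕜 := fun p =>
  { carrier := {f | ∃ (d : ℕ × ℕ) (G : Coord 𝕜), IsForm G d ∧ evalAt p G ≠ 0 ∧
      ∀ q r : T 𝕜, evalAt q G ≠ 0 → MapsTo ψ q r →
        f ∈ Submodule.span (localRing q) (ψ '' (M r : Set (K 𝕜)))}
    zero_mem' := ⟨0, 1, isWeightedHomogeneous_one _ _, by simp [evalAt],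
      fun _ _ _ _ => Submodule.zero_mem _⟩
    add_mem' := by
      rintro f f' ⟨d, G, hG, hp, h⟩ ⟨d', G', hG', hp', h'⟩
      refine ⟨d + d', G * G', hG.mul hG', by simpa [evalAt] using ⟨hp, hp'⟩, ?_⟩
      intro q r hq hr
      have hq' : evalAt q G ≠ 0 ∧ evalAt q G' ≠ 0 := by simpa [evalAt] using hq
      exact Submodule.add_mem _ (h q r hq'.1 hr) (h' q r hq'.2 hr)
    smul_mem' := by
      rintro ⟨a, d, F, G, hF, hG, hp, h⟩ f ⟨d', G', hG', hp', h'⟩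
      refine ⟨d + d', G * G', hG.mul hG', by simpa [evalAt] using ⟨hp, hp'⟩, ?_⟩
      intro q r hq hr
      have hq' : evalAt q G ≠ 0 ∧ evalAt q G' ≠ 0 := by simpa [evalAt] using hq
      have ha : a ∈ localRing q := ⟨d, F, G, hF, hG, hq'.1, h⟩
      exact Submodule.smul_mem _ (⟨a, ha⟩ : localRing q) (h' q r hq'.2 hr) }

end Surface

/-! ## The ring `R = R(τ)` and its sheaves -/

section Ring

variable {𝕜 : Type*} [Field 𝕜] [NeZero (2 : 𝕜)] (ρ θ : 𝕜ˣ)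

variable (𝕜) in
/-- The space `E = 𝕜 + 𝕜 u + 𝕜 v + 𝕜 u v` of rational functions. -/
def E : Submodule 𝕜 (K 𝕜) := Submodule.span 𝕜 {1, u 𝕜, v 𝕜, u 𝕜 * v 𝕜}

/-- The ring `R(τ) = 𝕜⟨E t⟩ ⊆ K[t, t⁻¹; φ]`, where `τ = τ(ρ, θ)`. -/
def R : Subalgebra 𝕜 (SkewLaurent (phi ρ θ)) :=
  Algebra.adjoin 𝕜 (monom (phi ρ θ) 1 '' (E 𝕜 : Set (K 𝕜)))

variable {ρ θ} in
/-- A right ideal of `R` is graded if it contains the homogeneous components of its elements. -/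
def IsGraded (J : Submodule (R ρ θ)ᵐᵒᵖ (R ρ θ)) : Prop :=
  ∀ f ∈ J, ∀ n : ℤ, ∃ g ∈ J,
    (g : SkewLaurent (phi ρ θ)) = monom (phi ρ θ) n (coeffAt (phi ρ θ) n f)

variable {ρ θ} in
/-- The rational functions `Jₙ t⁻ⁿ`, for a right ideal `J` of `R` and `Jₙ = J ∩ K tⁿ`. -/
def sections (J : Submodule (R ρ θ)ᵐᵒᵖ (R ρ θ)) (n : ℕ) : Set (K 𝕜) :=
  {a | ∃ f ∈ J, (f : SkewLaurent (phi ρ θ)) = monom (phi ρ θ) n a}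

/-- The sheaf `ℒ_n^{φ^m} = ℒ^{φ^m} ⊗ ℒ^{φ^{m+1}} ⊗ ⋯ ⊗ ℒ^{φ^{m+n-1}} ⊆ 𝒦`, where
`ℒ = 𝒪_T(Y + W)`; tensor products of invertible subsheaves of `𝒦` are products in `𝒦`. -/
def sheafL (m n : ℕ) : Subsheaf 𝕜 :=
  ∏ i ∈ Finset.range n, pullback (phi ρ θ ^ (m + i)) (twist (1, 1))

/-- The sheaf `ℛ_n^{φ^m} ⊆ 𝒦`, generated by `(Rₙ t⁻ⁿ)^{φ^m} = E^{φ^m} ⋯ E^{φ^{m+n-1}}`. -/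
def sheafR (m n : ℕ) : Subsheaf 𝕜 :=
  generated ((phi ρ θ ^ m) '' {a | monom (phi ρ θ) n a ∈ R ρ θ})

/-- The base ideal `ℐ_n^{φ^m}` of the sections `(Rₙ t⁻ⁿ)^{φ^m}` of the invertible sheaf
`ℒ_n^{φ^m}`, so that `ℛ_n^{φ^m} = ℐ_n^{φ^m} ℒ_n^{φ^m}`.  Here `1 / ℒ` is the inverse
`{f | f ℒ ⊆ 𝒪_T}` of an invertible sheaf `ℒ ⊆ 𝒦`. -/
def baseIdeal (m n : ℕ) : Subsheaf 𝕜 := sheafR ρ θ m n * (1 / sheafL ρ θ m n)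

end Ring

end BirP1P1

end

noncomputable section

namespace BirP1P1

/-! The iterate `φ^m` is given by forms: `v ↦ Z_m / W_m` with `Z_m`, `W_m` linear in `z, w`, and `u
↦ X_m / Y_m` with `X_m`, `Y_m` coprime of bidegree `(1, m)`. Hence `ℒ^{φ^m}` is locally generated by
one function `λ_m` (`pullback_twist`, a Hartogs argument), and the sheaf generated by `E^{φ^m}` is
`λ_m b_m`, with `b_m` the local ideal of `X_m`, `Y_m` (`sheafR_one_eq`). Say that the chain is
stable at a point `p` from `k` on if for all `n, ℓ ≥ k` the stalk at `p` of the sheaf generated by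
`J^{(ℓ)}_n` is the one for `J^{(k)}_k` times `ℛ_{n-k}^{φ^k}` (`StableAt`). The theorem amounts to
one `k` for all points; then `𝒥` is the sheaf generated by `J^{(k)}_k` times `ℒ_k⁻¹`.

At a single point such a `k` exists. Since `θ` is not a root of unity, `Z_m` and `W_m` are units at
`p` for large `m`, and then `b_{m+1} = b_m` (`baseMod_succ`). After division by products of the
`λ_m`, the stalks for large degrees form an ascending chain of ideals in the Rees algebra of a fixed
ideal `b`, which is Noetherian (`exists_eq_mul_pow`, `exists_stableAt`).

For uniformity, consider first the points outside the base locus, where all `b_m` are trivial. There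
a single chain of ideals in the polynomial ring gives a common bound (`exists_forall_stableAt`).
Next, if some `J^{(ℓ)}_n` has a nonzero section, it is given by a form `F`, and at points with `F ≠
0` the section generates everything, so the chain is stable there from `max ℓ n` on
(`stableAt_of_evalAt_ne_zero`). What remains are the base points on the curve `F = 0`, and there are
only finitely many of them (`IsForm.finite_baseLocus`).

This finiteness uses the algebraic independence of `ρ` and `θ`. The base points are, up to
exchanging coordinates, `[Q_i : P_i] [1 - θ^i : 1 + θ^i]` with `P_i`, `Q_i` coprime polynomials in
`ρ` whose degree grows with `i`. A fixed form has coefficients of bounded degree in `ρ`, so if it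
vanishes at infinitely many base points, all its coefficients vanish
(`eq_zero_of_infinite_sum_eq_zero`). -/

theorem pow_ne_neg_one {𝕜 : Type*} [Field 𝕜] [NeZero (2 : 𝕜)] {θ : 𝕜} (hθ : ∀ n, 0 < n → θ ^ n ≠ 1) (n : ℕ) : θ ^ n ≠ -1 := by
  intro h
  rcases Nat.eq_zero_or_pos n with rfl | hn
  · have : (2 : 𝕜) = 0 := by
      rw [pow_zero] at h
      linear_combination h
    exact NeZero.ne 2 this
  · exact hθ (n * 2) (by omega) (by rw [pow_mul, h]; ring)

section Heights

open Polynomial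

/-! ## Growth of the coordinates of base points -/

variable {F : Type*} [Field F]

/-- Homogeneous coordinates, as polynomials in the parameter `ρ`, of the points which are
blown up by the iterates of `φ`. -/
def basePQ (t : F) : ℕ → F[X] × F[X]
  | 0 => (0, 1)
  | i + 1 => (C (1 - t ^ (i + 1)) * ((1 + X) * (basePQ t i).1 + (1 - X) * (basePQ t i).2),
      C (1 + t ^ (i + 1)) * ((1 - X) * (basePQ t i).1 + (1 + X) * (basePQ t i).2))

theorem basePQ_natDegree_le (t : F) (i : ℕ) :
    (basePQ t i).1.natDegree ≤ i ∧ (basePQ t i).2.natDegree ≤ i := by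
  induction i with
  | zero => simp [basePQ]
  | succ i ih =>
    obtain ⟨h1, h2⟩ := ih
    have e1 : (1 + X : F[X]).natDegree ≤ 1 := by compute_degree
    have e2 : (1 - X : F[X]).natDegree ≤ 1 := by compute_degree
    have key : ∀ A B : F[X], A.natDegree ≤ 1 → B.natDegree ≤ 1 → ∀ c : F,
        (C c * (A * (basePQ t i).1 + B * (basePQ t i).2)).natDegree ≤ i + 1 := by
      intro A B hA hB c
      refine (natDegree_C_mul_le _ _).trans (natDegree_add_le_of_degree_le ?_ ?_)
      · rw [add_comm i]; exact natDegree_mul_le_of_le hA h1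
      · rw [add_comm i]; exact natDegree_mul_le_of_le hB h2
    exact ⟨key _ _ e1 e2 _, key _ _ e2 e1 _⟩

/-- The factors `1 - t^(i+1)` and `1 + t^(i+1)` add up to `2`, so the top coefficient of the
difference doubles in each step, independently of `t`. It follows that the first coordinate has
degree exactly `i` for `i > 0` when `t` is not a root of unity. -/
theorem basePQ_coeff (t : F) (i : ℕ) :
    ((basePQ t i).1 - (basePQ t i).2).coeff i = -2 ^ i ∧
      (basePQ t (i + 1)).1.coeff (i + 1) = -(1 - t ^ (i + 1)) * 2 ^ i := by
  have step : ∀ i, (basePQ t (i + 1)).1.coeff (i + 1) =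
      (1 - t ^ (i + 1)) * ((basePQ t i).1 - (basePQ t i).2).coeff i ∧
      (basePQ t (i + 1)).2.coeff (i + 1) =
      (1 + t ^ (i + 1)) * -((basePQ t i).1 - (basePQ t i).2).coeff i := by
    intro i
    obtain ⟨h1, h2⟩ := basePQ_natDegree_le t i
    have e1 := coeff_eq_zero_of_natDegree_lt (Nat.lt_succ_of_le h1)
    have e2 := coeff_eq_zero_of_natDegree_lt (Nat.lt_succ_of_le h2)
    constructor
    · simp only [basePQ, coeff_C_mul, add_mul, sub_mul, one_mul, coeff_add, coeff_sub, coeff_X_mul,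
        e1, e2]
      ring
    · simp only [basePQ, coeff_C_mul, add_mul, sub_mul, one_mul, coeff_add, coeff_sub, coeff_X_mul,
        e1, e2]
      ring
  have h : ∀ i, ((basePQ t i).1 - (basePQ t i).2).coeff i = -2 ^ i := by
    intro i
    induction i with
    | zero => simp [basePQ]
    | succ i ih =>
      rw [coeff_sub, (step i).1, (step i).2, ih]
      ring
  refine ⟨h i, ?_⟩
  rw [(step i).1, h i]
  ring

theorem isCoprime_add_sub {A : Type*} [CommRing A] {S D : A} (h2 : IsUnit (2 : A))
    (h : IsCoprime S D) : IsCoprime (S + D) (S - D) := by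
  obtain ⟨c, hc⟩ := h2.exists_right_inv
  obtain ⟨a, b, hab⟩ := h
  refine ⟨c * (a + b), c * (a - b), ?_⟩
  linear_combination c * 2 * hab + hc

variable [NeZero (2 : F)]

/-- With `S = P + Q` and `D = P - Q` the next pair is, up to unit constants, `S + X D` and `S - X
D`. As `2` is invertible, it suffices that `S` is coprime to `D` (induction) and to `X` (because
`S(0) = 2^i`). -/
theorem basePQ_isCoprime {t : F} (ht : ∀ n, 0 < n → t ^ n ≠ 1) (i : ℕ) :
    IsCoprime (basePQ t i).1 (basePQ t i).2 := by
  have h2 : (2 : F) ≠ 0 := NeZero.ne 2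
  have hu2 : IsUnit (2 : F[X]) := by
    have := (isUnit_iff_ne_zero.mpr h2).map (C : F →+* F[X])
    rwa [map_ofNat] at this
  have h0 : ∀ i, (basePQ t i).1.eval 0 + (basePQ t i).2.eval 0 = 2 ^ i := by
    intro i
    induction i with
    | zero => simp [basePQ]
    | succ i ih =>
      simp only [basePQ, eval_mul, eval_C, eval_add, eval_sub, eval_one, eval_X]
      linear_combination 2 * ih
  induction i with
  | zero => simpa [basePQ] using isCoprime_one_right
  | succ i ih =>
    have h1 : IsCoprime ((basePQ t i).1 + (basePQ t i).2) X := by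
      rw [isCoprime_comm, irreducible_X.coprime_iff_not_dvd, X_dvd_iff, coeff_zero_eq_eval_zero,
        eval_add, h0]
      exact pow_ne_zero _ h2
    have h3 := isCoprime_add_sub hu2 (h1.mul_right (isCoprime_add_sub hu2 ih))
    have hu : ∀ c : F, c ≠ 0 → IsUnit (C c : F[X]) := fun c hc => (isUnit_iff_ne_zero.mpr hc).map C
    have e1 := ht (i + 1) i.succ_pos
    have e2 := pow_ne_neg_one ht (i + 1)
    simp only [basePQ]
    rw [isCoprime_mul_unit_left_left (hu _ (sub_ne_zero.mpr e1.symm)),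
      isCoprime_mul_unit_left_right (hu _ (fun h => e2 (by linear_combination h)))]
    have e3 : (1 + X) * (basePQ t i).1 + (1 - X) * (basePQ t i).2 =
        (basePQ t i).1 + (basePQ t i).2 + X * ((basePQ t i).1 - (basePQ t i).2) := by ring
    have e4 : (1 - X) * (basePQ t i).1 + (1 + X) * (basePQ t i).2 =
        (basePQ t i).1 + (basePQ t i).2 - X * ((basePQ t i).1 - (basePQ t i).2) := by ring
    rw [e3, e4]
    exact h3

omit [NeZero (2 : F)] in
-- Modulo `P` only the term with `j = 0` survives, so `P` divides `g 0`, which is too small in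
-- degree to be nonzero; divide by `P` and repeat.
theorem coeff_eq_zero_of_sum_eq_zero {P Q : F[X]} (hPQ : IsCoprime P Q) (a : ℕ) (g : ℕ → F[X])
    (hg : ∀ j ≤ a, (g j).natDegree < P.natDegree)
    (h : ∑ j ∈ Finset.range (a + 1), g j * (P ^ j * Q ^ (a - j)) = 0) : ∀ j ≤ a, g j = 0 := by
  induction a generalizing g with
  | zero =>
    intro j hj
    obtain rfl : j = 0 := by omega
    simpa using h
  | succ a ih =>
    have h1 : ∑ j ∈ Finset.range (a + 1), g (j + 1) * (P ^ (j + 1) * Q ^ (a + 1 - (j + 1))) =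
        P * ∑ j ∈ Finset.range (a + 1), g (j + 1) * (P ^ j * Q ^ (a - j)) := by
      rw [Finset.mul_sum]
      refine Finset.sum_congr rfl fun j _ => ?_
      rw [Nat.add_sub_add_right]
      ring
    rw [Finset.sum_range_succ', h1] at h
    have h2 : P ∣ g 0 * Q ^ (a + 1) := by
      refine ⟨-∑ j ∈ Finset.range (a + 1), g (j + 1) * (P ^ j * Q ^ (a - j)), ?_⟩
      simp only [pow_zero, one_mul, Nat.sub_zero] at h
      linear_combination h
    have h3 : g 0 = 0 :=
      eq_zero_of_dvd_of_natDegree_lt (hPQ.pow_right.dvd_of_dvd_mul_right h2) (hg 0 (Nat.zero_le _))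
    have hP : P ≠ 0 := by
      rintro rfl
      simpa using hg 0 (Nat.zero_le _)
    rw [h3, zero_mul, add_zero] at h
    have h4 := ih (fun j => g (j + 1)) (fun j hj => hg _ (by omega))
      ((mul_eq_zero.mp h).resolve_left hP)
    intro j hj
    rcases j with _ | j
    · exact h3
    · exact h4 j (by omega)

omit [NeZero (2 : F)] in
theorem injective_pow_of_ne_one {t : F} (ht0 : t ≠ 0) (ht : ∀ n, 0 < n → t ^ n ≠ 1) :
    Function.Injective (fun n : ℕ => t ^ n) := by
  have key : ∀ i n, t ^ i = t ^ (i + n) → n = 0 := by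
    intro i n h
    by_contra hn
    apply ht n (Nat.pos_of_ne_zero hn)
    rw [pow_add] at h
    exact (mul_left_cancel₀ (pow_ne_zero i ht0) (by rw [mul_one]; exact h)).symm
  intro i j h
  rcases le_total i j with hij | hij
  · obtain ⟨n, rfl⟩ := Nat.exists_eq_add_of_le hij
    rw [key i n h, add_zero]
  · obtain ⟨n, rfl⟩ := Nat.exists_eq_add_of_le hij
    rw [key j n h.symm, add_zero]

/-- The two directions are separated in turn: the index `j` by the growth of the degree in `ρ`, then
the index `l` because `(1 - t^i) / (1 + t^i)` takes infinitely many values. -/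
theorem eq_zero_of_infinite_sum_eq_zero {t : F} (ht0 : t ≠ 0) (ht : ∀ n, 0 < n → t ^ n ≠ 1)
    (a b : ℕ) (G : ℕ → ℕ → F[X]) {S : Set ℕ} (hS : S.Infinite)
    (h : ∀ i ∈ S, ∑ j ∈ Finset.range (a + 1), ∑ l ∈ Finset.range (b + 1),
      ((basePQ t i).1 ^ j * (basePQ t i).2 ^ (a - j) *
        C ((1 - t ^ i) ^ l * (1 + t ^ i) ^ (b - l))) * G j l = 0) :
    ∀ j ≤ a, ∀ l ≤ b, G j l = 0 := by
  have h2 : (2 : F) ≠ 0 := NeZero.ne 2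
  obtain ⟨d, hd⟩ : ∃ d, ∀ j ≤ a, ∀ l ≤ b, (G j l).natDegree ≤ d := by
    refine ⟨∑ j ∈ Finset.range (a + 1), ∑ l ∈ Finset.range (b + 1), (G j l).natDegree, ?_⟩
    intro j hj l hl
    refine (Finset.single_le_sum (f := fun l => (G j l).natDegree) (fun _ _ => Nat.zero_le _)
      (Finset.mem_range.mpr (Nat.lt_succ_of_le hl))).trans ?_
    exact Finset.single_le_sum (f := fun j => ∑ l ∈ Finset.range (b + 1), (G j l).natDegree)
      (fun _ _ => Nat.zero_le _) (Finset.mem_range.mpr (Nat.lt_succ_of_le hj))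
  intro j hj l hl
  -- For `i > d` the degree of the first coordinate exceeds that of every `G j l`.
  have hS' : (S \ {i | i ≤ d}).Infinite := hS.sdiff (Set.finite_le_nat d)
  have key : ∀ i ∈ S \ {i | i ≤ d}, ∑ l ∈ Finset.range (b + 1),
      C ((1 - t ^ i) ^ l * (1 + t ^ i) ^ (b - l)) * G j l = 0 := by
    rintro i ⟨hiS, hid⟩
    have hid : d < i := not_le.mp hid
    have hdeg : i ≤ (basePQ t i).1.natDegree := by
      obtain ⟨i, rfl⟩ := Nat.exists_eq_succ_of_ne_zero (Nat.ne_zero_of_lt hid)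
      apply le_natDegree_of_ne_zero
      rw [Nat.succ_eq_add_one, (basePQ_coeff t i).2]
      exact mul_ne_zero (neg_ne_zero.mpr (sub_ne_zero.mpr (ht (i + 1) i.succ_pos).symm))
        (pow_ne_zero _ h2)
    refine coeff_eq_zero_of_sum_eq_zero (basePQ_isCoprime ht i) a (fun j => ∑ l ∈
      Finset.range (b + 1), C ((1 - t ^ i) ^ l * (1 + t ^ i) ^ (b - l)) * G j l) ?_ ?_ j hj
    · intro j hj
      refine lt_of_le_of_lt (natDegree_sum_le_of_forall_le _ _ (n := d) fun l hl => ?_)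
        (hid.trans_le hdeg)
      exact (natDegree_C_mul_le _ _).trans (hd j hj l (by simpa [Nat.lt_succ_iff] using hl))
    · rw [← h i hiS]
      refine Finset.sum_congr rfl fun j _ => ?_
      rw [Finset.sum_mul]
      refine Finset.sum_congr rfl fun l _ => ?_
      ring
  have hne : ∀ i : ℕ, 1 + t ^ i ≠ 0 := fun i h =>
    pow_ne_neg_one ht i (by linear_combination h)
  have hinj : Function.Injective (fun i : ℕ => (1 - t ^ i) / (1 + t ^ i)) := by
    intro i i' h
    simp only at h
    rw [div_eq_div_iff (hne i) (hne i')] at h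
    apply injective_pow_of_ne_one ht0 ht
    apply mul_left_cancel₀ h2
    simp only
    linear_combination -h
  ext e
  -- Dividing the relation for `i` by `(1 + t^i)^b` makes `(1 - t^i) / (1 + t^i)` a root of this
  -- polynomial, formed from the coefficients of `X^e`.
  have hq : (∑ l ∈ Finset.range (b + 1), C ((G j l).coeff e) * X ^ l : F[X]) = 0 := by
    apply eq_zero_of_infinite_isRoot
    refine (hS'.image (hinj.injOn)).mono ?_
    rintro _ ⟨i, hi, rfl⟩
    have h3 := congrArg (fun q => coeff q e) (key i hi)
    simp only [finsetSum_coeff, coeff_C_mul, coeff_zero] at h3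
    have h4 := hne i
    change eval _ _ = 0
    rw [eval_finsetSum]
    apply mul_left_cancel₀ (pow_ne_zero b h4)
    rw [mul_zero, ← h3, Finset.mul_sum]
    refine Finset.sum_congr rfl fun l hl => ?_
    obtain ⟨n, rfl⟩ := Nat.exists_eq_add_of_le (Nat.lt_succ_iff.mp (Finset.mem_range.mp hl))
    simp only [eval_mul, eval_C, eval_pow, eval_X, Nat.add_sub_cancel_left]
    rw [div_pow, pow_add]
    field_simp
  have h5 := congrArg (fun q => coeff q l) hq
  simp only [finsetSum_coeff, coeff_C_mul, coeff_X_pow, coeff_zero] at h5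
  rw [Finset.sum_eq_single l] at h5
  · simpa using h5
  · intro l' _ hl'
    rw [if_neg (Ne.symm hl'), mul_zero]
  · intro hl'
    exact absurd (Finset.mem_range.mpr (Nat.lt_succ_of_le hl)) hl'

/-- The relations of `eq_zero_of_infinite_sum_eq_zero`, with coefficients in an extension field in
which a transcendental element is substituted for the variable. -/
theorem eq_zero_of_infinite_aeval_sum_eq_zero {L : Type*} [Field L] [Algebra F L] {r : L}
    (hr : Transcendental F r) {t : F} (ht0 : t ≠ 0) (ht : ∀ n, 0 < n → t ^ n ≠ 1)
    (a b : ℕ) (c : ℕ → ℕ → L) {S : Set ℕ} (hS : S.Infinite)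
    (h : ∀ i ∈ S, ∑ j ∈ Finset.range (a + 1), ∑ l ∈ Finset.range (b + 1),
      aeval r ((basePQ t i).1 ^ j * (basePQ t i).2 ^ (a - j) *
        C ((1 - t ^ i) ^ l * (1 + t ^ i) ^ (b - l))) * c j l = 0) :
    ∀ j ≤ a, ∀ l ≤ b, c j l = 0 := by
  let _ : Algebra F[X] L := (aeval r : F[X] →ₐ[F] L).toRingHom.toAlgebra
  have hinj : Function.Injective (algebraMap F[X] L) := transcendental_iff_injective.mp hr
  have hsmul : ∀ (q : F[X]) (x : L), q • x = aeval r q * x := fun q x => rfl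
  have : Module.IsTorsionFree F[X] L := by
    have : FaithfulSMul F[X] L := (faithfulSMul_iff_algebraMap_injective F[X] L).mpr hinj
    infer_instance
  -- The `F[X]`-span of the coefficients is finitely generated and torsion-free over a principal
  -- ideal domain, hence free. Its coordinates reduce the claim to polynomial coefficients.
  let M : Submodule F[X] L := Submodule.span F[X]
    (Set.range fun k : Fin (a + 1) × Fin (b + 1) => c k.1 k.2)
  have hfin : Module.Finite F[X] M := Module.Finite.span_of_finite _ (Set.finite_range _)
  have hfree : Module.Free F[X] M := inferInstance
  have hmem : ∀ j ≤ a, ∀ l ≤ b, c j l ∈ M := fun j hj l hl =>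
    Submodule.subset_span ⟨(⟨j, Nat.lt_succ_of_le hj⟩, ⟨l, Nat.lt_succ_of_le hl⟩), rfl⟩
  let cM : ℕ → ℕ → M := fun j l => if hjl : j ≤ a ∧ l ≤ b then ⟨c j l, hmem j hjl.1 l hjl.2⟩ else 0
  have hcM : ∀ j ≤ a, ∀ l ≤ b, (cM j l : L) = c j l := by
    intro j hj l hl
    simp only [cM, dif_pos (And.intro hj hl)]
  intro j hj l hl
  rw [← hcM j hj l hl, Submodule.coe_eq_zero]
  apply (Module.Free.chooseBasis F[X] M).ext_elem
  intro n
  rw [map_zero, Finsupp.zero_apply]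
  refine eq_zero_of_infinite_sum_eq_zero ht0 ht a b
    (fun j l => (Module.Free.chooseBasis F[X] M).repr (cM j l) n) hS ?_ j hj l hl
  intro i hi
  have h1 : ∑ j ∈ Finset.range (a + 1), ∑ l ∈ Finset.range (b + 1),
      ((basePQ t i).1 ^ j * (basePQ t i).2 ^ (a - j) *
        C ((1 - t ^ i) ^ l * (1 + t ^ i) ^ (b - l))) • cM j l = 0 := by
    apply Subtype.ext
    rw [Submodule.coe_zero, ← h i hi, Submodule.coe_sum]
    refine Finset.sum_congr rfl fun j hj => ?_
    rw [Submodule.coe_sum]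
    refine Finset.sum_congr rfl fun l hl => ?_
    rw [Submodule.coe_smul, hcM j (Nat.lt_succ_iff.mp (Finset.mem_range.mp hj)) l
      (Nat.lt_succ_iff.mp (Finset.mem_range.mp hl)), hsmul]
  have h2 := congrArg (fun x => (Module.Free.chooseBasis F[X] M).repr x n) h1
  simpa only [map_sum, map_smul, Finsupp.coe_finsetSum, Finset.sum_apply, Finsupp.smul_apply,
    smul_eq_mul, map_zero, Finsupp.zero_apply] using h2

end Heights

open MvPolynomial

section Forms

variable {𝕜 : Type*} [Field 𝕜]

/-! ## Bihomogeneous forms -/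

theorem IsForm.aeval_smul {A : Type*} [CommRing A] [Algebra 𝕜 A] {F : Coord 𝕜} {d : ℕ × ℕ}
    (hF : IsForm F d) (s t : A) (a b : Fin 2 → A) :
    aeval (Sum.elim (fun i => s * a i) (fun i => t * b i)) F =
      s ^ d.1 * t ^ d.2 * aeval (Sum.elim a b) F := by
  refine IsWeightedHomogeneous.induction_on (motive := fun F _ =>
    aeval (Sum.elim (fun i => s * a i) (fun i => t * b i)) F =
      s ^ d.1 * t ^ d.2 * aeval (Sum.elim a b) F) ?_ ?_ ?_ hF
  · simp
  · intro p q _ _ hp hq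
    rw [map_add, map_add, hp, hq, mul_add]
  · rintro e r rfl
    have h1 : (Finsupp.weight (Sum.elim (fun _ : Fin 2 => ((1, 0) : ℕ × ℕ))
        (fun _ : Fin 2 => ((0, 1) : ℕ × ℕ))) e) =
        (e (Sum.inl 0) + e (Sum.inl 1), e (Sum.inr 0) + e (Sum.inr 1)) := by
      rw [Finsupp.weight_apply, Finsupp.sum_fintype _ _ (by simp)]
      ext <;> simp [Fintype.sum_sum_type, Fin.sum_univ_two]
    rw [h1]
    simp only [aeval_monomial, Finsupp.prod_fintype _ _ (fun _ => pow_zero _),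
      Fintype.prod_sum_type, Fin.prod_univ_two, Sum.elim_inl, Sum.elim_inr]
    ring

theorem IsForm.eval_smul {F : Coord 𝕜} {d : ℕ × ℕ}
    (hF : IsForm F d) (s t : 𝕜) (a b : Fin 2 → 𝕜) :
    eval (Sum.elim (fun i => s * a i) (fun i => t * b i)) F =
      s ^ d.1 * t ^ d.2 * eval (Sum.elim a b) F := by
  simpa [coe_aeval_eq_eval] using hF.aeval_smul s t a b

theorem isForm_X_inl (i : Fin 2) : IsForm (X (Sum.inl i) : Coord 𝕜) (1, 0) :=
  isWeightedHomogeneous_X _ _ _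

theorem isForm_X_inr (i : Fin 2) : IsForm (X (Sum.inr i) : Coord 𝕜) (0, 1) :=
  isWeightedHomogeneous_X _ _ _

theorem IsForm.mul {F G : Coord 𝕜} {d e : ℕ × ℕ} (hF : IsForm F d) (hG : IsForm G e) :
    IsForm (F * G) (d + e) :=
  IsWeightedHomogeneous.mul hF hG

theorem IsForm.add {F G : Coord 𝕜} {d : ℕ × ℕ} (hF : IsForm F d) (hG : IsForm G d) :
    IsForm (F + G) d :=
  IsWeightedHomogeneous.add hF hG

theorem IsForm.sub {F G : Coord 𝕜} {d : ℕ × ℕ} (hF : IsForm F d) (hG : IsForm G d) :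
    IsForm (F - G) d :=
  IsWeightedHomogeneous.sub hF hG

theorem IsForm.C_mul {F : Coord 𝕜} {d : ℕ × ℕ} (hF : IsForm F d) (c : 𝕜) :
    IsForm (C c * F) d :=
  IsWeightedHomogeneous.C_mul hF c

theorem isForm_C (c : 𝕜) : IsForm (C c : Coord 𝕜) 0 :=
  isWeightedHomogeneous_C _ _

theorem IsForm.pow {F : Coord 𝕜} {d : ℕ × ℕ} (hF : IsForm F d) (n : ℕ) :
    IsForm (F ^ n) (n • d) :=
  IsWeightedHomogeneous.pow hF n

/-- The rational functions `x / y` and `y / y`. -/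
def hx : Fin 2 → K 𝕜 := ![u 𝕜, 1]

/-- The rational functions `z / w` and `w / w`. -/
def hz : Fin 2 → K 𝕜 := ![v 𝕜, 1]

theorem hx_ne_zero (i : Fin 2) : (hx i : K 𝕜) ≠ 0 := by
  fin_cases i
  · exact u_ne_zero
  · exact one_ne_zero

theorem hz_ne_zero (i : Fin 2) : (hz i : K 𝕜) ≠ 0 := by
  fin_cases i
  · exact v_ne_zero
  · exact one_ne_zero

theorem dehom_eq : (dehom : Coord 𝕜 →ₐ[𝕜] K 𝕜) = aeval (Sum.elim hx hz) := rfl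

@[simp] theorem dehom_X_inl (i : Fin 2) : dehom (X (Sum.inl i) : Coord 𝕜) = hx i := by
  simp [dehom_eq]

@[simp] theorem dehom_X_inr (i : Fin 2) : dehom (X (Sum.inr i) : Coord 𝕜) = hz i := by
  simp [dehom_eq]

/-- By homogeneity, the dehomogenization determines the values of `F` wherever `y` and `w` are
nonzero. Thus `F y w` vanishes at all points over an infinite field and is zero. -/
theorem IsForm.eq_zero_of_dehom [Infinite 𝕜] {F : Coord 𝕜} {d : ℕ × ℕ} (hF : IsForm F d)
    (h : dehom F = 0) : F = 0 := by
  have h1 : (aeval (Sum.elim ![X 0, 1] ![X 1, 1] : _ → MvPolynomial (Fin 2) 𝕜)) F = 0 := by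
    apply IsFractionRing.injective (MvPolynomial (Fin 2) 𝕜) (K 𝕜)
    rw [map_zero, ← h]
    have : (dehom : Coord 𝕜 →ₐ[𝕜] K 𝕜) =
        (IsScalarTower.toAlgHom 𝕜 (MvPolynomial (Fin 2) 𝕜) (K 𝕜)).comp
          (aeval (Sum.elim ![X 0, 1] ![X 1, 1] : _ → MvPolynomial (Fin 2) 𝕜)) := by
      apply MvPolynomial.algHom_ext
      rintro (i | i) <;> fin_cases i <;> simp [dehom, u, v]
    rw [this]
    rfl
  have h2 : F * (X (Sum.inl 1) * X (Sum.inr 1)) = 0 := by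
    apply MvPolynomial.funext
    intro c
    rw [map_zero, map_mul, map_mul, eval_X, eval_X]
    by_cases hc1 : c (Sum.inl 1) = 0
    · simp [hc1]
    by_cases hc2 : c (Sum.inr 1) = 0
    · simp [hc2]
    have h3 := hF.eval_smul (c (Sum.inl 1)) (c (Sum.inr 1))
      ![c (Sum.inl 0) / c (Sum.inl 1), 1] ![c (Sum.inr 0) / c (Sum.inr 1), 1]
    have h4 : Sum.elim
        (fun i => c (Sum.inl 1) * (![c (Sum.inl 0) / c (Sum.inl 1), 1] : Fin 2 → 𝕜) i)
        (fun i => c (Sum.inr 1) * (![c (Sum.inr 0) / c (Sum.inr 1), 1] : Fin 2 → 𝕜) i) = c := by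
      funext k
      rcases k with k | k <;> fin_cases k <;> simp <;> field_simp
    rw [h4] at h3
    have h5 : eval (Sum.elim ![c (Sum.inl 0) / c (Sum.inl 1), 1]
        ![c (Sum.inr 0) / c (Sum.inr 1), 1]) F = 0 := by
      have := congrArg (eval ![c (Sum.inl 0) / c (Sum.inl 1), c (Sum.inr 0) / c (Sum.inr 1)]) h1
      rw [map_zero, aeval_def, eval₂_comp_left, eval₂_eq_eval_map] at this
      convert this using 2
      · congr 1
        funext k
        rcases k with k | k <;> fin_cases k <;> simp
      · have h6 : ((eval ![c (Sum.inl 0) / c (Sum.inl 1), c (Sum.inr 0) / c (Sum.inr 1)]).comp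
          (algebraMap 𝕜 (MvPolynomial (Fin 2) 𝕜))) = RingHom.id 𝕜 := by
          ext; simp
        rw [h6, map_id]
    rw [h3, h5]
    simp
  exact (mul_eq_zero.mp h2).resolve_right (mul_ne_zero (X_ne_zero _) (X_ne_zero _))

theorem IsForm.dehom_injective [Infinite 𝕜] {F G : Coord 𝕜} {d : ℕ × ℕ} (hF : IsForm F d)
    (hG : IsForm G d) (h : dehom F = dehom G) : F = G :=
  sub_eq_zero.mp ((hF.sub hG).eq_zero_of_dehom (by rw [map_sub, h, sub_self]))

/-! ## Charts -/

/-- The affine coordinates of the chart in which the `i`-th and `j`-th homogeneous coordinate do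
not vanish. -/
def chart (i j : Fin 2) : Coord 𝕜 →ₐ[𝕜] K 𝕜 :=
  aeval (Sum.elim (fun a => (hx i)⁻¹ * hx a) (fun b => (hz j)⁻¹ * hz b))

theorem IsForm.chart_eq {F : Coord 𝕜} {d : ℕ × ℕ} (hF : IsForm F d) (i j : Fin 2) :
    chart i j F * (hx i ^ d.1 * hz j ^ d.2) = dehom F := by
  rw [chart, hF.aeval_smul, dehom_eq]
  have h1 := pow_ne_zero d.1 (hx_ne_zero (𝕜 := 𝕜) i)
  have h2 := pow_ne_zero d.2 (hz_ne_zero (𝕜 := 𝕜) j)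
  rw [inv_pow, inv_pow]
  field_simp

/-- Padding with powers of the two chart coordinates does not change values where these are `1`.
This lets arbitrary polynomials, not only forms, represent elements of the local rings. -/
theorem exists_homogenization (i j : Fin 2) (F : Coord 𝕜) :
    ∃ (d : ℕ × ℕ) (H : Coord 𝕜), IsForm H d ∧ dehom H = chart i j F * (hx i ^ d.1 * hz j ^ d.2) ∧
      ∀ c : Fin 2 ⊕ Fin 2 → 𝕜, c (Sum.inl i) = 1 → c (Sum.inr j) = 1 → eval c H = eval c F := by
  have hX : ∀ k, ∃ (d : ℕ × ℕ), IsForm (X k : Coord 𝕜) d := by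
    rintro (k | k)
    · exact ⟨_, isForm_X_inl k⟩
    · exact ⟨_, isForm_X_inr k⟩
  induction F using MvPolynomial.induction_on with
  | C a => exact ⟨0, C a, isForm_C a, ((isForm_C a).chart_eq i j).symm, fun _ _ _ => rfl⟩
  | add F G hF hG =>
    obtain ⟨d, H, hH, h1, h2⟩ := hF
    obtain ⟨d', H', hH', h1', h2'⟩ := hG
    refine ⟨d + d', H * (X (Sum.inl i) ^ d'.1 * X (Sum.inr j) ^ d'.2) +
      (X (Sum.inl i) ^ d.1 * X (Sum.inr j) ^ d.2) * H', ?_, ?_, ?_⟩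
    · have key : ∀ e : ℕ × ℕ,
          IsForm (X (Sum.inl i) ^ e.1 * X (Sum.inr j) ^ e.2 : Coord 𝕜) e := by
        intro e
        have := ((isForm_X_inl (𝕜 := 𝕜) i).pow e.1).mul ((isForm_X_inr j).pow e.2)
        simpa using this
      exact (hH.mul (key d')).add ((key d).mul hH')
    · simp only [map_add, map_mul, map_pow, dehom_X_inl, dehom_X_inr, h1, h1', Prod.fst_add,
        Prod.snd_add]
      ring
    · intro c hi hj
      simp [hi, hj, h2 c hi hj, h2' c hi hj]
  | mul_X F k hF =>
    obtain ⟨d, H, hH, h1, h2⟩ := hF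
    obtain ⟨e, he⟩ := hX k
    refine ⟨d + e, H * X k, hH.mul he, ?_, ?_⟩
    · rw [map_mul, map_mul, h1, ← he.chart_eq i j, Prod.fst_add, Prod.snd_add]
      ring
    · intro c hi hj
      rw [map_mul, map_mul, h2 c hi hj]

/-- Affine coordinates of a point, for a given chart. -/
def coords (p : T 𝕜) (i j : Fin 2) : Fin 2 ⊕ Fin 2 → 𝕜 :=
  Sum.elim (fun a => (p.1.rep i)⁻¹ * p.1.rep a) (fun b => (p.2.rep j)⁻¹ * p.2.rep b)

theorem IsForm.eval_coords {F : Coord 𝕜} {d : ℕ × ℕ} (hF : IsForm F d) (p : T 𝕜) (i j : Fin 2) :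
    eval (coords p i j) F = (p.1.rep i)⁻¹ ^ d.1 * (p.2.rep j)⁻¹ ^ d.2 * evalAt p F :=
  hF.eval_smul _ _ _ _

theorem IsForm.eval_coords_ne_zero {F : Coord 𝕜} {d : ℕ × ℕ} (hF : IsForm F d) {p : T 𝕜}
    {i j : Fin 2} (hi : p.1.rep i ≠ 0) (hj : p.2.rep j ≠ 0) :
    eval (coords p i j) F ≠ 0 ↔ evalAt p F ≠ 0 := by
  rw [hF.eval_coords]
  simp [hi, hj]

theorem exists_rep_ne_zero (P : Projectivization 𝕜 (Fin 2 → 𝕜)) : ∃ i, P.rep i ≠ 0 := by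
  by_contra! h
  exact P.rep_nonzero (funext h)

@[simp] theorem evalAt_X_inl (p : T 𝕜) (i : Fin 2) : evalAt p (X (Sum.inl i)) = p.1.rep i := by
  simp [evalAt]

@[simp] theorem evalAt_X_inr (p : T 𝕜) (i : Fin 2) : evalAt p (X (Sum.inr i)) = p.2.rep i := by
  simp [evalAt]

theorem chart_inv_mem [Infinite 𝕜] {p : T 𝕜} {i j : Fin 2} (hi : p.1.rep i ≠ 0)
    (hj : p.2.rep j ≠ 0) (F G : Coord 𝕜) (hG : eval (coords p i j) G ≠ 0) :
    chart i j G ≠ 0 ∧ chart i j F / chart i j G ∈ localRing p := by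
  obtain ⟨d, H, hH, h1, h2⟩ := exists_homogenization i j F
  obtain ⟨d', H', hH', h1', h2'⟩ := exists_homogenization i j G
  have hc1 : coords p i j (Sum.inl i) = 1 := by simp [coords, hi]
  have hc2 : coords p i j (Sum.inr j) = 1 := by simp [coords, hj]
  have hx0 := hx_ne_zero (𝕜 := 𝕜) i
  have hz0 := hz_ne_zero (𝕜 := 𝕜) j
  have hne : evalAt p H' ≠ 0 := by
    rw [← hH'.eval_coords_ne_zero hi hj, h2' _ hc1 hc2]
    exact hG
  have hG0 : chart i j G ≠ 0 := by
    intro h0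
    rw [h0, zero_mul] at h1'
    rw [hH'.eq_zero_of_dehom h1'] at hne
    simp [evalAt] at hne
  have key : ∀ e : ℕ × ℕ, IsForm (X (Sum.inl i) ^ e.1 * X (Sum.inr j) ^ e.2 : Coord 𝕜) e := by
    intro e
    have := ((isForm_X_inl (𝕜 := 𝕜) i).pow e.1).mul ((isForm_X_inr j).pow e.2)
    simpa using this
  refine ⟨hG0, d + d', H * (X (Sum.inl i) ^ d'.1 * X (Sum.inr j) ^ d'.2),
    (X (Sum.inl i) ^ d.1 * X (Sum.inr j) ^ d.2) * H', hH.mul (key d'), (key d).mul hH', ?_, ?_⟩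
  · have : evalAt p ((X (Sum.inl i) ^ d.1 * X (Sum.inr j) ^ d.2) * H') =
        (p.1.rep i ^ d.1 * p.2.rep j ^ d.2) * evalAt p H' := by simp [evalAt]
    rw [this]
    exact mul_ne_zero (mul_ne_zero (pow_ne_zero _ hi) (pow_ne_zero _ hj)) hne
  · simp only [map_mul, map_pow, dehom_X_inl, dehom_X_inr, h1, h1']
    field_simp

theorem chart_mem [Infinite 𝕜] {p : T 𝕜} {i j : Fin 2} (hi : p.1.rep i ≠ 0)
    (hj : p.2.rep j ≠ 0) (F : Coord 𝕜) : chart i j F ∈ localRing p := by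
  simpa using (chart_inv_mem hi hj F 1 (by simp)).2

theorem exists_chart_of_mem_localRing {p : T 𝕜} {f : K 𝕜} (hf : f ∈ localRing p) (i j : Fin 2) :
    ∃ (d : ℕ × ℕ) (F G : Coord 𝕜), IsForm F d ∧ IsForm G d ∧ evalAt p G ≠ 0 ∧
      f * chart i j G = chart i j F := by
  obtain ⟨d, F, G, hF, hG, hp, h⟩ := hf
  refine ⟨d, F, G, hF, hG, hp, ?_⟩
  rw [← hF.chart_eq i j, ← hG.chart_eq i j, ← mul_assoc] at h
  exact mul_right_cancel₀ (mul_ne_zero (pow_ne_zero _ (hx_ne_zero i))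
    (pow_ne_zero _ (hz_ne_zero j))) h

/-- In a chart, every element of the local ring is a polynomial times a unit. An ideal is therefore
determined by its contraction to the Noetherian ring of polynomials. -/
theorem isNoetherianRing_localRing [Infinite 𝕜] (p : T 𝕜) : IsNoetherianRing (localRing p) := by
  obtain ⟨i, hi⟩ := exists_rep_ne_zero p.1
  obtain ⟨j, hj⟩ := exists_rep_ne_zero p.2
  let χ : Coord 𝕜 →ₐ[𝕜] localRing p := (chart i j).codRestrict _ (chart_mem hi hj)
  have hmono : StrictMono (Ideal.comap χ) := by
    refine Monotone.strictMono_of_injective (fun I J h => Ideal.comap_mono h) ?_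
    intro I J h
    suffices H : ∀ I J : Ideal (localRing p), Ideal.comap χ I = Ideal.comap χ J → I ≤ J from
      le_antisymm (H I J h) (H J I h.symm)
    intro I J h f hf
    obtain ⟨d, F, G, -, hG, hp, hfG⟩ := exists_chart_of_mem_localRing f.2 i j
    obtain ⟨hG0, hinv⟩ := chart_inv_mem hi hj 1 G ((hG.eval_coords_ne_zero hi hj).mpr hp)
    have e1 : χ F = f * χ G := Subtype.ext hfG.symm
    have e2 : f = χ F * ⟨_, hinv⟩ := by
      apply Subtype.ext
      change (f : K 𝕜) = chart i j F * (chart i j 1 / chart i j G)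
      rw [map_one, ← hfG]
      field_simp
    have e3 : F ∈ Ideal.comap χ I := by
      rw [Ideal.mem_comap]
      rw [e1]
      exact I.mul_mem_right _ hf
    rw [h, Ideal.mem_comap] at e3
    rw [e2]
    exact J.mul_mem_right _ e3
  rw [isNoetherianRing_iff, isNoetherian_iff']
  have : WellFoundedGT (Ideal (Coord 𝕜)) := inferInstance
  exact hmono.wellFoundedGT

/-- Invertible stalks: `𝒪_T(aY + bW)` is generated at `p` by any form of bidegree `(a, b)` which
does not vanish at `p`. -/
theorem twist_eq_span [Infinite 𝕜] (e : ℕ × ℕ) {p : T 𝕜} {H : Coord 𝕜} (hH : IsForm H e)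
    (hp : evalAt p H ≠ 0) : twist e p = Submodule.span (localRing p) {dehom H} := by
  have hH0 : dehom H ≠ 0 := by
    intro h0
    rw [hH.eq_zero_of_dehom h0] at hp
    simp [evalAt] at hp
  apply le_antisymm
  · rintro f ⟨d, F, G, hF, hG, hGp, h⟩
    rw [Submodule.mem_span_singleton]
    refine ⟨⟨f / dehom H, d + e, F, G * H, hF, hG.mul hH, ?_, ?_⟩, ?_⟩
    · simpa [evalAt] using ⟨hGp, hp⟩
    · rw [map_mul, ← h]
      field_simp
    · change f / dehom H * dehom H = f
      field_simp
  · rw [Submodule.span_singleton_le_iff_mem]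
    exact ⟨0, H, 1, by simpa using hH, isWeightedHomogeneous_one _ _, by simp [evalAt], by simp⟩

end Forms

section Iterates

variable {𝕜 : Type*} [Field 𝕜]

/-! ## The forms which describe the iterates of `φ` -/

/-- The forms `Z_m`, `W_m` of bidegree `(0, 1)` with `(φ^m)^* v = Z_m / W_m`. -/
def itZW (θ : 𝕜) : ℕ → Fin 2 → Coord 𝕜
  | 0 => fun i => X (Sum.inr i)
  | m + 1 => ![C (θ + 1) * itZW θ m 0 + C (θ - 1) * itZW θ m 1,
      C (θ - 1) * itZW θ m 0 + C (θ + 1) * itZW θ m 1]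

/-- The forms `X_m`, `Y_m` of bidegree `(1, m)` with `(φ^m)^* u = X_m / Y_m`. -/
def itXY (ρ θ : 𝕜) : ℕ → Fin 2 → Coord 𝕜
  | 0 => fun i => X (Sum.inl i)
  | m + 1 => ![C (ρ + 1) * (itZW θ m 0 * itXY ρ θ m 0) + C (ρ - 1) * (itZW θ m 1 * itXY ρ θ m 1),
      C (ρ - 1) * (itZW θ m 0 * itXY ρ θ m 0) + C (ρ + 1) * (itZW θ m 1 * itXY ρ θ m 1)]

theorem itXY_succ_zero (ρ θ : 𝕜) (m : ℕ) : itXY ρ θ (m + 1) 0 =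
    C (ρ + 1) * (itZW θ m 0 * itXY ρ θ m 0) + C (ρ - 1) * (itZW θ m 1 * itXY ρ θ m 1) := rfl

theorem itXY_succ_one (ρ θ : 𝕜) (m : ℕ) : itXY ρ θ (m + 1) 1 =
    C (ρ - 1) * (itZW θ m 0 * itXY ρ θ m 0) + C (ρ + 1) * (itZW θ m 1 * itXY ρ θ m 1) := rfl

theorem isForm_itZW (θ : 𝕜) (m : ℕ) (i : Fin 2) : IsForm (itZW θ m i) (0, 1) := by
  induction m generalizing i with
  | zero => exact isForm_X_inr i
  | succ m ih =>
    fin_cases i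
    · exact ((ih 0).C_mul _).add ((ih 1).C_mul _)
    · exact ((ih 0).C_mul _).add ((ih 1).C_mul _)

theorem isForm_itXY (ρ θ : 𝕜) (m : ℕ) (i : Fin 2) : IsForm (itXY ρ θ m i) (1, m) := by
  induction m generalizing i with
  | zero => exact isForm_X_inl i
  | succ m ih =>
    have h : ∀ i, IsForm (itZW θ m i * itXY ρ θ m i) (1, m + 1) := fun i => by
      have := (isForm_itZW θ m i).mul (ih i)
      rwa [Prod.mk_add_mk, zero_add, add_comm] at this
    fin_cases i
    · exact ((h 0).C_mul _).add ((h 1).C_mul _)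
    · exact ((h 0).C_mul _).add ((h 1).C_mul _)

/-- `Z + W` and `Z - W` are eigenvectors of the recursion, with eigenvalues `2 θ` and `2`. This
diagonalization locates the zeros of `Z_m` and `W_m`. -/
theorem itZW_add (θ : 𝕜) (m : ℕ) :
    itZW θ m 0 + itZW θ m 1 = C (2 ^ m * θ ^ m) * (X (Sum.inr 0) + X (Sum.inr 1)) := by
  induction m with
  | zero => simp [itZW]
  | succ m ih =>
    have : itZW θ (m + 1) 0 + itZW θ (m + 1) 1 = C (2 * θ) * (itZW θ m 0 + itZW θ m 1) := by
      simp only [itZW, Matrix.cons_val_zero, Matrix.cons_val_one, C_add, C_sub, C_mul,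
        map_ofNat, C_1]
      ring
    rw [this, ih, ← mul_assoc, ← C_mul]
    congr 2
    ring

theorem itZW_sub (θ : 𝕜) (m : ℕ) :
    itZW θ m 0 - itZW θ m 1 = C (2 ^ m) * (X (Sum.inr 0) - X (Sum.inr 1)) := by
  induction m with
  | zero => simp [itZW]
  | succ m ih =>
    have : itZW θ (m + 1) 0 - itZW θ (m + 1) 1 = C 2 * (itZW θ m 0 - itZW θ m 1) := by
      simp only [itZW, Matrix.cons_val_zero, Matrix.cons_val_one, C_add, C_sub,
        map_ofNat, C_1]
      ring
    rw [this, ih, ← mul_assoc, ← C_mul]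
    congr 2
    ring

theorem eval_itZW (θ : 𝕜) (m : ℕ) (c : Fin 2 ⊕ Fin 2 → 𝕜) :
    2 * eval c (itZW θ m 0) = 2 ^ m * (θ ^ m * (c (Sum.inr 0) + c (Sum.inr 1)) +
      (c (Sum.inr 0) - c (Sum.inr 1))) ∧
    2 * eval c (itZW θ m 1) = 2 ^ m * (θ ^ m * (c (Sum.inr 0) + c (Sum.inr 1)) -
      (c (Sum.inr 0) - c (Sum.inr 1))) := by
  have h1 := congrArg (eval c) (itZW_add θ m)
  have h2 := congrArg (eval c) (itZW_sub θ m)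
  simp only [map_add, map_sub, map_mul, eval_C, eval_X] at h1 h2
  constructor
  · linear_combination h1 + h2
  · linear_combination h1 - h2

variable [NeZero (2 : 𝕜)]

theorem eval_itZW_ne_zero {θ : 𝕜} (hθ : θ ≠ 0) (m : ℕ) {c : Fin 2 ⊕ Fin 2 → 𝕜} {j : Fin 2}
    (hc : c (Sum.inr j) ≠ 0) : ∃ i, eval c (itZW θ m i) ≠ 0 := by
  by_contra! h
  obtain ⟨h1, h2⟩ := eval_itZW θ m c
  have h2' : (2 : 𝕜) ≠ 0 := NeZero.ne 2
  rw [h, mul_zero, eq_comm, mul_eq_zero, or_iff_right (pow_ne_zero _ h2')] at h1 h2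
  have h3 : 2 * θ ^ m * (c (Sum.inr 0) + c (Sum.inr 1)) = 0 := by linear_combination h1 + h2
  have h4 : c (Sum.inr 0) + c (Sum.inr 1) = 0 :=
    (mul_eq_zero.mp h3).resolve_left (mul_ne_zero h2' (pow_ne_zero _ hθ))
  have h5 : 2 * c (Sum.inr 0) = 0 := by linear_combination h1 + (1 - θ ^ m) * h4
  have h6 : 2 * c (Sum.inr 1) = 0 := by linear_combination 2 * h4 - h5
  apply hc
  fin_cases j
  · exact (mul_eq_zero.mp h5).resolve_left h2'
  · exact (mul_eq_zero.mp h6).resolve_left h2'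

theorem itZW_ne_zero {θ : 𝕜} (m : ℕ) (i : Fin 2) : itZW θ m i ≠ 0 := by
  intro h
  have h2' : (2 : 𝕜) ≠ 0 := NeZero.ne 2
  obtain ⟨h1, h2⟩ := eval_itZW θ m (Sum.elim 0 ![1, -1])
  fin_cases i
  · rw [show itZW θ m 0 = 0 from h] at h1
    simp only [map_zero, mul_zero, Sum.elim_inr, Matrix.cons_val_zero, Matrix.cons_val_one] at h1
    refine mul_ne_zero (pow_ne_zero m h2') h2' ?_
    linear_combination -h1
  · rw [show itZW θ m 1 = 0 from h] at h2
    simp only [map_zero, mul_zero, Sum.elim_inr, Matrix.cons_val_zero, Matrix.cons_val_one] at h2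
    refine mul_ne_zero (pow_ne_zero m h2') h2' ?_
    linear_combination h2

/-- Over a point of the second factor where no earlier `Z_j`, `W_j` vanishes, each step of the
recursion is an invertible linear map: a diagonal one followed by one of determinant `4 ρ`. -/
theorem exists_eval_itXY (ρ θ : 𝕜) (hρ : ρ ≠ 0) (b : Fin 2 → 𝕜) (m : ℕ)
    (hb : ∀ j < m, ∀ i, eval (Sum.elim 0 b) (itZW θ j i) ≠ 0) (t : Fin 2 → 𝕜) :
    ∃ a : Fin 2 → 𝕜, ∀ i, eval (Sum.elim a b) (itXY ρ θ m i) = t i := by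
  induction m generalizing t with
  | zero => exact ⟨t, fun i => by simp [itXY]⟩
  | succ m ih =>
    have h2 : (2 : 𝕜) ≠ 0 := NeZero.ne 2
    have h0 := hb m (Nat.lt_succ_self m) 0
    have h1 := hb m (Nat.lt_succ_self m) 1
    obtain ⟨a, ha⟩ := ih (fun j hj => hb j (Nat.lt_succ_of_lt hj))
      ![((ρ + 1) * t 0 - (ρ - 1) * t 1) / (2 * 2 * ρ * eval (Sum.elim 0 b) (itZW θ m 0)),
        ((ρ + 1) * t 1 - (ρ - 1) * t 0) / (2 * 2 * ρ * eval (Sum.elim 0 b) (itZW θ m 1))]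
    have hind : ∀ i, eval (Sum.elim a b) (itZW θ m i) = eval (Sum.elim 0 b) (itZW θ m i) := by
      intro i
      have := (isForm_itZW θ m i).eval_smul 0 1 a b
      simpa [Pi.zero_def] using this.symm
    have ha0 := ha 0
    have ha1 := ha 1
    simp only [Matrix.cons_val_zero, Matrix.cons_val_one] at ha0 ha1
    refine ⟨a, Fin.forall_fin_two.mpr ⟨?_, ?_⟩⟩
    · rw [itXY_succ_zero]
      simp only [map_add, map_mul, eval_C, hind, ha0, ha1]
      field_simp
      ring
    · rw [itXY_succ_one]
      simp only [map_add, map_mul, eval_C, hind, ha0, ha1]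
      field_simp
      ring

theorem irreducible_itZW (θ : 𝕜) (m : ℕ) (i : Fin 2) : Irreducible (itZW θ m i) := by
  have hlin : ∀ m i, (itZW θ m i).IsHomogeneous 1 := by
    intro m
    induction m with
    | zero => exact fun i => isHomogeneous_X _ _
    | succ m ih =>
      intro i
      have h : ∀ a b : 𝕜, (C a * itZW θ m 0 + C b * itZW θ m 1).IsHomogeneous 1 := fun a b =>
        ((ih 0).C_mul a).add ((ih 1).C_mul b)
      fin_cases i
      · exact h _ _
      · exact h _ _
  apply irreducible_of_totalDegree_eq_one
  · exact (hlin m i).totalDegree (itZW_ne_zero m i)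
  · intro x hx
    rw [isUnit_iff_ne_zero]
    rintro rfl
    refine itZW_ne_zero (θ := θ) m i (MvPolynomial.ext _ _ fun k => ?_)
    rw [coeff_zero]
    exact zero_dvd_iff.mp (hx k)

/-- On the curve `Z_m = 0` (or `W_m = 0`) none of the earlier `Z_j`, `W_j` vanishes, since `θ^j ≠ ±
θ^m`. So both `X_m` and `Y_m` take the value `1` somewhere on this curve. -/
theorem not_dvd_itXY {ρ θ : 𝕜} (hρ : ρ ≠ 0) (hθ0 : θ ≠ 0) (hθ : ∀ n, 0 < n → θ ^ n ≠ 1) (m : ℕ)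
    (i k : Fin 2) : ¬ itZW θ m i ∣ itXY ρ θ m k := by
  rintro ⟨Q, hQ⟩
  have h2 : (2 : 𝕜) ≠ 0 := NeZero.ne 2
  have hne : ∀ j < m, θ ^ j - θ ^ m ≠ 0 ∧ θ ^ j + θ ^ m ≠ 0 := by
    intro j hj
    obtain ⟨n, rfl⟩ := Nat.exists_eq_add_of_lt hj
    have e1 := hθ (n + 1) n.succ_pos
    have e2 := pow_ne_neg_one hθ (n + 1)
    constructor
    · intro h
      have : θ ^ j * (1 - θ ^ (n + 1)) = 0 := by linear_combination h
      exact e1 (sub_eq_zero.mp ((mul_eq_zero.mp this).resolve_left (pow_ne_zero _ hθ0))).symm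
    · intro h
      have : θ ^ j * (1 + θ ^ (n + 1)) = 0 := by linear_combination h
      have := (mul_eq_zero.mp this).resolve_left (pow_ne_zero _ hθ0)
      exact e2 (by linear_combination this)
  -- The zero of `Z_m` is `[1 - θ^m : 1 + θ^m]`, and that of `W_m` is `[1 + θ^m : 1 - θ^m]`.
  obtain ⟨b, hb0, hb⟩ : ∃ b : Fin 2 → 𝕜, (∀ a, eval (Sum.elim a b) (itZW θ m i) = 0) ∧
      ∀ j < m, ∀ i, eval (Sum.elim 0 b) (itZW θ j i) ≠ 0 := by
    have key : ∀ (j : ℕ) (i : Fin 2) (a b : Fin 2 → 𝕜),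
        2 * eval (Sum.elim a b) (itZW θ j i) = 2 ^ j * (θ ^ j * (b 0 + b 1) +
        (![1, -1] : Fin 2 → 𝕜) i * (b 0 - b 1)) := by
      intro j i a b
      obtain ⟨h1, h2⟩ := eval_itZW θ j (Sum.elim a b)
      fin_cases i
      · simpa using h1
      · simpa [sub_eq_add_neg] using h2
    fin_cases i
    · refine ⟨![1 - θ ^ m, 1 + θ ^ m], fun a => ?_, fun j hj i h0 => ?_⟩
      · have := key m 0 a ![1 - θ ^ m, 1 + θ ^ m]
        simp only [Matrix.cons_val_zero, Matrix.cons_val_one] at this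
        refine (mul_eq_zero_iff_left h2).mp ?_
        refine this.trans ?_
        ring
      · have := key j i 0 ![1 - θ ^ m, 1 + θ ^ m]
        rw [h0] at this
        obtain ⟨e1, e2⟩ := hne j hj
        fin_cases i
        · simp only [Matrix.cons_val_zero, Matrix.cons_val_one, Fin.zero_eta] at this
          refine mul_ne_zero (mul_ne_zero (pow_ne_zero j h2) h2) e1 ?_
          linear_combination -this
        · simp only [Matrix.cons_val_zero, Matrix.cons_val_one, Fin.mk_one] at this
          refine mul_ne_zero (mul_ne_zero (pow_ne_zero j h2) h2) e2 ?_
          linear_combination -this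
    · refine ⟨![1 + θ ^ m, 1 - θ ^ m], fun a => ?_, fun j hj i h0 => ?_⟩
      · have := key m 1 a ![1 + θ ^ m, 1 - θ ^ m]
        simp only [Matrix.cons_val_zero, Matrix.cons_val_one] at this
        refine (mul_eq_zero_iff_left h2).mp ?_
        refine this.trans ?_
        ring
      · have := key j i 0 ![1 + θ ^ m, 1 - θ ^ m]
        rw [h0] at this
        obtain ⟨e1, e2⟩ := hne j hj
        fin_cases i
        · simp only [Matrix.cons_val_zero, Matrix.cons_val_one, Fin.zero_eta] at this
          refine mul_ne_zero (mul_ne_zero (pow_ne_zero j h2) h2) e2 ?_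
          linear_combination -this
        · simp only [Matrix.cons_val_zero, Matrix.cons_val_one, Fin.mk_one] at this
          refine mul_ne_zero (mul_ne_zero (pow_ne_zero j h2) h2) e1 ?_
          linear_combination -this
  obtain ⟨a, ha⟩ := exists_eval_itXY ρ θ hρ b m hb 1
  have h3 := ha k
  rw [hQ, map_mul, hb0, zero_mul] at h3
  exact zero_ne_one h3

/-- Inverting the recursion, a common prime factor of `X_{m+1}` and `Y_{m+1}` divides both `Z_m X_m`
and `W_m Y_m`. The four resulting cases are excluded by the coprimality of `Z_m` and `W_m`, by
`not_dvd_itXY` (twice), and by induction. It follows that `φ^m` is undefined exactly at the common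
zeros of `X_m` and `Y_m`. -/
theorem not_prime_dvd_itXY {ρ θ : 𝕜} (hρ : ρ ≠ 0) (hθ0 : θ ≠ 0) (hθ : ∀ n, 0 < n → θ ^ n ≠ 1)
    (m : ℕ) {π : Coord 𝕜} (hπ : Prime π) (h0 : π ∣ itXY ρ θ m 0) : ¬ π ∣ itXY ρ θ m 1 := by
  have h2 : (2 : 𝕜) ≠ 0 := NeZero.ne 2
  induction m with
  | zero =>
    intro h1
    have e0 := h0.trans (dvd_refl (X (Sum.inl 0)))
    have e1 := h1.trans (dvd_refl (X (Sum.inl 1)))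
    have a0 := (hπ.irreducible.dvd_irreducible_iff_associated (X_prime).irreducible).mp e0
    have a1 := (hπ.irreducible.dvd_irreducible_iff_associated (X_prime).irreducible).mp e1
    obtain ⟨Q, hQ⟩ := (a0.symm.trans a1).dvd
    have := congrArg (eval (Sum.elim ![0, 1] 0)) hQ
    simp at this
  | succ m ih =>
    intro h1
    have hu : IsUnit (C (2 * 2 * ρ) : Coord 𝕜) :=
      (isUnit_iff_ne_zero.mpr (mul_ne_zero (mul_ne_zero h2 h2) hρ)).map C
    have d0 : π ∣ itZW θ m 0 * itXY ρ θ m 0 := by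
      rw [← hu.dvd_mul_left]
      have : C (2 * 2 * ρ) * (itZW θ m 0 * itXY ρ θ m 0) =
          C (ρ + 1) * itXY ρ θ (m + 1) 0 - C (ρ - 1) * itXY ρ θ (m + 1) 1 := by
        simp only [itXY_succ_zero, itXY_succ_one, C_add, C_sub, C_mul, C_1, map_ofNat]
        ring
      rw [this]
      exact dvd_sub (h0.mul_left _) (h1.mul_left _)
    have d1 : π ∣ itZW θ m 1 * itXY ρ θ m 1 := by
      rw [← hu.dvd_mul_left]
      have : C (2 * 2 * ρ) * (itZW θ m 1 * itXY ρ θ m 1) =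
          C (ρ + 1) * itXY ρ θ (m + 1) 1 - C (ρ - 1) * itXY ρ θ (m + 1) 0 := by
        simp only [itXY_succ_zero, itXY_succ_one, C_add, C_sub, C_mul, C_1, map_ofNat]
        ring
      rw [this]
      exact dvd_sub (h1.mul_left _) (h0.mul_left _)
    have hZ : ∀ i k, π ∣ itZW θ m i → ¬ π ∣ itXY ρ θ m k := fun i k hi hk =>
      not_dvd_itXY hρ hθ0 hθ m i k (((hπ.irreducible.dvd_irreducible_iff_associated
        (irreducible_itZW θ m i)).mp hi).symm.dvd.trans hk)
    rcases hπ.dvd_or_dvd d0 with d0 | d0 <;> rcases hπ.dvd_or_dvd d1 with d1 | d1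
    · obtain ⟨Q, hQ⟩ := ((hπ.irreducible.dvd_irreducible_iff_associated
        (irreducible_itZW θ m 0)).mp d0).symm.dvd.trans d1
      obtain ⟨i, hi⟩ := eval_itZW_ne_zero hθ0 m (c := Sum.elim 0 ![1 - θ ^ m, 1 + θ ^ m])
        (j := 1) (by
          intro h
          change 1 + θ ^ m = 0 at h
          exact pow_ne_neg_one hθ m (by linear_combination h))
      have e0 : eval (Sum.elim 0 ![1 - θ ^ m, 1 + θ ^ m]) (itZW θ m 0) = 0 := by
        refine (mul_eq_zero_iff_left h2).mp ?_
        rw [(eval_itZW θ m _).1]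
        simp only [Sum.elim_inr, Matrix.cons_val_zero, Matrix.cons_val_one]
        ring
      have e1 := congrArg (eval (Sum.elim 0 ![1 - θ ^ m, 1 + θ ^ m])) hQ
      rw [map_mul, e0, zero_mul] at e1
      fin_cases i
      · exact hi e0
      · exact hi e1
    · exact hZ 0 1 d0 d1
    · exact hZ 1 0 d1 d0
    · exact ih d0 d1

end Iterates

/-! ### Pullback of functions and forms along the iterates of `φ`. -/

section Pullback

variable {𝕜 : Type*} [Field 𝕜] (ρ θ : 𝕜ˣ)

theorem map_linear (ψ : K 𝕜 ≃ₐ[𝕜] K 𝕜) (a b : 𝕜) (f : K 𝕜) :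
    ψ (algebraMap 𝕜 (K 𝕜) a * f + algebraMap 𝕜 (K 𝕜) b) =
      algebraMap 𝕜 (K 𝕜) a * ψ f + algebraMap 𝕜 (K 𝕜) b := by
  rw [map_add, map_mul, AlgEquiv.commutes, AlgEquiv.commutes]

theorem phi_linear_ne_zero (ψ : K 𝕜 ≃ₐ[𝕜] K 𝕜) {a b : 𝕜} (h : a ≠ 0 ∨ b ≠ 0) :
    algebraMap 𝕜 (K 𝕜) a * (ψ (u 𝕜 * v 𝕜)) + algebraMap 𝕜 (K 𝕜) b ≠ 0 := by
  intro h0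
  have h1 : ψ (algebraMap (MvPolynomial (Fin 2) 𝕜) (K 𝕜) (C a * (X 0 * X 1) + C b)) = 0 := by
    rw [← h0, map_add, map_mul, map_mul, ← MvPolynomial.algebraMap_eq,
      ← IsScalarTower.algebraMap_apply, ← IsScalarTower.algebraMap_apply, map_add, map_mul,
      AlgEquiv.commutes, AlgEquiv.commutes]
    rfl
  rw [map_eq_zero_iff _ ψ.injective,
    map_eq_zero_iff _ (IsFractionRing.injective (MvPolynomial (Fin 2) 𝕜) (K 𝕜))] at h1
  have e0 := congrArg (eval ![0, 0]) h1
  have e1 := congrArg (eval ![1, 1]) h1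
  simp only [map_add, map_mul, eval_C, eval_X, map_zero, Matrix.cons_val_zero,
    Matrix.cons_val_one, mul_zero, zero_add, mul_one] at e0 e1
  rw [e0, add_zero] at e1
  exact h.elim (fun h => h e1) (fun h => h e0)

/-- Pullback of forms along `φ^m`. -/
def substIt (m : ℕ) : Coord 𝕜 →ₐ[𝕜] Coord 𝕜 :=
  aeval (Sum.elim (itXY (ρ : 𝕜) θ m) (itZW (θ : 𝕜) m))

theorem eval_substIt (m : ℕ) (c : Fin 2 ⊕ Fin 2 → 𝕜) (F : Coord 𝕜) :
    eval c (substIt ρ θ m F) = eval (Sum.elim (fun i => eval c (itXY (ρ : 𝕜) θ m i))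
      (fun i => eval c (itZW (θ : 𝕜) m i))) F := by
  have : (aeval c : Coord 𝕜 →ₐ[𝕜] 𝕜).comp (substIt ρ θ m) =
      aeval (Sum.elim (fun i => eval c (itXY (ρ : 𝕜) θ m i))
      (fun i => eval c (itZW (θ : 𝕜) m i))) := by
    apply MvPolynomial.algHom_ext
    rintro (i | i) <;> simp [substIt]
  have := DFunLike.congr_fun this F
  simpa [coe_aeval_eq_eval] using this

/-- The growth of the second degree is the action of `φ^m` on the Picard group, `(a, b) ↦ (a, m a +
b)`. -/
theorem isForm_substIt (m : ℕ) {F : Coord 𝕜} {d : ℕ × ℕ} (hF : IsForm F d) :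
    IsForm (substIt ρ θ m F) (d.1, m * d.1 + d.2) := by
  refine IsWeightedHomogeneous.induction_on (motive := fun F _ =>
    IsForm (substIt ρ θ m F) (d.1, m * d.1 + d.2)) ?_ ?_ ?_ hF
  · rw [map_zero]
    exact isWeightedHomogeneous_zero _ _ _
  · intro p q _ _ hp hq
    rw [map_add]
    exact hp.add hq
  · rintro e r rfl
    have h1 : (Finsupp.weight (Sum.elim (fun _ : Fin 2 => ((1, 0) : ℕ × ℕ))
        (fun _ : Fin 2 => ((0, 1) : ℕ × ℕ))) e) =
        (e (Sum.inl 0) + e (Sum.inl 1), e (Sum.inr 0) + e (Sum.inr 1)) := by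
      rw [Finsupp.weight_apply, Finsupp.sum_fintype _ _ (by simp)]
      ext <;> simp [Fintype.sum_sum_type, Fin.sum_univ_two]
    rw [h1]
    simp only [substIt, aeval_monomial, Finsupp.prod_fintype _ _ (fun _ => pow_zero _),
      Fintype.prod_sum_type, Fin.prod_univ_two, Sum.elim_inl, Sum.elim_inr]
    have := ((((isForm_itXY (ρ : 𝕜) θ m 0).pow (e (Sum.inl 0))).mul
      ((isForm_itXY (ρ : 𝕜) θ m 1).pow (e (Sum.inl 1)))).mul
      (((isForm_itZW (θ : 𝕜) m 0).pow (e (Sum.inr 0))).mul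
      ((isForm_itZW (θ : 𝕜) m 1).pow (e (Sum.inr 1))))).C_mul r
    convert this using 1
    · rw [algebraMap_eq]
    · ext
      · simp only [Prod.fst_add, Prod.smul_fst, smul_eq_mul]
        ring
      · simp only [Prod.snd_add, Prod.smul_snd, smul_eq_mul]
        ring

variable [NeZero (2 : 𝕜)]

theorem phi_pow_succ (m : ℕ) (f : K 𝕜) :
    (phi ρ θ ^ (m + 1)) f = (phi ρ θ ^ m) (phi ρ θ f) := by
  rw [pow_succ]
  rfl

theorem dehom_itZW_ne_zero [Infinite 𝕜] (m : ℕ) (i : Fin 2) : dehom (itZW (θ : 𝕜) m i) ≠ 0 :=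
  fun h => itZW_ne_zero m i ((isForm_itZW (θ : 𝕜) m i).eq_zero_of_dehom h)

theorem phi_pow_v [Infinite 𝕜] (m : ℕ) :
    (phi ρ θ ^ m) (v 𝕜) * dehom (itZW (θ : 𝕜) m 1) = dehom (itZW (θ : 𝕜) m 0) := by
  induction m with
  | zero => simp [itZW, hz]
  | succ m ih =>
    have h1 := dehom_itZW_ne_zero θ m 1
    have h2 := dehom_itZW_ne_zero θ (m + 1) 1
    have hC : ∀ c : 𝕜, dehom (C c : Coord 𝕜) = algebraMap 𝕜 (K 𝕜) c := fun c => by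
      rw [← MvPolynomial.algebraMap_eq, AlgHom.commutes]
    have e : ∀ a b : 𝕜, dehom (C a * itZW (θ : 𝕜) m 0 + C b * itZW (θ : 𝕜) m 1) =
        (algebraMap 𝕜 (K 𝕜) a * ((phi ρ θ ^ m) (v 𝕜)) + algebraMap 𝕜 (K 𝕜) b) *
          dehom (itZW (θ : 𝕜) m 1) := by
      intro a b
      simp only [map_add, map_mul, hC, ← ih]
      ring
    change dehom (C ((θ : 𝕜) - 1) * itZW (θ : 𝕜) m 0 + C ((θ : 𝕜) + 1) * itZW (θ : 𝕜) m 1) ≠ 0 at h2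
    change _ * dehom (C ((θ : 𝕜) - 1) * itZW (θ : 𝕜) m 0 + C ((θ : 𝕜) + 1) * itZW (θ : 𝕜) m 1) =
      dehom (C ((θ : 𝕜) + 1) * itZW (θ : 𝕜) m 0 + C ((θ : 𝕜) - 1) * itZW (θ : 𝕜) m 1)
    rw [e] at h2
    rw [e, e, phi_pow_succ, phi_v, moebius, map_div₀, ← mul_assoc, map_linear, map_linear,
      div_mul_cancel₀ _ (left_ne_zero_of_mul h2)]

theorem phi_pow_u [Infinite 𝕜] (m : ℕ) :
    dehom (itXY (ρ : 𝕜) θ m 0) ≠ 0 ∧ dehom (itXY (ρ : 𝕜) θ m 1) ≠ 0 ∧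
    (phi ρ θ ^ m) (u 𝕜) * dehom (itXY (ρ : 𝕜) θ m 1) = dehom (itXY (ρ : 𝕜) θ m 0) := by
  induction m with
  | zero => simp [itXY, hx, u_ne_zero]
  | succ m ih =>
    obtain ⟨hX, hY, hu⟩ := ih
    have hv := phi_pow_v ρ θ m
    have h1 := dehom_itZW_ne_zero θ m 1
    have hC : ∀ c : 𝕜, dehom (C c : Coord 𝕜) = algebraMap 𝕜 (K 𝕜) c := fun c => by
      rw [← MvPolynomial.algebraMap_eq, AlgHom.commutes]
    have e : ∀ a b : 𝕜, dehom (C a * (itZW (θ : 𝕜) m 0 * itXY (ρ : 𝕜) θ m 0) +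
        C b * (itZW (θ : 𝕜) m 1 * itXY (ρ : 𝕜) θ m 1)) =
        (algebraMap 𝕜 (K 𝕜) a * ((phi ρ θ ^ m) (u 𝕜 * v 𝕜)) + algebraMap 𝕜 (K 𝕜) b) *
          (dehom (itZW (θ : 𝕜) m 1) * dehom (itXY (ρ : 𝕜) θ m 1)) := by
      intro a b
      simp only [map_add, map_mul, hC, ← hu, ← hv]
      ring
    have hh : ((ρ : 𝕜) + 1 ≠ 0 ∨ (ρ : 𝕜) - 1 ≠ 0) := by
      by_contra! h
      refine NeZero.ne (2 : 𝕜) ?_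
      linear_combination h.1 - h.2
    have hne := mul_ne_zero h1 hY
    refine ⟨?_, ?_, ?_⟩
    · change dehom (C ((ρ : 𝕜) + 1) * (itZW (θ : 𝕜) m 0 * itXY (ρ : 𝕜) θ m 0) +
        C ((ρ : 𝕜) - 1) * (itZW (θ : 𝕜) m 1 * itXY (ρ : 𝕜) θ m 1)) ≠ 0
      rw [e]
      exact mul_ne_zero (phi_linear_ne_zero _ hh) hne
    · change dehom (C ((ρ : 𝕜) - 1) * (itZW (θ : 𝕜) m 0 * itXY (ρ : 𝕜) θ m 0) +
        C ((ρ : 𝕜) + 1) * (itZW (θ : 𝕜) m 1 * itXY (ρ : 𝕜) θ m 1)) ≠ 0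
      rw [e]
      exact mul_ne_zero (phi_linear_ne_zero _ hh.symm) hne
    · change _ * dehom (C ((ρ : 𝕜) - 1) * (itZW (θ : 𝕜) m 0 * itXY (ρ : 𝕜) θ m 0) +
        C ((ρ : 𝕜) + 1) * (itZW (θ : 𝕜) m 1 * itXY (ρ : 𝕜) θ m 1)) =
        dehom (C ((ρ : 𝕜) + 1) * (itZW (θ : 𝕜) m 0 * itXY (ρ : 𝕜) θ m 0) +
        C ((ρ : 𝕜) - 1) * (itZW (θ : 𝕜) m 1 * itXY (ρ : 𝕜) θ m 1))
      rw [e, e, phi_pow_succ, phi_u, moebius, map_div₀, ← mul_assoc]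
      congr 1
      rw [map_linear, map_linear]
      exact div_mul_cancel₀ _ (phi_linear_ne_zero _ hh.symm)

theorem dehom_itXY_ne_zero [Infinite 𝕜] (m : ℕ) (i : Fin 2) :
    dehom (itXY (ρ : 𝕜) (θ : 𝕜) m i) ≠ 0 := by
  fin_cases i
  · exact (phi_pow_u ρ θ m).1
  · exact (phi_pow_u ρ θ m).2.1

theorem phi_pow_hx [Infinite 𝕜] (m : ℕ) (i : Fin 2) :
    dehom (itXY (ρ : 𝕜) θ m 1) * (phi ρ θ ^ m) (hx i) = dehom (itXY (ρ : 𝕜) θ m i) := by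
  revert i
  rw [Fin.forall_fin_two]
  constructor
  · rw [← (phi_pow_u ρ θ m).2.2, mul_comm]; rfl
  · simp [hx]

theorem phi_pow_hz [Infinite 𝕜] (m : ℕ) (i : Fin 2) :
    dehom (itZW (θ : 𝕜) m 1) * (phi ρ θ ^ m) (hz i) = dehom (itZW (θ : 𝕜) m i) := by
  revert i
  rw [Fin.forall_fin_two]
  constructor
  · rw [← phi_pow_v ρ θ m, mul_comm]; rfl
  · simp [hz]

theorem dehom_substIt [Infinite 𝕜] (m : ℕ) {F : Coord 𝕜} {d : ℕ × ℕ} (hF : IsForm F d) :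
    dehom (substIt ρ θ m F) = dehom (itXY (ρ : 𝕜) θ m 1) ^ d.1 * dehom (itZW (θ : 𝕜) m 1) ^ d.2 *
      (phi ρ θ ^ m) (dehom F) := by
  have h1 : dehom (substIt ρ θ m F) =
      aeval (Sum.elim (fun i => dehom (itXY (ρ : 𝕜) θ m 1) * (phi ρ θ ^ m) (hx i))
        (fun i => dehom (itZW (θ : 𝕜) m 1) * (phi ρ θ ^ m) (hz i))) F := by
    rw [substIt, ← AlgHom.comp_apply]
    congr 1
    apply MvPolynomial.algHom_ext
    rintro (i | i)
    · rw [AlgHom.comp_apply, aeval_X, aeval_X, Sum.elim_inl, Sum.elim_inl, phi_pow_hx]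
    · rw [AlgHom.comp_apply, aeval_X, aeval_X, Sum.elim_inr, Sum.elim_inr, phi_pow_hz]
  have h2 : (phi ρ θ ^ m) (dehom F) = aeval (Sum.elim (fun i => (phi ρ θ ^ m) (hx i))
        (fun i => (phi ρ θ ^ m) (hz i))) F := by
    have : ((phi ρ θ ^ m : K 𝕜 ≃ₐ[𝕜] K 𝕜) : K 𝕜 →ₐ[𝕜] K 𝕜).comp dehom =
        aeval (Sum.elim (fun i => (phi ρ θ ^ m) (hx i)) (fun i => (phi ρ θ ^ m) (hz i))) := by
      apply MvPolynomial.algHom_ext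
      rintro (i | i) <;> simp
    exact DFunLike.congr_fun this F
  rw [h1, h2]
  exact hF.aeval_smul _ _ _ _

end Pullback

section Hartogs

variable {𝕜 : Type*} [Field 𝕜]

/-! ## Extension of rational functions over finite sets of points -/

/-- The point with given homogeneous coordinates. -/
def ptOf (a b : Fin 2 → 𝕜) (ha : a ≠ 0) (hb : b ≠ 0) : T 𝕜 :=
  (Projectivization.mk 𝕜 a ha, Projectivization.mk 𝕜 b hb)

theorem IsForm.evalAt_ptOf {F : Coord 𝕜} {d : ℕ × ℕ} (hF : IsForm F d) {a b : Fin 2 → 𝕜}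
    (ha : a ≠ 0) (hb : b ≠ 0) :
    evalAt (ptOf a b ha hb) F ≠ 0 ↔ eval (Sum.elim a b) F ≠ 0 := by
  obtain ⟨s, hs⟩ := Projectivization.exists_smul_eq_mk_rep 𝕜 a ha
  obtain ⟨t, ht⟩ := Projectivization.exists_smul_eq_mk_rep 𝕜 b hb
  have : evalAt (ptOf a b ha hb) F =
      eval (Sum.elim (fun i => (s : 𝕜) * a i) (fun i => (t : 𝕜) * b i)) F := by
    rw [evalAt, ptOf, ← hs, ← ht]
    rfl
  rw [this, hF.eval_smul]
  simp

theorem exists_forms (h : K 𝕜) : ∃ (d : ℕ × ℕ) (F G : Coord 𝕜), IsForm F d ∧ IsForm G d ∧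
    G ≠ 0 ∧ h * dehom G = dehom F := by
  obtain ⟨a, b, hb, rfl⟩ := IsFractionRing.div_surjective (MvPolynomial (Fin 2) 𝕜) h
  have hren : ∀ a : MvPolynomial (Fin 2) 𝕜, chart 1 1 (rename ![Sum.inl 0, Sum.inr 0] a) =
      algebraMap (MvPolynomial (Fin 2) 𝕜) (K 𝕜) a := by
    intro a
    have : (chart 1 1).comp (rename ![Sum.inl 0, Sum.inr 0]) =
        IsScalarTower.toAlgHom 𝕜 (MvPolynomial (Fin 2) 𝕜) (K 𝕜) := by
      apply MvPolynomial.algHom_ext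
      intro i
      fin_cases i <;> simp [chart, hx, hz, u, v]
    exact DFunLike.congr_fun this a
  have hbne : algebraMap (MvPolynomial (Fin 2) 𝕜) (K 𝕜) b ≠ 0 :=
    IsFractionRing.to_map_ne_zero_of_mem_nonZeroDivisors hb
  obtain ⟨d, H, hH, h1, -⟩ := exists_homogenization 1 1 (rename ![Sum.inl 0, Sum.inr 0] a)
  obtain ⟨d', H', hH', h1', -⟩ := exists_homogenization 1 1 (rename ![Sum.inl 0, Sum.inr 0] b)
  have key : ∀ e : ℕ × ℕ, IsForm (X (Sum.inl 1) ^ e.1 * X (Sum.inr 1) ^ e.2 : Coord 𝕜) e ∧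
      dehom (X (Sum.inl 1) ^ e.1 * X (Sum.inr 1) ^ e.2 : Coord 𝕜) = 1 := by
    intro e
    have := ((isForm_X_inl (𝕜 := 𝕜) 1).pow e.1).mul ((isForm_X_inr 1).pow e.2)
    exact ⟨by simpa using this, by simp [hx, hz]⟩
  have e1 : (hx 1 : K 𝕜) = 1 := rfl
  have e2 : (hz 1 : K 𝕜) = 1 := rfl
  rw [hren, e1, e2, one_pow, one_pow, mul_one, mul_one] at h1 h1'
  have h2 : dehom ((X (Sum.inl 1) ^ d.1 * X (Sum.inr 1) ^ d.2) * H') ≠ 0 := by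
    rw [map_mul, (key d).2, one_mul, h1']
    exact hbne
  refine ⟨d + d', H * (X (Sum.inl 1) ^ d'.1 * X (Sum.inr 1) ^ d'.2),
    (X (Sum.inl 1) ^ d.1 * X (Sum.inr 1) ^ d.2) * H', hH.mul (key d').1, (key d).1.mul hH', ?_, ?_⟩
  · intro h0
    rw [h0, map_zero] at h2
    exact h2 rfl
  · rw [map_mul _ _ H', map_mul _ H, (key d).2, (key d').2, h1, h1', one_mul, mul_one,
      div_mul_cancel₀ _ hbne]

/-- A Hartogs principle: `A` and `B` have no common prime factor, so their common zero set has
codimension two. If the reduced denominator of `h` vanished at `p`, it would have a prime factor `π`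
through `p`. Since `h` is not regular on `π = 0`, both `A` and `B` would vanish there near `p`, and
`π` would divide both. -/
theorem mem_localRing_of_forall [IsAlgClosed 𝕜] {p : T 𝕜} {h : K 𝕜} {d e e' : ℕ × ℕ}
    {G A B : Coord 𝕜}
    (hG : IsForm G d) (hp : evalAt p G ≠ 0) (hA : IsForm A e) (hB : IsForm B e')
    (hAB : ∀ π, Prime π → π ∣ A → ¬ π ∣ B)
    (H : ∀ q, evalAt q G ≠ 0 → evalAt q A ≠ 0 ∨ evalAt q B ≠ 0 → h ∈ localRing q) :
    h ∈ localRing p := by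
  have : Infinite 𝕜 := IsAlgClosed.instInfinite
  obtain ⟨i, hi⟩ := exists_rep_ne_zero p.1
  obtain ⟨j, hj⟩ := exists_rep_ne_zero p.2
  obtain ⟨d, F₁, F₂, hF₁, hF₂, hne, hF⟩ := exists_forms h
  obtain ⟨F₂', F₁', g, hrel, rfl, rfl⟩ :=
    UniqueFactorizationMonoid.exists_reduced_factors F₂ hne F₁
  have hg : g ≠ 0 := left_ne_zero_of_mul hne
  have hF₂' : F₂' ≠ 0 := right_ne_zero_of_mul hne
  by_cases h0 : eval (coords p i j) F₂' = 0
  · exfalso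
    obtain ⟨f, hf, hprod⟩ := UniqueFactorizationMonoid.exists_prime_factors F₂' hF₂'
    have h1 : eval (coords p i j) f.prod = 0 := by
      obtain ⟨w, hw⟩ := hprod.symm
      rw [← hw, map_mul, h0, zero_mul]
    rw [map_multiset_prod, Multiset.prod_eq_zero_iff, Multiset.mem_map] at h1
    obtain ⟨π, hπf, hπ0⟩ := h1
    have hπ := hf π hπf
    have hπF : π ∣ F₂' := (Multiset.dvd_prod hπf).trans hprod.dvd
    have hπI : (Ideal.span {π}).IsPrime := (Ideal.span_singleton_prime hπ.ne_zero).mpr hπ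
    have key : ∀ (A : Coord 𝕜) (e : ℕ × ℕ), IsForm A e →
        (∀ q, evalAt q G ≠ 0 → evalAt q A ≠ 0 → h ∈ localRing q) → π ∣ A := by
      intro A e hA H
      -- Nullstellensatz: the product vanishes on the hypersurface `π = 0`. The coordinate factors
      -- exclude tuples which do not define a point of `T`, and `G` restricts to the neighbourhood
      -- of `p`.
      have h2 : π ∣ G * (X (Sum.inl i) * X (Sum.inr j)) * A := by
        rw [← Ideal.mem_span_singleton, ← MvPolynomial.IsPrime.vanishingIdeal_zeroLocus (k := 𝕜)
          (K := 𝕜) (Ideal.span {π})]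
        rw [mem_vanishingIdeal_iff]
        intro c hc
        rw [mem_zeroLocus_iff] at hc
        have hev : ∀ P : Coord 𝕜, aeval c P = eval c P := fun P => rfl
        have hc := hc π (Ideal.mem_span_singleton_self π)
        rw [hev] at hc ⊢
        by_contra hcon
        rw [map_mul, map_mul, map_mul, eval_X, eval_X] at hcon
        have hcA := right_ne_zero_of_mul hcon
        have hcG := left_ne_zero_of_mul (left_ne_zero_of_mul hcon)
        have hcX := right_ne_zero_of_mul (left_ne_zero_of_mul hcon)
        have ha : (fun i => c (Sum.inl i)) ≠ 0 := fun h =>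
          left_ne_zero_of_mul hcX (congrFun h i)
        have hb : (fun i => c (Sum.inr i)) ≠ 0 := fun h =>
          right_ne_zero_of_mul hcX (congrFun h j)
        have hcc : Sum.elim (fun i => c (Sum.inl i)) (fun i => c (Sum.inr i)) = c := by
          funext k
          rcases k with k | k <;> rfl
        obtain ⟨d', A', B', hA', hB', hq, hAB'⟩ := H (ptOf _ _ ha hb)
          ((hG.evalAt_ptOf ha hb).mpr (by rwa [hcc])) ((hA.evalAt_ptOf ha hb).mpr (by rwa [hcc]))
        rw [hB'.evalAt_ptOf ha hb, hcc] at hq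
        have h3 : (g * F₁') * B' = A' * (g * F₂') := by
          apply (hF₁.mul hB').dehom_injective
          · rw [add_comm d d']
            exact hA'.mul hF₂
          · rw [map_mul _ _ B', map_mul _ A', ← hF, ← hAB']
            ring
        have h4 : F₁' * B' = A' * F₂' := by
          apply mul_left_cancel₀ hg
          linear_combination h3
        have h5 : F₂' ∣ B' := hrel.dvd_of_dvd_mul_left (Dvd.intro_left A' h4.symm)
        obtain ⟨Q, rfl⟩ := hπF.trans h5
        rw [map_mul, hc, zero_mul] at hq
        exact hq rfl
      -- At the normalized coordinates of `p`, the prime `π` vanishes while `G` and the two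
      -- coordinates do not.
      have hnd : ¬ π ∣ G * (X (Sum.inl i) * X (Sum.inr j)) := by
        rintro ⟨Q, hQ⟩
        have h6 := congrArg (eval (coords p i j)) hQ
        rw [map_mul, map_mul, map_mul, hπ0, zero_mul, eval_X, eval_X] at h6
        have e1 := (hG.eval_coords_ne_zero hi hj).mpr hp
        have e2 : coords p i j (Sum.inl i) = 1 := by simp [coords, hi]
        have e3 : coords p i j (Sum.inr j) = 1 := by simp [coords, hj]
        rw [e2, e3, mul_one, mul_one] at h6
        exact e1 h6
      exact (hπ.dvd_or_dvd h2).resolve_left hnd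
    exact hAB π hπ (key A e hA fun q h1 h2 => H q h1 (Or.inl h2))
      (key B e' hB fun q h1 h2 => H q h1 (Or.inr h2))
  · obtain ⟨hne0, hmem⟩ := chart_inv_mem hi hj F₁' F₂' h0
    convert hmem using 1
    rw [eq_div_iff hne0]
    rw [← hF₁.chart_eq i j, ← hF₂.chart_eq i j, ← mul_assoc] at hF
    have h1 := mul_right_cancel₀ (mul_ne_zero (pow_ne_zero _ (hx_ne_zero i))
      (pow_ne_zero _ (hz_ne_zero j))) hF
    have hg0 : chart i j g ≠ 0 := by
      intro h0
      have := hF₂.chart_eq i j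
      rw [map_mul, h0, zero_mul, zero_mul] at this
      exact hne (hF₂.eq_zero_of_dehom this.symm)
    apply mul_left_cancel₀ hg0
    rw [map_mul, map_mul] at h1
    linear_combination h1

theorem IsForm.dehom_ne_zero [Infinite 𝕜] {F : Coord 𝕜} {d : ℕ × ℕ} (hF : IsForm F d) {p : T 𝕜}
    (hp : evalAt p F ≠ 0) : dehom F ≠ 0 := by
  intro h
  rw [hF.eq_zero_of_dehom h] at hp
  simp [evalAt] at hp

theorem IsForm.div_mem_localRing [Infinite 𝕜] {F G : Coord 𝕜} {d : ℕ × ℕ} (hF : IsForm F d)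
    (hG : IsForm G d) {p : T 𝕜} (hp : evalAt p G ≠ 0) : dehom F / dehom G ∈ localRing p :=
  ⟨d, F, G, hF, hG, hp, div_mul_cancel₀ _ (hG.dehom_ne_zero hp)⟩

theorem isForm_substIt_one {ρ θ : 𝕜ˣ} (m : ℕ) {F : Coord 𝕜} (hF : IsForm F (1, 1)) :
    IsForm (substIt ρ θ m F) (1, m + 1) := by
  simpa using isForm_substIt ρ θ m hF

end Hartogs

section PullbackTwist

variable {𝕜 : Type*} [Field 𝕜] [NeZero (2 : 𝕜)] {ρ θ : 𝕜ˣ}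

/-! ## The sheaves `ℒ^{φ^m}` -/

theorem mapsTo_ptOf [Infinite 𝕜] (m : ℕ) {q : T 𝕜}
    (h1 : (fun i => evalAt q (itXY (ρ : 𝕜) θ m i)) ≠ 0)
    (h2 : (fun i => evalAt q (itZW (θ : 𝕜) m i)) ≠ 0) :
    MapsTo (phi ρ θ ^ m) q (ptOf _ _ h1 h2) := by
  rintro f ⟨d, F, G, hF, hG, hr, h⟩
  refine ⟨_, _, _, isForm_substIt ρ θ m hF, isForm_substIt ρ θ m hG, ?_, ?_⟩
  · rw [hG.evalAt_ptOf] at hr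
    rw [evalAt, eval_substIt]
    exact hr
  · rw [dehom_substIt ρ θ m hF, dehom_substIt ρ θ m hG, ← h, map_mul]
    ring

/-- The functions `x_k / x_i` are regular at `r`, so their pullbacks, the quotients of `X_m` and
`Y_m` in one order or the other, are regular at `q`. Since `X_m` and `Y_m` are coprime, the
denominator form `itXY ρ θ m i` divides a form which does not vanish at `q`. -/
theorem evalAt_itXY_of_mapsTo [Infinite 𝕜] (hθ : ∀ n, 0 < n → (θ : 𝕜) ^ n ≠ 1) {m : ℕ} {q r : T 𝕜}
    (h : MapsTo (phi ρ θ ^ m) q r) {i : Fin 2} (hi : r.1.rep i ≠ 0) :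
    evalAt q (itXY (ρ : 𝕜) θ m i) ≠ 0 := by
  have key : ∀ k, ∃ (d : ℕ × ℕ) (F G : Coord 𝕜), IsForm F d ∧ IsForm G d ∧ evalAt q G ≠ 0 ∧
      itXY (ρ : 𝕜) θ m k * G = F * itXY (ρ : 𝕜) θ m i := by
    intro k
    obtain ⟨d, F, G, hF, hG, hq, hh⟩ := h (hx k / hx i)
      ⟨_, X (Sum.inl k), X (Sum.inl i), isForm_X_inl k, isForm_X_inl i, by simpa, by
        rw [dehom_X_inl, dehom_X_inl, div_mul_cancel₀ _ (hx_ne_zero i)]⟩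
    refine ⟨d, F, G, hF, hG, hq, ?_⟩
    apply ((isForm_itXY (ρ : 𝕜) θ m k).mul hG).dehom_injective
    · rw [add_comm]
      exact hF.mul (isForm_itXY (ρ : 𝕜) θ m i)
    · rw [map_mul, map_mul, ← hh, ← phi_pow_hx ρ θ m k, ← phi_pow_hx ρ θ m i, map_div₀]
      have : (phi ρ θ ^ m) (hx i) ≠ 0 := (map_ne_zero_iff _ (AlgEquiv.injective _)).mpr (hx_ne_zero i)
      field_simp
  have hdvd : ∀ k, k ≠ i → ∃ (G : Coord 𝕜), evalAt q G ≠ 0 ∧ itXY (ρ : 𝕜) θ m i ∣ G := by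
    intro k hk
    obtain ⟨d, F, G, hF, hG, hq, hh⟩ := key k
    refine ⟨G, hq, ?_⟩
    have hne : itXY (ρ : 𝕜) (θ : 𝕜) m i ≠ 0 := fun h0 =>
      dehom_itXY_ne_zero ρ θ m i (by rw [h0, map_zero])
    refine UniqueFactorizationMonoid.dvd_of_dvd_mul_right_of_no_prime_factors hne ?_
      (Dvd.intro_left F hh.symm)
    intro π hπi hπk hπ
    have := @not_prime_dvd_itXY 𝕜 _ _ (ρ : 𝕜) θ ρ.ne_zero θ.ne_zero hθ m π hπ
    fin_cases i <;> fin_cases k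
    · exact hk rfl
    · exact this hπi hπk
    · exact this hπk hπi
    · exact hk rfl
  obtain ⟨G, hG, Q, rfl⟩ : ∃ (G : Coord 𝕜), evalAt q G ≠ 0 ∧ itXY (ρ : 𝕜) θ m i ∣ G := by
    fin_cases i
    · exact hdvd 1 (by decide)
    · exact hdvd 0 (by decide)
  intro h0
  rw [evalAt] at hG h0
  rw [map_mul, h0, zero_mul] at hG
  exact hG rfl

theorem evalAt_itZW_ne_zero (θ : 𝕜ˣ) (m : ℕ) (q : T 𝕜) : ∃ i, evalAt q (itZW (θ : 𝕜) m i) ≠ 0 := by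
  obtain ⟨j, hj⟩ := exists_rep_ne_zero q.2
  exact eval_itZW_ne_zero θ.ne_zero m (j := j) hj

theorem evalAt_itZW_of_mapsTo [Infinite 𝕜] {m : ℕ} {q r : T 𝕜}
    (h : MapsTo (phi ρ θ ^ m) q r) {j : Fin 2} (hj : r.2.rep j ≠ 0) :
    evalAt q (itZW (θ : 𝕜) m j) ≠ 0 := by
  obtain ⟨k, hk⟩ := evalAt_itZW_ne_zero θ m q
  obtain ⟨d, F, G, hF, hG, hq, hh⟩ := h (hz k / hz j)
    ⟨_, X (Sum.inr k), X (Sum.inr j), isForm_X_inr k, isForm_X_inr j, by simpa, by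
      rw [dehom_X_inr, dehom_X_inr, div_mul_cancel₀ _ (hz_ne_zero j)]⟩
  have h1 : itZW (θ : 𝕜) m k * G = F * itZW (θ : 𝕜) m j := by
    apply ((isForm_itZW (θ : 𝕜) m k).mul hG).dehom_injective
    · rw [add_comm]
      exact hF.mul (isForm_itZW (θ : 𝕜) m j)
    · rw [map_mul, map_mul, ← hh, ← phi_pow_hz ρ θ m k, ← phi_pow_hz ρ θ m j, map_div₀]
      have : (phi ρ θ ^ m) (hz j) ≠ 0 := (map_ne_zero_iff _ (AlgEquiv.injective _)).mpr (hz_ne_zero j)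
      field_simp
  intro h0
  have h2 := congrArg (evalAt q) h1
  simp only [evalAt, map_mul] at h2 h0 hk hq
  rw [h0, mul_zero] at h2
  exact mul_ne_zero hk hq h2

/-- The denominator of `ℒ^{φ^m}`. -/
def denom (ρ θ : 𝕜ˣ) (m : ℕ) : K 𝕜 := dehom (itXY (ρ : 𝕜) θ m 1) * dehom (itZW (θ : 𝕜) m 1)

theorem denom_ne_zero [Infinite 𝕜] (ρ θ : 𝕜ˣ) (m : ℕ) : denom ρ θ m ≠ 0 :=
  mul_ne_zero (dehom_itXY_ne_zero ρ θ m 1) (dehom_itZW_ne_zero θ m 1)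

theorem phi_pow_dehom_mul [Infinite 𝕜] (m : ℕ) {F : Coord 𝕜} (hF : IsForm F (1, 1)) :
    (phi ρ θ ^ m) (dehom F) = dehom (substIt ρ θ m F) / denom ρ θ m := by
  rw [dehom_substIt ρ θ m hF, eq_div_iff (denom_ne_zero ρ θ m), denom]
  ring

/-- Where `φ^m` is defined, a local generator of `𝒪(1, 1)` at the image pulls back to a form of
bidegree `(1, m + 1)` over `denom`. The remaining points are the common zeros of the coprime forms
`X_m`, `Y_m`, and Hartogs' principle extends the description across them. -/
theorem pullback_twist [IsAlgClosed 𝕜] (hθ : ∀ n, 0 < n → (θ : 𝕜) ^ n ≠ 1) (m : ℕ) {p : T 𝕜}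
    {H : Coord 𝕜} (hH : IsForm H (1, m + 1)) (hp : evalAt p H ≠ 0) :
    pullback (phi ρ θ ^ m) (twist (1, 1)) p =
      Submodule.span (localRing p) {dehom H / denom ρ θ m} := by
  have : Infinite 𝕜 := IsAlgClosed.instInfinite
  have hD := denom_ne_zero ρ θ m
  have hX : ∀ i j : Fin 2, IsForm (X (Sum.inl i) * X (Sum.inr j) : Coord 𝕜) (1, 1) := fun i j =>
    (isForm_X_inl i).mul (isForm_X_inr j)
  apply le_antisymm
  · rintro f ⟨d, G, hG, hGp, hf⟩
    have hH0 := hH.dehom_ne_zero hp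
    rw [Submodule.mem_span_singleton]
    suffices h : f * denom ρ θ m / dehom H ∈ localRing p by
      refine ⟨⟨_, h⟩, ?_⟩
      change f * denom ρ θ m / dehom H * (dehom H / denom ρ θ m) = f
      field_simp
    -- It suffices to work at points `q` where `X_m` or `Y_m` does not vanish; there the image of
    -- `q` is explicit.
    refine mem_localRing_of_forall (hG.mul hH) (by simpa [evalAt] using ⟨hGp, hp⟩)
      (isForm_itXY (ρ : 𝕜) θ m 0) (isForm_itXY (ρ : 𝕜) θ m 1)
      (fun π hπ => not_prime_dvd_itXY ρ.ne_zero θ.ne_zero hθ m hπ) ?_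
    intro q hGH hq
    have hGH' : evalAt q G ≠ 0 ∧ evalAt q H ≠ 0 := by simpa [evalAt] using hGH
    have h1 : (fun i => evalAt q (itXY (ρ : 𝕜) θ m i)) ≠ 0 := by
      intro h0
      exact hq.elim (fun h => h (congrFun h0 0)) (fun h => h (congrFun h0 1))
    have h2 : (fun i => evalAt q (itZW (θ : 𝕜) m i)) ≠ 0 := by
      intro h0
      obtain ⟨i, hi⟩ := evalAt_itZW_ne_zero θ m q
      exact hi (congrFun h0 i)
    obtain ⟨i, hi⟩ := Function.ne_iff.mp h1
    obtain ⟨j, hj⟩ := Function.ne_iff.mp h2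
    have hr : evalAt (ptOf _ _ h1 h2) (X (Sum.inl i) * X (Sum.inr j)) ≠ 0 := by
      rw [(hX i j).evalAt_ptOf]
      simpa using ⟨hi, hj⟩
    have h3 := hf q _ hGH'.1 (mapsTo_ptOf m h1 h2)
    rw [twist_eq_span (1, 1) (hX i j) hr] at h3
    have h4 : Submodule.span (localRing q) ((phi ρ θ ^ m) ''
        ((Submodule.span (localRing (ptOf _ _ h1 h2))
          {(dehom (X (Sum.inl i) * X (Sum.inr j)) : K 𝕜)} : Submodule _ (K 𝕜)) : Set (K 𝕜))) ≤
        Submodule.span (localRing q) {dehom H / denom ρ θ m} := by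
      rw [Submodule.span_le]
      rintro _ ⟨g, hg, rfl⟩
      obtain ⟨a, rfl⟩ := Submodule.mem_span_singleton.mp hg
      have h5 := mapsTo_ptOf m h1 h2 a a.2
      change (phi ρ θ ^ m) ((a : K 𝕜) * dehom (X (Sum.inl i) * X (Sum.inr j))) ∈ _
      rw [map_mul, phi_pow_dehom_mul m (hX i j)]
      refine Submodule.mem_span_singleton.mpr ⟨⟨_, mul_mem h5
        ((isForm_substIt_one (ρ := ρ) (θ := θ) m (hX i j)).div_mem_localRing hH hGH'.2)⟩, ?_⟩
      change (phi ρ θ ^ m) (a : K 𝕜) * (dehom (substIt ρ θ m (X (Sum.inl i) * X (Sum.inr j))) /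
        dehom H) * (dehom H / denom ρ θ m) = _
      field_simp
    obtain ⟨a, ha⟩ := Submodule.mem_span_singleton.mp (h4 h3)
    have h6 : f * denom ρ θ m / dehom H = a := by
      rw [← ha]
      change (a : K 𝕜) * (dehom H / denom ρ θ m) * denom ρ θ m / dehom H = a
      field_simp
    rw [h6]
    exact a.2
  · rw [Submodule.span_singleton_le_iff_mem]
    -- Every pair `q`, `r` with `MapsTo` has to be treated. A monomial `x_i z_j` nonzero at `r`
    -- generates there, and its pullback is nonzero at `q` by the two lemmas on `MapsTo`.
    refine ⟨_, H, hH, hp, fun q r hq hqr => ?_⟩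
    obtain ⟨i, hi⟩ := exists_rep_ne_zero r.1
    obtain ⟨j, hj⟩ := exists_rep_ne_zero r.2
    have h1 := evalAt_itXY_of_mapsTo hθ hqr hi
    have h2 := evalAt_itZW_of_mapsTo hqr hj
    have hs : evalAt q (substIt ρ θ m (X (Sum.inl i) * X (Sum.inr j))) ≠ 0 := by
      simpa [evalAt, substIt] using ⟨h1, h2⟩
    have hs0 := (isForm_substIt_one m (hX i j)).dehom_ne_zero hs
    have h3 : (phi ρ θ ^ m) (dehom (X (Sum.inl i) * X (Sum.inr j))) ∈
        Submodule.span (localRing q) ((phi ρ θ ^ m) '' (twist (1, 1) r : Set (K 𝕜))) := by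
      refine Submodule.subset_span ⟨_, ?_, rfl⟩
      rw [twist_eq_span (1, 1) (hX i j) (by simpa [evalAt] using ⟨hi, hj⟩)]
      exact Submodule.mem_span_singleton_self _
    have h4 := Submodule.smul_mem _ (⟨_, hH.div_mem_localRing (isForm_substIt_one m (hX i j)) hs⟩ :
      localRing q) h3
    convert h4 using 1
    change _ = dehom H / dehom (substIt ρ θ m (X (Sum.inl i) * X (Sum.inr j))) *
      (phi ρ θ ^ m) (dehom (X (Sum.inl i) * X (Sum.inr j)))
    rw [phi_pow_dehom_mul m (hX i j)]
    field_simp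

end PullbackTwist

section BasePoints

variable {𝕜 : Type*} [Field 𝕜]

/-! ## Base points -/

/-- The powers are those of `a 1` and `b 0` because the first family of base points has `a = (Q, P)`
and `b = (1 - θ^i, 1 + θ^i)`. Its equations then have the shape used in
`eq_zero_of_infinite_sum_eq_zero`. -/
theorem IsForm.exists_coeffs {F : Coord 𝕜} {d : ℕ × ℕ} (hF : IsForm F d) :
    ∃ c : ℕ → ℕ → 𝕜, ∀ a b : Fin 2 → 𝕜, eval (Sum.elim a b) F =
      ∑ j ∈ Finset.range (d.1 + 1), ∑ l ∈ Finset.range (d.2 + 1),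
        (a 1 ^ j * a 0 ^ (d.1 - j) * (b 0 ^ l * b 1 ^ (d.2 - l))) * c j l := by
  refine IsWeightedHomogeneous.induction_on (motive := fun F _ =>
    ∃ c : ℕ → ℕ → 𝕜, ∀ a b : Fin 2 → 𝕜, eval (Sum.elim a b) F =
      ∑ j ∈ Finset.range (d.1 + 1), ∑ l ∈ Finset.range (d.2 + 1),
        (a 1 ^ j * a 0 ^ (d.1 - j) * (b 0 ^ l * b 1 ^ (d.2 - l))) * c j l) ?_ ?_ ?_ hF
  · exact ⟨0, by simp⟩
  · rintro p q - - ⟨c, hc⟩ ⟨c', hc'⟩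
    refine ⟨c + c', fun a b => ?_⟩
    rw [map_add, hc, hc']
    simp only [Pi.add_apply, mul_add, Finset.sum_add_distrib]
  · rintro e r rfl
    have h1 : (Finsupp.weight (Sum.elim (fun _ : Fin 2 => ((1, 0) : ℕ × ℕ))
        (fun _ : Fin 2 => ((0, 1) : ℕ × ℕ))) e) =
        (e (Sum.inl 0) + e (Sum.inl 1), e (Sum.inr 0) + e (Sum.inr 1)) := by
      rw [Finsupp.weight_apply, Finsupp.sum_fintype _ _ (by simp)]
      ext <;> simp [Fintype.sum_sum_type, Fin.sum_univ_two]
    rw [h1]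
    refine ⟨fun j l => if j = e (Sum.inl 1) ∧ l = e (Sum.inr 0) then r else 0, fun a b => ?_⟩
    rw [Finset.sum_eq_single (e (Sum.inl 1)), Finset.sum_eq_single (e (Sum.inr 0))]
    · simp only [eval_monomial, Finsupp.prod_fintype _ _ (fun _ => pow_zero _),
        Fintype.prod_sum_type, Fin.prod_univ_two, Sum.elim_inl, Sum.elim_inr, and_self, if_true,
        Nat.add_sub_cancel, Nat.add_sub_cancel_left]
      ring
    · intro l _ hl
      simp [hl]
    · intro h
      exact absurd (Finset.mem_range.mpr (by simp only; omega)) h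
    · intro j _ hj
      simp [hj]
    · intro h
      exact absurd (Finset.mem_range.mpr (by simp only; omega)) h

/-- Homogeneous coordinates of the points which are blown up by the iterates of `φ`. -/
def baseVal (ρ θ : 𝕜) : ℕ → 𝕜 × 𝕜
  | 0 => (0, 1)
  | i + 1 => ((1 - θ ^ (i + 1)) * ((1 + ρ) * (baseVal ρ θ i).1 + (1 - ρ) * (baseVal ρ θ i).2),
      (1 + θ ^ (i + 1)) * ((1 - ρ) * (baseVal ρ θ i).1 + (1 + ρ) * (baseVal ρ θ i).2))

theorem aeval_basePQ {F : Type*} [Field F] [Algebra F 𝕜] (ρ : 𝕜) (t : F) (i : ℕ) :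
    (Polynomial.aeval ρ (basePQ t i).1 : 𝕜) = (baseVal ρ (algebraMap F 𝕜 t) i).1 ∧
    (Polynomial.aeval ρ (basePQ t i).2 : 𝕜) = (baseVal ρ (algebraMap F 𝕜 t) i).2 := by
  induction i with
  | zero => simp [basePQ, baseVal]
  | succ i ih =>
    simp only [basePQ, baseVal, map_mul, map_add, map_sub, map_one, Polynomial.aeval_X,
      Polynomial.aeval_C, map_pow, ih.1, ih.2, and_self]

variable {ρ θ : 𝕜}

theorem pow_ne_one_of_algebraicIndependent
    (h : AlgebraicIndependent (⊥ : Subfield 𝕜) ![ρ, θ]) (n : ℕ) (hn : 0 < n) : θ ^ n ≠ 1 := by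
  intro h1
  have h2 : Transcendental (⊥ : Subfield 𝕜) θ := h.transcendental 1
  refine h2 (IsAlgebraic.of_pow hn ?_)
  rw [h1]
  exact isAlgebraic_one

theorem transcendental_adjoin_of_algebraicIndependent
    (h : AlgebraicIndependent (⊥ : Subfield 𝕜) ![ρ, θ]) :
    Transcendental (IntermediateField.adjoin (⊥ : Subfield 𝕜) {θ}) ρ := by
  have h1 := h.transcendental_adjoin (s := {1}) (i := 0) (by simp)
  have h2 : (![ρ, θ] : Fin 2 → 𝕜) '' {1} = {θ} := by simp
  rw [h2] at h1
  exact IntermediateField.transcendental_adjoin_iff.mpr h1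

variable [NeZero (2 : 𝕜)]

/-- Let `k` be the field generated by `θ` over the prime field. Then `ρ` is transcendental over `k`,
and the coordinates of the base points are polynomials in `ρ` over `k` of growing degree. This is
the situation of `eq_zero_of_infinite_aeval_sum_eq_zero`. -/
theorem IsForm.finite_eval_baseVal (h : AlgebraicIndependent (⊥ : Subfield 𝕜) ![ρ, θ])
    {F : Coord 𝕜} {d : ℕ × ℕ} (hF : IsForm F d) (hF0 : F ≠ 0) :
    {i | eval (Sum.elim ![(baseVal ρ θ i).2, (baseVal ρ θ i).1] ![1 - θ ^ i, 1 + θ ^ i]) F = 0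
      }.Finite ∧
    {i | eval (Sum.elim ![(baseVal ρ θ i).1, (baseVal ρ θ i).2] ![1 + θ ^ i, 1 - θ ^ i]) F = 0
      }.Finite := by
  have : Infinite 𝕜 := by
    apply Infinite.of_injective (fun n : ℕ => θ ^ n)
    exact injective_pow_of_ne_one (by simpa using h.ne_zero 1)
      (pow_ne_one_of_algebraicIndependent h)
  obtain ⟨c, hc⟩ := hF.exists_coeffs
  let k := IntermediateField.adjoin (⊥ : Subfield 𝕜) {θ}
  let t : k := ⟨θ, IntermediateField.mem_adjoin_simple_self _ θ⟩
  have htθ : algebraMap k 𝕜 t = θ := rfl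
  have hk2 : NeZero (2 : k) := ⟨fun h0 => NeZero.ne (2 : 𝕜) (by
    have := congrArg (algebraMap k 𝕜) h0
    rwa [map_ofNat, map_zero] at this)⟩
  have ht0 : t ≠ 0 := fun h0 => h.ne_zero 1 (congrArg (algebraMap k 𝕜) h0)
  have ht : ∀ n, 0 < n → t ^ n ≠ 1 := fun n hn h1 =>
    pow_ne_one_of_algebraicIndependent h n hn (by
      have := congrArg (algebraMap k 𝕜) h1
      rwa [map_pow, map_one] at this)
  have key : ∀ c : ℕ → ℕ → 𝕜,
      {i | ∑ j ∈ Finset.range (d.1 + 1), ∑ l ∈ Finset.range (d.2 + 1),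
        ((baseVal ρ θ i).1 ^ j * (baseVal ρ θ i).2 ^ (d.1 - j) *
          ((1 - θ ^ i) ^ l * (1 + θ ^ i) ^ (d.2 - l))) * c j l = 0}.Infinite →
      ∀ j ≤ d.1, ∀ l ≤ d.2, c j l = 0 := by
    intro c hinf
    refine eq_zero_of_infinite_aeval_sum_eq_zero
      (transcendental_adjoin_of_algebraicIndependent h) ht0 ht d.1 d.2 c hinf ?_
    intro i hi
    rw [← Set.mem_ofPred.mp hi]
    refine Finset.sum_congr rfl fun j _ => Finset.sum_congr rfl fun l _ => ?_
    simp only [map_mul, map_pow, (aeval_basePQ ρ t i).1, (aeval_basePQ ρ t i).2,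
      Polynomial.aeval_C, map_sub, map_add, map_one]
    rfl
  have hne : ¬ ∀ j ≤ d.1, ∀ l ≤ d.2, c j l = 0 := by
    intro h0
    apply hF0
    apply MvPolynomial.funext
    intro x
    have hx : x = Sum.elim (fun i => x (Sum.inl i)) (fun i => x (Sum.inr i)) := by
      funext k
      rcases k with k | k <;> rfl
    rw [hx, hc, map_zero]
    refine Finset.sum_eq_zero fun j hj => Finset.sum_eq_zero fun l hl => ?_
    rw [h0 j (Nat.lt_succ_iff.mp (Finset.mem_range.mp hj)) l
      (Nat.lt_succ_iff.mp (Finset.mem_range.mp hl)), mul_zero]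
  constructor
  · by_contra hinf
    refine hne (key c ?_)
    convert! hinf using 3
    funext i
    rw [hc]
    simp
  · by_contra hinf
    refine hne fun j hj l hl => ?_
    -- The second family exchanges the coordinates in both factors, which reverses both indices of
    -- the coefficients.
    have h1 := key (fun j l => c (d.1 - j) (d.2 - l)) ?_ (d.1 - j) (Nat.sub_le _ _) (d.2 - l)
      (Nat.sub_le _ _)
    · simpa only [Nat.sub_sub_self hj, Nat.sub_sub_self hl] using h1
    · convert! hinf using 3
      funext i
      rw [hc, ← Finset.sum_flip]
      congr! 1
      refine Finset.sum_congr rfl fun j hj => ?_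
      rw [← Finset.sum_flip]
      refine Finset.sum_congr rfl fun l hl => ?_
      have hj := Nat.lt_succ_iff.mp (Finset.mem_range.mp hj)
      have hl := Nat.lt_succ_iff.mp (Finset.mem_range.mp hl)
      simp only [Matrix.cons_val_zero, Matrix.cons_val_one, Nat.sub_sub_self hj,
        Nat.sub_sub_self hl]
      ring

/-- The recursion is run backwards from the point `[1 : 0]` at level `m` down to level `0`. It is
stated for arbitrary sequences so that it applies also after exchanging `x, y` and `z, w`. -/
theorem baseVal_cross (hρ : ρ ≠ 0) (m : ℕ) (x y z w : ℕ → 𝕜)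
    (hx : ∀ j, x (j + 1) = (ρ + 1) * (z j * x j) + (ρ - 1) * (w j * y j))
    (hy : ∀ j, y (j + 1) = (ρ - 1) * (z j * x j) + (ρ + 1) * (w j * y j))
    (hz0 : ∀ j < m, z j ≠ 0) (hw0 : ∀ j < m, w j ≠ 0)
    (hzw : ∀ j < m, z j * (1 + θ ^ (m - j)) = w j * (1 - θ ^ (m - j))) (hym : y m = 0) :
    y 0 * (baseVal ρ θ m).2 = x 0 * (baseVal ρ θ m).1 := by
  have h2 : (2 : 𝕜) ≠ 0 := NeZero.ne 2
  suffices h : ∀ s ≤ m, y (m - s) * (baseVal ρ θ s).2 = x (m - s) * (baseVal ρ θ s).1 by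
    simpa using h m le_rfl
  intro s
  induction s with
  | zero => simp [baseVal, hym]
  | succ s ih =>
    intro hs
    have ih := ih (by omega)
    obtain ⟨j, rfl⟩ := Nat.exists_eq_add_of_le hs
    have e1 : s + 1 + j - s = j + 1 := by omega
    have e2 : s + 1 + j - (s + 1) = j := by omega
    have e3 : s + 1 + j - j = s + 1 := by omega
    have hzj := hz0 j (by omega)
    have hwj := hw0 j (by omega)
    have hr := hzw j (by omega)
    rw [e3] at hr
    rw [e1] at ih
    rw [e2]
    have hX : 2 * 2 * ρ * (z j * x j) = (ρ + 1) * x (j + 1) + (1 - ρ) * y (j + 1) := by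
      rw [hx, hy]; ring
    have hY : 2 * 2 * ρ * (w j * y j) = (ρ + 1) * y (j + 1) + (1 - ρ) * x (j + 1) := by
      rw [hx, hy]; ring
    -- The nonzero factor `4 ρ z_j w_j` clears the denominators of the inverse recursion given by
    -- `hX` and `hY`.
    apply mul_left_cancel₀ (mul_ne_zero (mul_ne_zero (mul_ne_zero h2 h2) hρ) (mul_ne_zero hzj hwj))
    simp only [baseVal]
    set P := (baseVal ρ θ s).1
    set Q := (baseVal ρ θ s).2
    calc 2 * 2 * ρ * (z j * w j) * (y j * ((1 + θ ^ (s + 1)) * ((1 - ρ) * P + (1 + ρ) * Q)))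
        = (2 * 2 * ρ * (w j * y j)) * (z j * (1 + θ ^ (s + 1))) *
          ((1 - ρ) * P + (1 + ρ) * Q) := by ring
      _ = (2 * 2 * ρ * (z j * x j)) * (w j * (1 - θ ^ (s + 1))) *
          ((1 + ρ) * P + (1 - ρ) * Q) := by
          rw [hX, hY, hr]
          linear_combination (w j * (1 - θ ^ (s + 1))) * 2 * 2 * ρ * ih
      _ = _ := by ring

end BasePoints

/-! ### The base locus of the iterates and its intersection with curves. -/

section

variable {𝕜 : Type*} [Field 𝕜]

theorem eq_mk_of_cross (P : Projectivization 𝕜 (Fin 2 → 𝕜)) {a : Fin 2 → 𝕜} (ha : a ≠ 0)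
    (h : P.rep 1 * a 0 = P.rep 0 * a 1) : P = Projectivization.mk 𝕜 a ha := by
  rw [← P.mk_rep, Projectivization.mk_eq_mk_iff']
  by_cases h0 : a 0 = 0
  · have h1 : a 1 ≠ 0 := fun h1 => ha (funext fun i => by fin_cases i <;> assumption)
    have h2 : P.rep 0 = 0 := by
      rw [h0, mul_zero, eq_comm, mul_eq_zero] at h
      exact h.resolve_right h1
    refine ⟨P.rep 1 / a 1, funext fun i => ?_⟩
    fin_cases i
    · simp [h0, h2]
    · simp [h1]
  · refine ⟨P.rep 0 / a 0, funext fun i => ?_⟩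
    fin_cases i
    · simp [h0]
    · simp only [Fin.mk_one, Pi.smul_apply, smul_eq_mul]
      field_simp
      linear_combination -h

theorem vec_ne_zero {a b : 𝕜} (h : a ≠ 0 ∨ b ≠ 0) : ![a, b] ≠ 0 ∧ ![b, a] ≠ 0 := by
  constructor
  · intro h0
    exact h.elim (fun h => h (congrFun h0 0)) (fun h => h (congrFun h0 1))
  · intro h0
    exact h.elim (fun h => h (congrFun h0 1)) (fun h => h (congrFun h0 0))

end

section

variable {𝕜 : Type*} [Field 𝕜] [NeZero (2 : 𝕜)]

/-- The points at which some iterate of `φ` is not defined. -/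
def baseLocus (ρ θ : 𝕜) : Set (T 𝕜) :=
  {p | ∃ m, ∀ i, evalAt p (itXY ρ θ m i) = 0}

/-- The sign `s = ± 1` treats `Z_m(p) = 0` and `W_m(p) = 0` together. Either condition fixes the
second factor of `p`, and with it the ratios `Z_j : W_j` at `p` for `j < m`. -/
theorem evalAt_itZW_cross {θ : 𝕜} (hθ0 : θ ≠ 0) (hθ : ∀ n, 0 < n → θ ^ n ≠ 1) (m : ℕ) (p : T 𝕜)
    (s : 𝕜) (hs : s ^ 2 = 1)
    (h : θ ^ m * (p.2.rep 0 + p.2.rep 1) + s * (p.2.rep 0 - p.2.rep 1) = 0) :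
    p.2.rep 0 * (1 + s * θ ^ m) = p.2.rep 1 * (1 - s * θ ^ m) ∧
    (∀ j < m, evalAt p (itZW θ j 0) ≠ 0 ∧ evalAt p (itZW θ j 1) ≠ 0 ∧
      evalAt p (itZW θ j 0) * (1 + s * θ ^ (m - j)) =
        evalAt p (itZW θ j 1) * (1 - s * θ ^ (m - j))) := by
  have h2 : (2 : 𝕜) ≠ 0 := NeZero.ne 2
  have hsum : p.2.rep 0 + p.2.rep 1 ≠ 0 := by
    intro h0
    have hs0 : s ≠ 0 := by rintro rfl; simp at hs
    rw [h0, mul_zero, zero_add, mul_eq_zero, or_iff_right hs0] at h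
    obtain ⟨i, hi⟩ := exists_rep_ne_zero p.2
    have e0 : p.2.rep 0 = 0 := (mul_eq_zero_iff_left h2).mp (by linear_combination h0 + h)
    have e1 : p.2.rep 1 = 0 := (mul_eq_zero_iff_left h2).mp (by linear_combination h0 - h)
    exact (Fin.forall_fin_two.mpr ⟨fun h => h e0, fun h => h e1⟩ : ∀ i, p.2.rep i ≠ 0 → False) i hi
  refine ⟨by linear_combination s * h + (p.2.rep 1 - p.2.rep 0) * hs, fun j hj => ?_⟩
  obtain ⟨n, rfl⟩ := Nat.exists_eq_add_of_lt hj
  obtain ⟨e0, e1⟩ := eval_itZW θ j (Sum.elim p.1.rep p.2.rep)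
  simp only [Sum.elim_inr] at e0 e1
  have hn : j + n + 1 - j = n + 1 := by omega
  rw [hn]
  have hne1 : 1 - s * θ ^ (n + 1) ≠ 0 ∧ 1 + s * θ ^ (n + 1) ≠ 0 := by
    have h3 := hθ (n + 1) n.succ_pos
    have h4 := pow_ne_neg_one hθ (n + 1)
    rcases (sq_eq_sq_iff_eq_or_eq_neg.mp (hs.trans (one_pow 2).symm)) with rfl | rfl
    · exact ⟨fun h => h3 (by linear_combination -h), fun h => h4 (by linear_combination h)⟩
    · exact ⟨fun h => h4 (by linear_combination h), fun h => h3 (by linear_combination -h)⟩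
  have hne0 : (2 : 𝕜) ^ j * θ ^ j * (p.2.rep 0 + p.2.rep 1) ≠ 0 :=
    mul_ne_zero (mul_ne_zero (pow_ne_zero _ h2) (pow_ne_zero _ hθ0)) hsum
  have hd : p.2.rep 0 - p.2.rep 1 = -s * θ ^ (j + n + 1) * (p.2.rep 0 + p.2.rep 1) := by
    linear_combination s * h - (p.2.rep 0 - p.2.rep 1) * hs
  have f0 : 2 * evalAt p (itZW θ j 0) =
      2 ^ j * θ ^ j * (p.2.rep 0 + p.2.rep 1) * (1 - s * θ ^ (n + 1)) := by
    rw [evalAt, e0, hd]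
    ring
  have f1 : 2 * evalAt p (itZW θ j 1) =
      2 ^ j * θ ^ j * (p.2.rep 0 + p.2.rep 1) * (1 + s * θ ^ (n + 1)) := by
    rw [evalAt, e1, hd]
    ring
  refine ⟨fun h0 => ?_, fun h0 => ?_, mul_left_cancel₀ h2 ?_⟩
  · rw [h0, mul_zero] at f0
    exact mul_ne_zero hne0 hne1.1 f0.symm
  · rw [h0, mul_zero] at f1
    exact mul_ne_zero hne0 hne1.2 f1.symm
  · linear_combination (1 + s * θ ^ (n + 1)) * f0 - (1 - s * θ ^ (n + 1)) * f1

theorem baseVal_ne_zero (ρ : 𝕜) {θ : 𝕜} (hθ : ∀ n, 0 < n → θ ^ n ≠ 1) (i : ℕ) :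
    (baseVal ρ θ i).1 ≠ 0 ∨ (baseVal ρ θ i).2 ≠ 0 := by
  obtain ⟨a, b, hab⟩ := basePQ_isCoprime hθ i
  have h := congrArg (Polynomial.aeval ρ : Polynomial 𝕜 →ₐ[𝕜] 𝕜) hab
  rw [map_add, map_mul, map_mul, (aeval_basePQ ρ θ i).1, (aeval_basePQ ρ θ i).2, map_one] at h
  by_contra! h0
  change _ * (baseVal ρ θ i).1 + _ * (baseVal ρ θ i).2 = 1 at h
  rw [h0.1, h0.2, mul_zero, mul_zero, add_zero] at h
  exact zero_ne_one h

theorem one_add_or_sub_ne_zero (c : 𝕜) : 1 - c ≠ 0 ∨ 1 + c ≠ 0 := by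
  by_contra! h
  exact NeZero.ne (2 : 𝕜) (by linear_combination h.1 + h.2)

/-- Let `m + 1` be the least index for which both forms vanish at `p`. Then `Z_m X_m` and `W_m Y_m`
vanish at `p`, while neither pair vanishes entirely. So `Z_m = Y_m = 0` or `W_m = X_m = 0` at `p`,
and running the recursion backwards determines `p` in each case. -/
theorem baseLocus_subset {ρ θ : 𝕜} (hρ : ρ ≠ 0) (hθ0 : θ ≠ 0) (hθ : ∀ n, 0 < n → θ ^ n ≠ 1) :
    baseLocus ρ θ ⊆
      Set.range (fun i => ptOf ![(baseVal ρ θ i).2, (baseVal ρ θ i).1] ![1 - θ ^ i, 1 + θ ^ i]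
        (vec_ne_zero (baseVal_ne_zero ρ hθ i)).2 (vec_ne_zero (one_add_or_sub_ne_zero _)).1) ∪
      Set.range (fun i => ptOf ![(baseVal ρ θ i).1, (baseVal ρ θ i).2] ![1 + θ ^ i, 1 - θ ^ i]
        (vec_ne_zero (baseVal_ne_zero ρ hθ i)).1 (vec_ne_zero (one_add_or_sub_ne_zero _)).2) := by
  classical
  have h2 : (2 : 𝕜) ≠ 0 := NeZero.ne 2
  intro p hp
  have hex : ∃ m, ∀ i, evalAt p (itXY ρ θ m i) = 0 := hp
  obtain ⟨m, hm⟩ : ∃ m, Nat.find hex = m + 1 := by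
    refine Nat.exists_eq_succ_of_ne_zero fun h0 => ?_
    obtain ⟨i, hi⟩ := exists_rep_ne_zero p.1
    have := Nat.find_spec hex i
    rw [h0] at this
    exact hi (by simpa [itXY] using this)
  have hvan : ∀ i, evalAt p (itXY ρ θ (m + 1) i) = 0 := by
    have := Nat.find_spec hex
    rwa [hm] at this
  have hnv : ∃ i, evalAt p (itXY ρ θ m i) ≠ 0 := by
    have := Nat.find_min hex (m := m) (by omega)
    push Not at this
    exact this
  have hx : ∀ j, evalAt p (itXY ρ θ (j + 1) 0) =
      (ρ + 1) * (evalAt p (itZW θ j 0) * evalAt p (itXY ρ θ j 0)) +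
      (ρ - 1) * (evalAt p (itZW θ j 1) * evalAt p (itXY ρ θ j 1)) := fun j => by
    rw [itXY_succ_zero]
    simp [evalAt]
  have hy : ∀ j, evalAt p (itXY ρ θ (j + 1) 1) =
      (ρ - 1) * (evalAt p (itZW θ j 0) * evalAt p (itXY ρ θ j 0)) +
      (ρ + 1) * (evalAt p (itZW θ j 1) * evalAt p (itXY ρ θ j 1)) := fun j => by
    rw [itXY_succ_one]
    simp [evalAt]
  have h4 : 2 * 2 * ρ ≠ 0 := mul_ne_zero (mul_ne_zero h2 h2) hρ
  have hX := hx m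
  have hY := hy m
  rw [hvan] at hX hY
  have hZX : evalAt p (itZW θ m 0) = 0 ∨ evalAt p (itXY ρ θ m 0) = 0 := by
    rw [← mul_eq_zero]
    apply mul_left_cancel₀ h4
    linear_combination -(ρ + 1) * hX + (ρ - 1) * hY
  have hWY : evalAt p (itZW θ m 1) = 0 ∨ evalAt p (itXY ρ θ m 1) = 0 := by
    rw [← mul_eq_zero]
    apply mul_left_cancel₀ h4
    linear_combination (ρ - 1) * hX - (ρ + 1) * hY
  obtain ⟨e0, e1⟩ := eval_itZW θ m (Sum.elim p.1.rep p.2.rep)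
  simp only [Sum.elim_inr] at e0 e1
  have hcase : (evalAt p (itZW θ m 0) = 0 ∧ evalAt p (itXY ρ θ m 1) = 0) ∨
      (evalAt p (itZW θ m 1) = 0 ∧ evalAt p (itXY ρ θ m 0) = 0) := by
    have hZW : evalAt p (itZW θ m 0) = 0 → evalAt p (itZW θ m 1) ≠ 0 := fun hZ hW => by
      obtain ⟨j, hj⟩ := exists_rep_ne_zero p.2
      obtain ⟨i, hi⟩ := eval_itZW_ne_zero hθ0 m (c := Sum.elim p.1.rep p.2.rep) (j := j) hj
      fin_cases i
      · exact hi hZ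
      · exact hi hW
    rcases hZX with hZ | hX
    · exact Or.inl ⟨hZ, hWY.resolve_left (hZW hZ)⟩
    · rcases hWY with hW | hY
      · exact Or.inr ⟨hW, hX⟩
      · obtain ⟨i, hi⟩ := hnv
        fin_cases i
        · exact absurd hX hi
        · exact absurd hY hi
  rcases hcase with ⟨hZ, hY⟩ | ⟨hW, hX⟩
  · rw [evalAt] at hZ
    rw [hZ, mul_zero, eq_comm, mul_eq_zero, or_iff_right (pow_ne_zero _ h2)] at e0
    obtain ⟨h5, h6⟩ := evalAt_itZW_cross hθ0 hθ m p 1 (one_pow 2) (by rw [one_mul]; exact e0)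
    left
    refine ⟨m, (Prod.ext (eq_mk_of_cross _ _ ?_) (eq_mk_of_cross _ _ ?_)).symm⟩
    · have := baseVal_cross (θ := θ) hρ m (fun j => evalAt p (itXY ρ θ j 0))
        (fun j => evalAt p (itXY ρ θ j 1)) (fun j => evalAt p (itZW θ j 0))
        (fun j => evalAt p (itZW θ j 1)) hx hy (fun j hj => (h6 j hj).1)
        (fun j hj => (h6 j hj).2.1) (fun j hj => by simpa using (h6 j hj).2.2) hY
      simpa [itXY] using this
    · simp only [one_mul] at h5
      simpa using h5.symm
  · rw [evalAt] at hW
    rw [hW, mul_zero, eq_comm, mul_eq_zero, or_iff_right (pow_ne_zero _ h2)] at e1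
    obtain ⟨h5, h6⟩ := evalAt_itZW_cross hθ0 hθ m p (-1) (by ring) (by rw [← e1]; ring)
    right
    refine ⟨m, (Prod.ext (eq_mk_of_cross _ _ ?_) (eq_mk_of_cross _ _ ?_)).symm⟩
    · have := baseVal_cross (θ := θ) hρ m (fun j => evalAt p (itXY ρ θ j 1))
        (fun j => evalAt p (itXY ρ θ j 0)) (fun j => evalAt p (itZW θ j 1))
        (fun j => evalAt p (itZW θ j 0)) (fun j => by rw [hy]; ring) (fun j => by rw [hx]; ring)
        (fun j hj => (h6 j hj).2.1) (fun j hj => (h6 j hj).1)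
        (fun j hj => by
          have := (h6 j hj).2.2
          linear_combination -this) hX
      simpa [itXY] using this.symm
    · simp only [Matrix.cons_val_zero, Matrix.cons_val_one]
      linear_combination -h5

/-- A curve contains only finitely many points of the base locus. This makes the bounds obtained
point by point uniform. -/
theorem IsForm.finite_baseLocus {ρ θ : 𝕜} (hρ : ρ ≠ 0)
    (h : AlgebraicIndependent (⊥ : Subfield 𝕜) ![ρ, θ]) {F : Coord 𝕜} {d : ℕ × ℕ} (hF : IsForm F d)
    (hF0 : F ≠ 0) : {p ∈ baseLocus ρ θ | evalAt p F = 0}.Finite := by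
  have hθ := pow_ne_one_of_algebraicIndependent h
  have hθ0 : θ ≠ 0 := by simpa using h.ne_zero 1
  obtain ⟨h1, h2⟩ := hF.finite_eval_baseVal h hF0
  refine ((h1.image (fun i => ptOf ![(baseVal ρ θ i).2, (baseVal ρ θ i).1] ![1 - θ ^ i, 1 + θ ^ i]
        (vec_ne_zero (baseVal_ne_zero ρ hθ i)).2 (vec_ne_zero (one_add_or_sub_ne_zero _)).1)).union
      (h2.image (fun i => ptOf ![(baseVal ρ θ i).1, (baseVal ρ θ i).2] ![1 + θ ^ i, 1 - θ ^ i]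
        (vec_ne_zero (baseVal_ne_zero ρ hθ i)).1
        (vec_ne_zero (one_add_or_sub_ne_zero _)).2))).subset ?_
  rintro p ⟨hp, hpF⟩
  rcases baseLocus_subset hρ hθ0 hθ hp with ⟨i, rfl⟩ | ⟨i, rfl⟩
  · refine Or.inl ⟨i, ?_, rfl⟩
    by_contra h0
    exact (hF.evalAt_ptOf _ _).mpr h0 hpF
  · refine Or.inr ⟨i, ?_, rfl⟩
    by_contra h0
    exact (hF.evalAt_ptOf _ _).mpr h0 hpF

end

/-! ### Homogeneous components of `R` and of its right ideals. -/

section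

variable {𝕜 A : Type*} [CommRing 𝕜] [CommRing A] [Algebra 𝕜 A] (φ : A ≃ₐ[𝕜] A)

theorem coeffAt_monom_self (n : ℤ) (a : A) : coeffAt φ n (monom φ n a) = a :=
  (SkewMonoidAlgebra.coeff_single_apply (k := Twisted φ) (b := a)).trans (if_pos rfl)

theorem coeffAt_monom_of_ne {m n : ℤ} (h : m ≠ n) (a : A) : coeffAt φ n (monom φ m a) = 0 :=
  (SkewMonoidAlgebra.coeff_single_apply (k := Twisted φ) (b := a)).trans
    (if_neg fun h' => h (Multiplicative.ofAdd.injective h'))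

theorem coeffAt_add (n : ℤ) (f g : SkewLaurent φ) :
    coeffAt φ n (f + g) = coeffAt φ n f + coeffAt φ n g := by
  unfold coeffAt
  rw [SkewMonoidAlgebra.coeff_add]
  rfl

theorem monom_add (n : ℤ) (a b : A) : monom φ n (a + b) = monom φ n a + monom φ n b :=
  SkewMonoidAlgebra.single_add ..

end

theorem span_coe_mul {𝕜 : Type*} [Field 𝕜] (p : T 𝕜) (P Q : Submodule 𝕜 (K 𝕜)) :
    Submodule.span (localRing p) ((P * Q : Submodule 𝕜 (K 𝕜)) : Set (K 𝕜)) =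
      Submodule.span (localRing p) P * Submodule.span (localRing p) Q := by
  rw [Submodule.span_mul_span]
  apply le_antisymm
  · rw [Submodule.span_le]
    intro x hx
    refine Submodule.mul_induction_on hx (fun a ha b hb => ?_) (fun a b ha hb => ?_)
    · exact Submodule.subset_span ⟨a, ha, b, hb, rfl⟩
    · exact Submodule.add_mem _ ha hb
  · apply Submodule.span_mono
    rintro _ ⟨a, ha, b, hb, rfl⟩
    exact Submodule.mul_mem_mul ha hb

section

variable {𝕜 : Type*} [Field 𝕜] [NeZero (2 : 𝕜)] (ρ θ : 𝕜ˣ)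

/-- The space `E^{φ^m} ⋯ E^{φ^{m+n-1}}` of rational functions. -/
def prodE (m n : ℕ) : Submodule 𝕜 (K 𝕜) :=
  ∏ i ∈ Finset.range n, (E 𝕜).map (phi ρ θ ^ (m + i)).toLinearMap

theorem prodE_zero (m : ℕ) : prodE ρ θ m 0 = 1 := Finset.prod_range_zero _

theorem prodE_one (m : ℕ) : prodE ρ θ m 1 = (E 𝕜).map (phi ρ θ ^ m).toLinearMap :=
  Finset.prod_range_one _

theorem prodE_add (m n n' : ℕ) :
    prodE ρ θ m (n + n') = prodE ρ θ m n * prodE ρ θ (m + n) n' := by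
  simp only [prodE, Finset.prod_range_add, add_assoc]

theorem map_prodE (k m n : ℕ) :
    (prodE ρ θ m n).map (phi ρ θ ^ k).toLinearMap = prodE ρ θ (k + m) n := by
  induction n with
  | zero =>
    rw [prodE_zero, prodE_zero]
    exact Submodule.map_one (phi ρ θ ^ k).toAlgHom
  | succ n ih =>
    rw [prodE_add, prodE_add, ← ih, prodE_one, prodE_one]
    refine (Submodule.map_mul _ _ (phi ρ θ ^ k).toAlgHom).trans ?_
    congr 1
    ext x
    simp only [Submodule.mem_map]
    have h : ∀ y, (phi ρ θ ^ (k + m + n)) y = (phi ρ θ ^ k) ((phi ρ θ ^ (m + n)) y) := fun y => by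
      rw [add_assoc, pow_add _ k]
      rfl
    constructor
    · rintro ⟨_, ⟨y, hy, rfl⟩, rfl⟩
      exact ⟨y, hy, h y⟩
    · rintro ⟨y, hy, rfl⟩
      exact ⟨_, ⟨y, hy, rfl⟩, (h y).symm⟩

theorem monom_mul_monom_nat (n m : ℕ) (a b : K 𝕜) :
    monom (phi ρ θ) n a * monom (phi ρ θ) m b =
      monom (phi ρ θ) (n + m : ℕ) (a * (phi ρ θ ^ n) b) := by
  rw [monom_mul_monom, zpow_natCast, Nat.cast_add]

theorem mul_phi_pow_mem_prodE {n m : ℕ} {a b : K 𝕜} (ha : a ∈ prodE ρ θ 0 n)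
    (hb : b ∈ prodE ρ θ 0 m) : a * (phi ρ θ ^ n) b ∈ prodE ρ θ 0 (n + m) := by
  rw [prodE_add]
  refine Submodule.mul_mem_mul ha ?_
  rw [zero_add, ← add_zero n, ← map_prodE, add_zero]
  exact Submodule.mem_map_of_mem hb

theorem monom_mem_R_of_mem (n : ℕ) {a : K 𝕜} (ha : a ∈ prodE ρ θ 0 n) :
    monom (phi ρ θ) n a ∈ R ρ θ := by
  induction n generalizing a with
  | zero =>
    rw [prodE_zero, Submodule.mem_one] at ha
    obtain ⟨c, rfl⟩ := ha
    exact (R ρ θ).algebraMap_mem c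
  | succ n ih =>
    rw [prodE_add, prodE_one, zero_add] at ha
    refine Submodule.mul_induction_on ha ?_ ?_
    · rintro x hx _ ⟨y, hy, rfl⟩
      have := (R ρ θ).mul_mem (ih hx) (Algebra.subset_adjoin ⟨y, hy, rfl⟩)
      have h1 := monom_mul_monom_nat ρ θ n 1 x y
      rw [Nat.cast_one] at h1
      rw [h1] at this
      exact this
    · intro x y hx hy
      rw [monom_add]
      exact add_mem hx hy

/-- Products of the generators `a t` are monomials `b t^m` with `b` in `E E^φ ⋯ E^{φ^{m-1}}`, and
they span `R`. Hence the sheaf `sheafR` is generated by the explicit space `prodE`. -/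
theorem coeffAt_mem_prodE {f : SkewLaurent (phi ρ θ)} (hf : f ∈ R ρ θ) (n : ℕ) :
    coeffAt (phi ρ θ) n f ∈ prodE ρ θ 0 n := by
  replace hf : f ∈ Subalgebra.toSubmodule (R ρ θ) := hf
  rw [R, Algebra.adjoin_eq_span] at hf
  induction hf using Submodule.span_induction with
  | mem f hf =>
    obtain ⟨m, a, ha, rfl⟩ : ∃ m : ℕ, ∃ a ∈ prodE ρ θ 0 m, monom (phi ρ θ) m a = f := by
      induction hf using Submonoid.closure_induction with
      | mem f hf =>
        obtain ⟨a, ha, rfl⟩ := hf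
        refine ⟨1, a, ?_, by rw [Nat.cast_one]⟩
        rw [prodE_one, pow_zero]
        exact ⟨a, ha, rfl⟩
      | one => exact ⟨0, 1, by rw [prodE_zero]; exact Submodule.one_le.mp le_rfl, rfl⟩
      | mul f g _ _ hf hg =>
        obtain ⟨m, a, ha, rfl⟩ := hf
        obtain ⟨m', b, hb, rfl⟩ := hg
        exact ⟨m + m', _, mul_phi_pow_mem_prodE ρ θ ha hb, (monom_mul_monom_nat ρ θ _ _ _ _).symm⟩
    rcases eq_or_ne m n with rfl | h
    · rwa [coeffAt_monom_self]
    · rw [coeffAt_monom_of_ne _ (by exact_mod_cast h)]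
      exact Submodule.zero_mem _
  | zero => exact Submodule.zero_mem _
  | add f g _ _ hf hg =>
    rw [coeffAt_add]
    exact Submodule.add_mem _ hf hg
  | smul c f _ hf => exact Submodule.smul_mem _ c hf

theorem monom_mem_R_iff (n : ℕ) (a : K 𝕜) :
    monom (phi ρ θ) n a ∈ R ρ θ ↔ a ∈ prodE ρ θ 0 n := by
  refine ⟨fun h => ?_, monom_mem_R_of_mem ρ θ n⟩
  simpa only [coeffAt_monom_self] using coeffAt_mem_prodE ρ θ h n

theorem sheafR_eq (m n : ℕ) (p : T 𝕜) :
    sheafR ρ θ m n p = Submodule.span (localRing p) (prodE ρ θ m n : Set (K 𝕜)) := by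
  have : (phi ρ θ ^ m) '' {a | monom (phi ρ θ) n a ∈ R ρ θ} = (prodE ρ θ m n : Set (K 𝕜)) := by
    rw [← add_zero m, ← map_prodE, add_zero]
    simp only [monom_mem_R_iff]
    rfl
  rw [sheafR, this, generated]

theorem sheafR_add (m n n' : ℕ) (p : T 𝕜) :
    sheafR ρ θ m (n + n') p = sheafR ρ θ m n p * sheafR ρ θ (m + n) n' p := by
  rw [sheafR_eq, sheafR_eq, sheafR_eq, prodE_add, span_coe_mul]

theorem sheafR_zero (m : ℕ) (p : T 𝕜) : sheafR ρ θ m 0 p = 1 := by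
  have h := sheafR_add ρ θ m 0 0 p
  rw [sheafR_eq, prodE_zero, Submodule.one_eq_span, Submodule.span_span_of_tower,
    Submodule.one_eq_span]

theorem sheafR_one (m : ℕ) (p : T 𝕜) : sheafR ρ θ m 1 p = Submodule.span (localRing p)
    ((phi ρ θ ^ m) '' {1, u 𝕜, v 𝕜, u 𝕜 * v 𝕜}) := by
  rw [sheafR_eq, prodE_one, E, Submodule.map_span, Submodule.span_span_of_tower]
  rfl

variable {ρ θ}

theorem sections_subset (J : Submodule (R ρ θ)ᵐᵒᵖ (R ρ θ)) (n : ℕ) :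
    sections J n ⊆ prodE ρ θ 0 n := by
  rintro a ⟨f, -, hf⟩
  exact (monom_mem_R_iff ρ θ n a).mp (hf ▸ f.2)

theorem sections_mono {J J' : Submodule (R ρ θ)ᵐᵒᵖ (R ρ θ)} (h : J ≤ J') (n : ℕ) :
    sections J n ⊆ sections J' n :=
  fun _ ⟨f, hf, hfa⟩ => ⟨f, h hf, hfa⟩

theorem mul_mem_sections {J : Submodule (R ρ θ)ᵐᵒᵖ (R ρ θ)} {n m : ℕ} {a b : K 𝕜}
    (ha : a ∈ sections J n) (hb : b ∈ prodE ρ θ n m) : a * b ∈ sections J (n + m) := by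
  nth_rw 1 [← add_zero n] at hb
  rw [← map_prodE] at hb
  obtain ⟨b, hb, rfl⟩ := hb
  obtain ⟨f, hf, hfa⟩ := ha
  refine ⟨f * ⟨_, monom_mem_R_of_mem ρ θ m hb⟩, ?_, ?_⟩
  · exact J.smul_mem (MulOpposite.op _) hf
  · rw [Subalgebra.coe_mul, hfa]
    exact monom_mul_monom_nat ρ θ n m a b

/-- The stalk at `p` of the subsheaf generated by `Jₙ t⁻ⁿ` contains the one for `n`
times `E^{φ^n} ⋯ E^{φ^{n+m-1}}`. -/
theorem generated_sections_mul_le (J : Submodule (R ρ θ)ᵐᵒᵖ (R ρ θ)) (n m : ℕ) (p : T 𝕜) :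
    generated (sections J n) p * sheafR ρ θ n m p ≤ generated (sections J (n + m)) p := by
  rw [sheafR_eq, generated, Submodule.span_mul_span]
  apply Submodule.span_mono
  rintro _ ⟨a, ha, b, hb, rfl⟩
  exact mul_mem_sections ha hb

theorem generated_sections_le (J : Submodule (R ρ θ)ᵐᵒᵖ (R ρ θ)) (n : ℕ) (p : T 𝕜) :
    generated (sections J n) p ≤ sheafR ρ θ 0 n p := by
  rw [sheafR_eq]
  exact Submodule.span_mono (sections_subset J n)

end

/-! ### Stabilization through Rees algebras. -/

section

variable {A : Type*} [CommRing A]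

/-- The ideal of the Rees algebra of `b` which in degree `n` is `I n` for `n ≤ j` and
`I j * b ^ (n - j)` for `n ≥ j`. -/
def reesIdeal (b : Ideal A) (I : ℕ → Ideal A) (hI : ∀ n m, I n * b ^ m ≤ I (n + m)) (j : ℕ) :
    Ideal (reesAlgebra b) where
  carrier := {f | ∀ n, (f : Polynomial A).coeff n ∈ I (min n j) * b ^ (n - j)}
  add_mem' hf hg n := by
    rw [Subalgebra.coe_add, Polynomial.coeff_add]
    exact add_mem (hf n) (hg n)
  zero_mem' n := by simp
  smul_mem' := by
    intro f g hg n
    rw [smul_eq_mul, Subalgebra.coe_mul, Polynomial.coeff_mul]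
    refine Ideal.sum_mem _ fun x hx => ?_
    obtain rfl := Finset.HasAntidiagonal.mem_antidiagonal.mp hx
    have h1 := Ideal.mul_mem_mul (mem_reesAlgebra_iff _ _ |>.mp f.2 x.1) (hg x.2)
    refine (?_ : b ^ x.1 * (I (min x.2 j) * b ^ (x.2 - j)) ≤ _) h1
    rcases le_total j x.2 with h | h
    · rw [min_eq_right h, min_eq_right (h.trans (Nat.le_add_left _ _)), Nat.add_sub_assoc h, pow_add]
      exact le_of_eq (by ring)
    · rw [min_eq_left h, Nat.sub_eq_zero_of_le h, pow_zero, mul_one]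
      rcases le_total (x.1 + x.2) j with h' | h'
      · rw [min_eq_left h', Nat.sub_eq_zero_of_le h', pow_zero, mul_one, mul_comm, add_comm]
        exact hI _ _
      · rw [min_eq_right h']
        obtain ⟨m, rfl⟩ := Nat.exists_eq_add_of_le h
        obtain ⟨l, hl⟩ := Nat.exists_eq_add_of_le (Nat.le_of_add_le_add_right (by omega : m + x.2 ≤ x.1 + x.2))
        rw [show x.1 + x.2 - (x.2 + m) = l by omega, hl, pow_add, mul_comm, ← mul_assoc]
        exact Ideal.mul_mono_left (hI _ _)

theorem reesIdeal_mono {b : Ideal A} {I I' : ℕ → Ideal A} {hI : ∀ n m, I n * b ^ m ≤ I (n + m)}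
    {hI' : ∀ n m, I' n * b ^ m ≤ I' (n + m)} (h : ∀ n, I n ≤ I' n) {j j' : ℕ} (hj : j ≤ j') :
    reesIdeal b I hI j ≤ reesIdeal b I' hI' j' := by
  intro f hf n
  refine (?_ : I (min n j) * b ^ (n - j) ≤ _) (hf n)
  rcases le_total n j with h1 | h1
  · rw [min_eq_left h1, min_eq_left (h1.trans hj), Nat.sub_eq_zero_of_le h1,
      Nat.sub_eq_zero_of_le (h1.trans hj)]
    exact Ideal.mul_mono_left (h n)
  · rw [min_eq_right h1]
    refine (Ideal.mul_mono_left (h j)).trans ?_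
    rw [show n - j = (min n j' - j) + (n - j') by omega, pow_add, ← mul_assoc]
    refine Ideal.mul_mono_left ((hI' _ _).trans_eq ?_)
    congr 1
    omega

/-- A doubly indexed family of ideals which is a chain of graded modules over the Rees algebra
of `b` contained in it is eventually stable. -/
theorem exists_eq_mul_pow [IsNoetherianRing A] (b : Ideal A) (I : ℕ → ℕ → Ideal A)
    (hb : ∀ l n, I l n ≤ b ^ n) (hI : ∀ l n, I l n * b ≤ I l (n + 1))
    (hmono : ∀ n, Monotone fun l => I l n) :
    ∃ k, ∀ n, k ≤ n → ∀ l, k ≤ l → I l n = I k k * b ^ (n - k) := by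
  have hI' : ∀ l n m, I l n * b ^ m ≤ I l (n + m) := by
    intro l n m
    induction m with
    | zero => simp
    | succ m ih =>
      rw [pow_succ, ← mul_assoc, ← add_assoc]
      exact (Ideal.mul_mono_left ih).trans (hI l _)
  -- The chain is taken along the diagonal: `j` is both the index of the family and the degree up to
  -- which it is used. One application of Noetherianity then controls `l` and `n` together.
  obtain ⟨k, hk⟩ := monotone_stabilizes_iff_noetherian.mpr
    (inferInstanceAs (IsNoetherian (reesAlgebra b) (reesAlgebra b)))
    ⟨fun j => reesIdeal b (I j) (hI' j) j,
      fun j j' h => reesIdeal_mono (fun n => hmono n h) h⟩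
  refine ⟨k, fun n hn l hl => le_antisymm (fun a ha => ?_) ?_⟩
  · have hmem : (⟨Polynomial.monomial n a, reesAlgebra.monomial_mem.mpr (hb l n ha)⟩ : reesAlgebra b) ∈
        reesIdeal b (I (max l n)) (hI' _) (max l n) := by
      intro m
      rw [Polynomial.coeff_monomial]
      split_ifs with h
      · subst h
        rw [min_eq_left (le_max_right _ _), Nat.sub_eq_zero_of_le (le_max_right _ _), pow_zero,
          mul_one]
        exact hmono n (le_max_left _ _) ha
      · exact Submodule.zero_mem _
    have h2 : reesIdeal b (I k) (hI' k) k = reesIdeal b (I (max l n)) (hI' _) (max l n) :=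
      hk (max l n) (hl.trans (le_max_left _ _))
    rw [← h2] at hmem
    simpa [min_eq_right hn] using hmem n
  · refine (hI' k k _).trans ?_
    rw [Nat.add_sub_cancel' hn]
    exact hmono n hl

end

section

variable {A B : Type*} [CommRing A]

theorem span_singleton_mul_span_singleton_inv [Field B] [Algebra A B] {x : B} (hx : x ≠ 0) :
    Submodule.span A {x} * Submodule.span A {x⁻¹} = 1 := by
  rw [Submodule.span_mul_span, Set.singleton_mul_singleton, mul_inv_cancel₀ hx,
    Submodule.one_eq_span]

theorem one_div_span_singleton [Field B] [Algebra A B] {x : B} (hx : x ≠ 0) :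
    1 / Submodule.span A {x} = Submodule.span A {x⁻¹} := by
  have h := span_singleton_mul_span_singleton_inv (A := A) hx
  apply le_antisymm
  · calc 1 / Submodule.span A {x}
        = Submodule.span A {x} * (1 / Submodule.span A {x}) * Submodule.span A {x⁻¹} := by
          rw [mul_right_comm, h, one_mul]
      _ ≤ 1 * Submodule.span A {x⁻¹} := mul_le_mul_left Submodule.mul_one_div_le_one _
      _ = _ := one_mul _
  · rw [Submodule.le_div_iff_mul_le, mul_comm, h]

/-- A variant of `exists_eq_mul_pow` for submodules of an algebra. -/
theorem exists_eq_mul_pow_submodule [IsNoetherianRing A] [CommRing B] [Algebra A B]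
    (hinj : Function.Injective (algebraMap A B))
    (b : Submodule A B) (hb1 : b ≤ 1) (I : ℕ → ℕ → Submodule A B)
    (hb : ∀ l n, I l n ≤ b ^ n) (hI : ∀ l n, I l n * b ≤ I l (n + 1))
    (hmono : ∀ n, Monotone fun l => I l n) :
    ∃ k, ∀ n, k ≤ n → ∀ l, k ≤ l → I l n = I k k * b ^ (n - k) := by
  have hmul : ∀ P Q : Ideal A, Submodule.map (Algebra.linearMap A B) (P * Q) =
      Submodule.map (Algebra.linearMap A B) P * Submodule.map (Algebra.linearMap A B) Q :=
    fun P Q => Submodule.map_mul P Q (Algebra.ofId A B)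
  have hpow : ∀ (P : Ideal A) n, Submodule.map (Algebra.linearMap A B) (P ^ n) =
      Submodule.map (Algebra.linearMap A B) P ^ n := by
    intro P n
    induction n with
    | zero =>
      rw [pow_zero, pow_zero]
      exact Submodule.map_one (Algebra.ofId A B)
    | succ n ih => rw [pow_succ, pow_succ, hmul, ih]
  have hmc : ∀ S : Submodule A B, S ≤ 1 →
      Submodule.map (Algebra.linearMap A B) (S.comap (Algebra.linearMap A B)) = S := fun S hS => by
    rw [Submodule.map_comap_eq, inf_eq_right]
    exact hS.trans_eq Submodule.one_eq_range
  have hle : ∀ P Q : Ideal A, Submodule.map (Algebra.linearMap A B) P ≤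
      Submodule.map (Algebra.linearMap A B) Q → P ≤ Q :=
    fun P Q => (Submodule.map_le_map_iff_of_injective (f := Algebra.linearMap A B) hinj P Q).mp
  have hI1 : ∀ l n, I l n ≤ 1 := fun l n =>
    (hb l n).trans (pow_le_one' hb1 n)
  obtain ⟨k, hk⟩ := exists_eq_mul_pow (b.comap (Algebra.linearMap A B))
    (fun l n => (I l n).comap (Algebra.linearMap A B))
    (fun l n => hle _ _ (by rw [hpow, hmc _ hb1, hmc _ (hI1 l n)]; exact hb l n))
    (fun l n => hle _ _ (by
      rw [hmul, hmc _ hb1, hmc _ (hI1 l n), hmc _ (hI1 l _)]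
      exact hI l n))
    (fun n l l' h => Submodule.comap_mono (hmono n h))
  refine ⟨k, fun n hn l hl => ?_⟩
  have h := congrArg (Submodule.map (Algebra.linearMap A B)) (hk n hn l hl)
  rwa [hmul, hpow, hmc _ hb1, hmc _ (hI1 l n), hmc _ (hI1 k k)] at h

end

/-! ### Local description of `ℒ_n` and `ℛ_n`. -/

section

variable {𝕜 : Type*} [Field 𝕜]

theorem mul_mem_of_mem_localRing {p : T 𝕜} {N : Submodule (localRing p) (K 𝕜)} {a f : K 𝕜}
    (ha : a ∈ localRing p) (hf : f ∈ N) : a * f ∈ N :=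
  N.smul_mem ⟨a, ha⟩ hf

theorem mem_one_iff_mem_localRing {p : T 𝕜} {f : K 𝕜} :
    f ∈ (1 : Submodule (localRing p) (K 𝕜)) ↔ f ∈ localRing p := by
  rw [Submodule.mem_one]
  exact ⟨fun ⟨a, ha⟩ => ha ▸ a.2, fun h => ⟨⟨f, h⟩, rfl⟩⟩

theorem one_le_of_unit_mem {p : T 𝕜} {N : Submodule (localRing p) (K 𝕜)} {a : K 𝕜} (ha : a ≠ 0)
    (hinv : a⁻¹ ∈ localRing p) (h : a ∈ N) : 1 ≤ N := by
  rw [Submodule.one_le]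
  simpa [ha] using mul_mem_of_mem_localRing hinv h

variable [Infinite 𝕜]

theorem IsForm.chart_ne_zero_and_inv_mem {G : Coord 𝕜} {d : ℕ × ℕ} (hG : IsForm G d) {p : T 𝕜}
    {i j : Fin 2} (hi : p.1.rep i ≠ 0) (hj : p.2.rep j ≠ 0) (hp : evalAt p G ≠ 0) :
    chart i j G ≠ 0 ∧ (chart i j G)⁻¹ ∈ localRing p := by
  simpa using chart_inv_mem hi hj 1 G ((hG.eval_coords_ne_zero hi hj).mpr hp)

end

section

variable {𝕜 : Type*} [Field 𝕜] (ρ θ : 𝕜ˣ) (i j : Fin 2)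

/-- A generator of `ℒ^{φ^m}` on the chart `(i, j)`. -/
def lam (m : ℕ) : K 𝕜 := dehom (X (Sum.inl i) * X (Sum.inr j) ^ (m + 1)) / denom ρ θ m

/-- A generator of `ℒ_n^{φ^m}` on the chart `(i, j)`. -/
def lamProd (m n : ℕ) : K 𝕜 := ∏ a ∈ Finset.range n, lam ρ θ i j (m + a)

/-- The base ideal of the sections `E^{φ^m}` of `ℒ^{φ^m}`, at a point of the chart `(i, j)`. -/
def baseMod (m : ℕ) (p : T 𝕜) : Submodule (localRing p) (K 𝕜) :=
  Submodule.span (localRing p) (Set.range fun a => chart i j (itXY (ρ : 𝕜) θ m a))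

theorem isForm_lam (m : ℕ) :
    IsForm (X (Sum.inl i) * X (Sum.inr j) ^ (m + 1) : Coord 𝕜) (1, m + 1) := by
  simpa using (isForm_X_inl i).mul ((isForm_X_inr (𝕜 := 𝕜) j).pow (m + 1))

theorem dehom_lam (m : ℕ) : dehom (X (Sum.inl i) * X (Sum.inr j) ^ (m + 1) : Coord 𝕜) =
    hx i * hz j ^ (m + 1) := by
  simp

theorem lamProd_add (m n n' : ℕ) : lamProd ρ θ i j m (n + n') =
    lamProd ρ θ i j m n * lamProd ρ θ i j (m + n) n' := by
  simp only [lamProd, Finset.prod_range_add, add_assoc]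

theorem lamProd_one (m : ℕ) : lamProd ρ θ i j m 1 = lam ρ θ i j m := by
  simp [lamProd]

theorem span_lamProd_add (m n n' : ℕ) (p : T 𝕜) :
    Submodule.span (localRing p) {lamProd ρ θ i j m (n + n')} =
      Submodule.span (localRing p) {lamProd ρ θ i j m n} *
        Submodule.span (localRing p) {lamProd ρ θ i j (m + n) n'} := by
  rw [Submodule.span_mul_span, Set.singleton_mul_singleton, lamProd_add]

theorem baseMod_le_one [Infinite 𝕜] {i j : Fin 2} {p : T 𝕜} (hi : p.1.rep i ≠ 0)
    (hj : p.2.rep j ≠ 0) (m : ℕ) : baseMod ρ θ i j m p ≤ 1 := by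
  rw [baseMod, Submodule.span_le]
  rintro _ ⟨a, rfl⟩
  exact mem_one_iff_mem_localRing.mpr (chart_mem hi hj _)

theorem baseMod_eq_one [Infinite 𝕜] {i j : Fin 2} {p : T 𝕜} (hi : p.1.rep i ≠ 0)
    (hj : p.2.rep j ≠ 0) {m : ℕ} {a : Fin 2} (ha : evalAt p (itXY (ρ : 𝕜) θ m a) ≠ 0) :
    baseMod ρ θ i j m p = 1 := by
  apply le_antisymm (baseMod_le_one ρ θ hi hj m)
  obtain ⟨h1, h2⟩ := (isForm_itXY (ρ : 𝕜) θ m a).chart_ne_zero_and_inv_mem hi hj ha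
  exact one_le_of_unit_mem h1 h2 (Submodule.subset_span ⟨a, rfl⟩)

theorem baseMod_eq_one_of_notMem_baseLocus [Infinite 𝕜] {p : T 𝕜} (hp : p ∉ baseLocus (ρ : 𝕜) θ)
    {i j : Fin 2} (hi : p.1.rep i ≠ 0) (hj : p.2.rep j ≠ 0) (m : ℕ) :
    baseMod ρ θ i j m p = 1 := by
  have h : ∃ a, evalAt p (itXY (ρ : 𝕜) θ m a) ≠ 0 := by
    by_contra! h
    exact hp ⟨m, h⟩
  obtain ⟨a, ha⟩ := h
  exact baseMod_eq_one ρ θ hi hj ha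

variable [NeZero (2 : 𝕜)]

theorem lam_ne_zero [Infinite 𝕜] (m : ℕ) : lam ρ θ i j m ≠ 0 := by
  rw [lam, dehom_lam]
  exact div_ne_zero (mul_ne_zero (hx_ne_zero i) (pow_ne_zero _ (hz_ne_zero j)))
    (denom_ne_zero ρ θ m)

theorem lamProd_ne_zero [Infinite 𝕜] (m n : ℕ) : lamProd ρ θ i j m n ≠ 0 :=
  Finset.prod_ne_zero_iff.mpr fun _ _ => lam_ne_zero ρ θ i j _

variable {i j} {p : T 𝕜} (hi : p.1.rep i ≠ 0) (hj : p.2.rep j ≠ 0)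
include hi hj

theorem sheafL_eq [IsAlgClosed 𝕜] (hθ : ∀ n, 0 < n → (θ : 𝕜) ^ n ≠ 1) (m n : ℕ) :
    sheafL ρ θ m n p = Submodule.span (localRing p) {lamProd ρ θ i j m n} := by
  rw [sheafL, Finset.prod_apply, lamProd, ← Submodule.prod_span_singleton]
  refine Finset.prod_congr rfl fun a _ => ?_
  refine pullback_twist hθ (m + a) (isForm_lam i j (m + a)) ?_
  simpa [evalAt] using ⟨hi, hj⟩

variable [Infinite 𝕜]

open scoped Pointwise in
-- `E` is spanned by the products of `u, 1` with `v, 1`. Their pullbacks are `λ_m` times local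
-- equations of `X_m, Y_m` and of `Z_m, W_m`, and the latter pair has no common zero, so it
-- generates the unit ideal.
theorem sheafR_one_eq (m : ℕ) :
    sheafR ρ θ m 1 p = Submodule.span (localRing p) {lam ρ θ i j m} * baseMod ρ θ i j m p := by
  have hset : (phi ρ θ ^ m) '' {1, u 𝕜, v 𝕜, u 𝕜 * v 𝕜} = ({lam ρ θ i j m} : Set (K 𝕜)) *
      (Set.range (fun a => chart i j (itXY (ρ : 𝕜) θ m a))) *
      (Set.range (fun a => chart i j (itZW (θ : 𝕜) m a))) := by
    have h1 : ({1, u 𝕜, v 𝕜, u 𝕜 * v 𝕜} : Set (K 𝕜)) = Set.range hx * Set.range hz := by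
      have e1 : Set.range (hx : Fin 2 → K 𝕜) = {u 𝕜, 1} := by simp [hx, Set.pair_comm]
      have e2 : Set.range (hz : Fin 2 → K 𝕜) = {v 𝕜, 1} := by simp [hz, Set.pair_comm]
      ext f
      simp only [e1, e2, Set.mem_mul, Set.mem_singleton_iff, Set.mem_insert_iff,
        exists_eq_or_imp, exists_eq_left, mul_one, one_mul, eq_comm (b := f)]
      tauto
    have h2 : ∀ a b, (phi ρ θ ^ m) (hx a * hz b) = lam ρ θ i j m *
        chart i j (itXY (ρ : 𝕜) θ m a) * chart i j (itZW (θ : 𝕜) m b) := by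
      intro a b
      rw [lam, dehom_lam, map_mul]
      have e1 := phi_pow_hx ρ θ m a
      have e2 := phi_pow_hz ρ θ m b
      rw [← (isForm_itXY (ρ : 𝕜) θ m a).chart_eq i j] at e1
      rw [← (isForm_itZW (θ : 𝕜) m b).chart_eq i j] at e2
      rw [div_mul_eq_mul_div, div_mul_eq_mul_div, eq_div_iff (denom_ne_zero ρ θ m), denom]
      calc _ = (dehom (itXY (ρ : 𝕜) θ m 1) * (phi ρ θ ^ m) (hx a)) *
            (dehom (itZW (θ : 𝕜) m 1) * (phi ρ θ ^ m) (hz b)) := by ring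
        _ = _ := by
          rw [e1, e2]
          ring
    rw [h1]
    ext f
    constructor
    · rintro ⟨_, ⟨_, ⟨a, rfl⟩, _, ⟨b, rfl⟩, rfl⟩, rfl⟩
      exact ⟨_, ⟨_, rfl, _, ⟨a, rfl⟩, rfl⟩, _, ⟨b, rfl⟩, (h2 a b).symm⟩
    · rintro ⟨_, ⟨_, rfl, _, ⟨a, rfl⟩, rfl⟩, _, ⟨b, rfl⟩, rfl⟩
      exact ⟨_, ⟨_, ⟨a, rfl⟩, _, ⟨b, rfl⟩, rfl⟩, h2 a b⟩
  have hZW : Submodule.span (localRing p)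
      (Set.range fun a => chart i j (itZW (θ : 𝕜) m a)) = 1 := by
    apply le_antisymm
    · rw [Submodule.span_le]
      rintro _ ⟨a, rfl⟩
      exact mem_one_iff_mem_localRing.mpr (chart_mem hi hj _)
    · obtain ⟨a, ha⟩ := evalAt_itZW_ne_zero θ m p
      obtain ⟨h1, h2⟩ := (isForm_itZW (θ : 𝕜) m a).chart_ne_zero_and_inv_mem hi hj ha
      exact one_le_of_unit_mem h1 h2 (Submodule.subset_span ⟨a, rfl⟩)
  rw [sheafR_one, hset, ← Submodule.span_mul_span, hZW, mul_one, ← Submodule.span_mul_span]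
  rfl

theorem sheafR_eq_mul_pow {m : ℕ} {b : Submodule (localRing p) (K 𝕜)}
    (hb : ∀ m', m ≤ m' → baseMod ρ θ i j m' p = b) (n : ℕ) :
    sheafR ρ θ m n p = Submodule.span (localRing p) {lamProd ρ θ i j m n} * b ^ n := by
  induction n with
  | zero => rw [sheafR_zero, pow_zero, mul_one, Submodule.one_eq_span, lamProd,
      Finset.prod_range_zero]
  | succ n ih =>
    rw [sheafR_add, ih, sheafR_one_eq ρ θ hi hj, hb _ (Nat.le_add_right m n), span_lamProd_add,
      lamProd_one, pow_succ]
    exact mul_mul_mul_comm _ _ _ _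

theorem sheafR_le_span (m n : ℕ) :
    sheafR ρ θ m n p ≤ Submodule.span (localRing p) {lamProd ρ θ i j m n} := by
  induction n with
  | zero => rw [sheafR_zero, Submodule.one_eq_span, lamProd, Finset.prod_range_zero]
  | succ n ih =>
    rw [sheafR_add, sheafR_one_eq ρ θ hi hj, span_lamProd_add, lamProd_one]
    refine mul_le_mul' ih ?_
    exact (mul_le_mul_right (baseMod_le_one ρ θ hi hj _) _).trans_eq (mul_one _)

/-- `X_{m+1}`, `Y_{m+1}` arise from `Z_m X_m`, `W_m Y_m` by a constant matrix of determinant `4 ρ`,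
and here `Z_m`, `W_m` are units at `p`. -/
theorem baseMod_succ {m : ℕ} (h : ∀ a, evalAt p (itZW (θ : 𝕜) m a) ≠ 0) :
    baseMod ρ θ i j (m + 1) p = baseMod ρ θ i j m p := by
  have hmem : ∀ a, chart i j (itXY (ρ : 𝕜) θ m a) ∈ baseMod ρ θ i j m p :=
    fun a => Submodule.subset_span ⟨a, rfl⟩
  have hmem' : ∀ a, chart i j (itXY (ρ : 𝕜) θ (m + 1) a) ∈ baseMod ρ θ i j (m + 1) p :=
    fun a => Submodule.subset_span ⟨a, rfl⟩
  have e0 := congrArg (chart i j) (itXY_succ_zero (ρ : 𝕜) θ m)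
  have e1 := congrArg (chart i j) (itXY_succ_one (ρ : 𝕜) θ m)
  apply le_antisymm
  · rw [baseMod, Submodule.span_le]
    rintro _ ⟨a, rfl⟩
    revert a
    have h1 : ∀ (c : 𝕜) a, chart i j (C c * (itZW (θ : 𝕜) m a * itXY (ρ : 𝕜) θ m a)) ∈
        baseMod ρ θ i j m p := fun c a => by
      rw [← mul_assoc, map_mul]
      exact mul_mem_of_mem_localRing (chart_mem hi hj _) (hmem a)
    refine Fin.forall_fin_two.mpr ⟨?_, ?_⟩
    · simp only [e0, map_add (chart i j)]
      exact add_mem (h1 _ _) (h1 _ _)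
    · simp only [e1, map_add (chart i j)]
      exact add_mem (h1 _ _) (h1 _ _)
  · rw [baseMod, Submodule.span_le]
    rintro _ ⟨a, rfl⟩
    have h4 : (2 * 2 * ρ : 𝕜) ≠ 0 :=
      mul_ne_zero (mul_ne_zero (NeZero.ne 2) (NeZero.ne 2)) ρ.ne_zero
    have h1 : ∀ (c : 𝕜) a, chart i j (C c * itXY (ρ : 𝕜) θ (m + 1) a) ∈
        baseMod ρ θ i j (m + 1) p := fun c a => by
      rw [map_mul]
      exact mul_mem_of_mem_localRing (chart_mem hi hj _) (hmem' a)
    have h2 : ∀ a, chart i j (C (2 * 2 * ρ : 𝕜) * (itZW (θ : 𝕜) m a * itXY (ρ : 𝕜) θ m a)) ∈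
        baseMod ρ θ i j (m + 1) p := by
      refine Fin.forall_fin_two.mpr ⟨?_, ?_⟩
      · have : C (2 * 2 * ρ : 𝕜) * (itZW (θ : 𝕜) m 0 * itXY (ρ : 𝕜) θ m 0) =
            C (ρ + 1 : 𝕜) * itXY (ρ : 𝕜) θ (m + 1) 0 - C (ρ - 1 : 𝕜) * itXY (ρ : 𝕜) θ (m + 1) 1 := by
          rw [itXY_succ_zero, itXY_succ_one]
          simp only [map_mul, map_add, map_sub, map_one, map_ofNat]
          ring
        rw [this, map_sub]
        exact sub_mem (h1 _ _) (h1 _ _)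
      · have : C (2 * 2 * ρ : 𝕜) * (itZW (θ : 𝕜) m 1 * itXY (ρ : 𝕜) θ m 1) =
            C (ρ + 1 : 𝕜) * itXY (ρ : 𝕜) θ (m + 1) 1 - C (ρ - 1 : 𝕜) * itXY (ρ : 𝕜) θ (m + 1) 0 := by
          rw [itXY_succ_zero, itXY_succ_one]
          simp only [map_mul, map_add, map_sub, map_one, map_ofNat]
          ring
        rw [this, map_sub]
        exact sub_mem (h1 _ _) (h1 _ _)
    have h3 := h2 a
    have hG : IsForm (C (2 * 2 * ρ : 𝕜) * itZW (θ : 𝕜) m a) (0, 1) := (isForm_itZW _ m a).C_mul _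
    obtain ⟨h5, h6⟩ := hG.chart_ne_zero_and_inv_mem hi hj (by
      rw [evalAt, map_mul, eval_C]
      exact mul_ne_zero h4 (h a))
    rw [← mul_assoc, map_mul] at h3
    have h7 := mul_mem_of_mem_localRing h6 h3
    rwa [inv_mul_cancel_left₀ h5] at h7

end

section

variable {𝕜 : Type*} [Field 𝕜] [NeZero (2 : 𝕜)] (ρ θ : 𝕜ˣ)

/-- The vanishing of `Z_m` or of `W_m` at `p` determines `θ^m`, hence `m`, so each happens for at
most one `m`. -/
theorem exists_forall_evalAt_itZW_ne_zero (hθ : ∀ n, 0 < n → (θ : 𝕜) ^ n ≠ 1) (p : T 𝕜) :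
    ∃ N, ∀ m, N ≤ m → ∀ a, evalAt p (itZW (θ : 𝕜) m a) ≠ 0 := by
  have h2 : (2 : 𝕜) ≠ 0 := NeZero.ne 2
  have hsub : ∀ a, {m | evalAt p (itZW (θ : 𝕜) m a) = 0}.Subsingleton := by
    have key : ∀ s d : 𝕜, (s ≠ 0 ∨ d ≠ 0) → ∀ m m', (θ : 𝕜) ^ m * s + d = 0 →
        (θ : 𝕜) ^ m' * s + d = 0 → m = m' := by
      intro s d hsd m m' h h'
      have hs : s ≠ 0 := by
        rintro rfl
        rw [mul_zero, zero_add] at h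
        exact hsd.elim (fun h => h rfl) (fun h' => h' h)
      exact injective_pow_of_ne_one θ.ne_zero hθ (mul_right_cancel₀ hs (by linear_combination h - h'))
    have hne : p.2.rep 0 + p.2.rep 1 ≠ 0 ∨ p.2.rep 0 - p.2.rep 1 ≠ 0 := by
      by_contra! h
      obtain ⟨i, hi⟩ := exists_rep_ne_zero p.2
      have e0 : p.2.rep 0 = 0 := (mul_eq_zero_iff_left h2).mp (by linear_combination h.1 + h.2)
      have e1 : p.2.rep 1 = 0 := (mul_eq_zero_iff_left h2).mp (by linear_combination h.1 - h.2)
      exact (Fin.forall_fin_two.mpr ⟨fun h => h e0, fun h => h e1⟩ :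
        ∀ i, p.2.rep i ≠ 0 → False) i hi
    have hz : ∀ (m : ℕ) (t : 𝕜), 0 = 2 ^ m * t → t = 0 := fun m t h =>
      (mul_eq_zero_iff_left (pow_ne_zero m h2)).mp h.symm
    refine Fin.forall_fin_two.mpr ⟨fun m hm m' hm' => ?_, fun m hm m' hm' => ?_⟩
    · have e := (eval_itZW (θ : 𝕜) m (Sum.elim p.1.rep p.2.rep)).1
      have e' := (eval_itZW (θ : 𝕜) m' (Sum.elim p.1.rep p.2.rep)).1
      change eval _ _ = 0 at hm hm'
      rw [hm, mul_zero] at e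
      rw [hm', mul_zero] at e'
      exact key _ _ hne _ _ (hz _ _ e) (hz _ _ e')
    · have e := (eval_itZW (θ : 𝕜) m (Sum.elim p.1.rep p.2.rep)).2
      have e' := (eval_itZW (θ : 𝕜) m' (Sum.elim p.1.rep p.2.rep)).2
      change eval _ _ = 0 at hm hm'
      rw [hm, mul_zero] at e
      rw [hm', mul_zero] at e'
      refine key _ (-(p.2.rep 0 - p.2.rep 1)) (hne.imp_right neg_ne_zero.mpr) _ _ ?_ ?_
      · exact (sub_eq_add_neg _ _).symm.trans (hz _ _ e)
      · exact (sub_eq_add_neg _ _).symm.trans (hz _ _ e')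
  obtain ⟨N, hN⟩ := ((hsub 0).finite.union (hsub 1).finite).bddAbove
  refine ⟨N + 1, fun m hm => Fin.forall_fin_two.mpr ⟨fun h => ?_, fun h => ?_⟩⟩
  · exact absurd (hN (Or.inl h)) (by omega)
  · exact absurd (hN (Or.inr h)) (by omega)

theorem exists_baseMod_eq [Infinite 𝕜] (hθ : ∀ n, 0 < n → (θ : 𝕜) ^ n ≠ 1) {p : T 𝕜} {i j : Fin 2}
    (hi : p.1.rep i ≠ 0) (hj : p.2.rep j ≠ 0) :
    ∃ N, ∀ m, N ≤ m → baseMod ρ θ i j m p = baseMod ρ θ i j N p := by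
  obtain ⟨N, hN⟩ := exists_forall_evalAt_itZW_ne_zero θ hθ p
  refine ⟨N, fun m hm => ?_⟩
  induction m, hm using Nat.le_induction with
  | base => rfl
  | succ m hm ih => rw [baseMod_succ ρ θ hi hj (hN m hm), ih]

/-- Elements of `E^{φ^0} ⋯ E^{φ^{n-1}}` are given by forms. -/
theorem exists_form_of_mem_prodE [Infinite 𝕜] (n : ℕ) {a : K 𝕜} (ha : a ∈ prodE ρ θ 0 n) :
    ∃ (F : Coord 𝕜) (d : ℕ × ℕ), IsForm F d ∧ (a ≠ 0 → F ≠ 0) ∧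
      ∀ i j, a = chart i j F * lamProd ρ θ i j 0 n := by
  suffices h : ∃ F : Coord 𝕜, IsForm F (∑ m ∈ Finset.range n, (1, m + 1)) ∧
      a * ∏ m ∈ Finset.range n, denom ρ θ m = dehom F by
    obtain ⟨F, hF, hFa⟩ := h
    have hD : ∏ m ∈ Finset.range n, denom ρ θ m ≠ 0 :=
      Finset.prod_ne_zero_iff.mpr fun _ _ => denom_ne_zero ρ θ _
    refine ⟨F, _, hF, ?_, fun i j => ?_⟩
    · rintro h0 rfl
      rw [map_zero] at hFa
      exact (mul_ne_zero h0 hD) hFa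
    · apply mul_right_cancel₀ hD
      rw [hFa, ← hF.chart_eq i j, mul_assoc]
      congr 1
      simp only [lamProd, lam, Finset.prod_div_distrib, dehom_lam, zero_add]
      rw [div_mul_cancel₀ _ hD, Finset.prod_mul_distrib, Finset.prod_pow_eq_pow_sum]
      simp [Prod.fst_sum, Prod.snd_sum]
  have hE : ∀ e ∈ E 𝕜, ∃ F : Coord 𝕜, IsForm F (1, 1) ∧ e = dehom F := by
    intro e he
    have hf : ∀ a b, IsForm (X (Sum.inl a) * X (Sum.inr b) : Coord 𝕜) (1, 1) := fun a b => by
      simpa using (isForm_X_inl a).mul (isForm_X_inr (𝕜 := 𝕜) b)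
    induction he using Submodule.span_induction with
    | mem e he =>
      rcases he with rfl | rfl | rfl | rfl
      · exact ⟨_, hf 1 1, by simp [hx, hz]⟩
      · exact ⟨_, hf 0 1, by simp [hx, hz]⟩
      · exact ⟨_, hf 1 0, by simp [hx, hz]⟩
      · exact ⟨_, hf 0 0, by simp [hx, hz]⟩
    | zero => exact ⟨0, isWeightedHomogeneous_zero _ _ _, (map_zero _).symm⟩
    | add e e' _ _ h h' =>
      obtain ⟨F, hF, rfl⟩ := h
      obtain ⟨F', hF', rfl⟩ := h'
      exact ⟨F + F', hF.add hF', (map_add _ _ _).symm⟩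
    | smul c e _ h =>
      obtain ⟨F, hF, rfl⟩ := h
      refine ⟨C c * F, hF.C_mul c, ?_⟩
      rw [← smul_eq_C_mul, map_smul]
  induction n generalizing a with
  | zero =>
    rw [prodE_zero, Submodule.mem_one] at ha
    obtain ⟨c, rfl⟩ := ha
    exact ⟨C c, isForm_C c, by simp [dehom]⟩
  | succ n ih =>
    rw [prodE_add, prodE_one, zero_add] at ha
    refine Submodule.mul_induction_on ha ?_ ?_
    · rintro x hx _ ⟨e, he, rfl⟩
      obtain ⟨F, hF, hFx⟩ := ih hx
      obtain ⟨G, hG, rfl⟩ := hE e he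
      refine ⟨F * substIt ρ θ n G, ?_, ?_⟩
      · rw [Finset.sum_range_succ]
        exact hF.mul (isForm_substIt_one n hG)
      · change x * (phi ρ θ ^ n) (dehom G) * _ = _
        rw [Finset.prod_range_succ, map_mul, ← hFx, phi_pow_dehom_mul n hG]
        have := denom_ne_zero ρ θ n
        field_simp
    · rintro x y ⟨F, hF, hFx⟩ ⟨G, hG, hGy⟩
      exact ⟨F + G, hF.add hG, by rw [add_mul, hFx, hGy, map_add]⟩

end

/-! ### Stability of the chain: at a point, then uniformly. -/

section

variable {𝕜 : Type*} [Field 𝕜] [NeZero (2 : 𝕜)] {ρ θ : 𝕜ˣ}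

/-- From `k` on, the stalks at `p` of the subsheaves generated by the sections of the right ideals
`J ℓ` do not depend on `ℓ` and are given by those of degree `k`. -/
def StableAt (J : ℕ → Submodule (R ρ θ)ᵐᵒᵖ (R ρ θ)) (p : T 𝕜) (k : ℕ) : Prop :=
  ∀ n, k ≤ n → ∀ ℓ, k ≤ ℓ → generated (sections (J ℓ) n) p =
    generated (sections (J k) k) p * sheafR ρ θ k (n - k) p

theorem StableAt.mono {J : ℕ → Submodule (R ρ θ)ᵐᵒᵖ (R ρ θ)} {p : T 𝕜} {k k' : ℕ}
    (h : StableAt J p k) (hk : k ≤ k') : StableAt J p k' := by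
  intro n hn ℓ hℓ
  rw [h n (hk.trans hn) ℓ (hk.trans hℓ), h k' hk k' hk, mul_assoc]
  congr 1
  have e := sheafR_add ρ θ k (k' - k) (n - k') p
  rwa [show k' - k + (n - k') = n - k by omega, Nat.add_sub_cancel' hk] at e

theorem generated_sections_mono {J J' : Submodule (R ρ θ)ᵐᵒᵖ (R ρ θ)} (h : J ≤ J') (n : ℕ)
    (p : T 𝕜) : generated (sections J n) p ≤ generated (sections J' n) p :=
  Submodule.span_mono (sections_mono h n)

variable {J : ℕ → Submodule (R ρ θ)ᵐᵒᵖ (R ρ θ)}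

/-- From some degree `N` on, the base ideal at `p` is constant, and `exists_eq_mul_pow_submodule`
applies to the stalks divided by generators of `ℒ_n`. -/
theorem exists_stableAt [Infinite 𝕜] (hθ : ∀ n, 0 < n → (θ : 𝕜) ^ n ≠ 1) (hJ : Monotone J)
    (p : T 𝕜) : ∃ k, StableAt J p k := by
  obtain ⟨i, hi⟩ := exists_rep_ne_zero p.1
  obtain ⟨j, hj⟩ := exists_rep_ne_zero p.2
  obtain ⟨N, hN⟩ := exists_baseMod_eq ρ θ hθ hi hj
  set b := baseMod ρ θ i j N p
  set Λ : ℕ → K 𝕜 := fun n => lamProd ρ θ i j 0 n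
  have hΛ : ∀ n, Submodule.span (localRing p) {Λ n} * Submodule.span (localRing p) {(Λ n)⁻¹} = 1 :=
    fun n => span_singleton_mul_span_singleton_inv (lamProd_ne_zero ρ θ i j 0 n)
  have hR : ∀ m, N ≤ m → ∀ n, sheafR ρ θ m n p =
      Submodule.span (localRing p) {lamProd ρ θ i j m n} * b ^ n := fun m hm =>
    sheafR_eq_mul_pow ρ θ hi hj fun m' hm' => hN m' (hm.trans hm')
  have hadd : ∀ m n, Submodule.span (localRing p) {Λ (m + n)} =
      Submodule.span (localRing p) {Λ m} *
        Submodule.span (localRing p) {lamProd ρ θ i j m n} := fun m n => by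
    have := span_lamProd_add ρ θ i j 0 m n p
    rwa [zero_add] at this
  have hcancel : ∀ n (S : Submodule (localRing p) (K 𝕜)), Submodule.span (localRing p) {Λ n} *
      (Submodule.span (localRing p) {(Λ n)⁻¹} * S) = S := fun n S => by
    rw [← mul_assoc, hΛ, one_mul]
  have hcancel' : ∀ n (S : Submodule (localRing p) (K 𝕜)), Submodule.span (localRing p) {(Λ n)⁻¹} *
      (Submodule.span (localRing p) {Λ n} * S) = S := fun n S => by
    rw [← mul_assoc, mul_comm (Submodule.span _ {(Λ n)⁻¹}), hΛ, one_mul]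
  -- The degree is shifted by `N`, so that multiplication by one more factor `E^{φ^m}` becomes
  -- multiplication by the fixed ideal `b`.
  let I : ℕ → ℕ → Submodule (localRing p) (K 𝕜) := fun l n =>
    Submodule.span (localRing p) {(Λ (N + n))⁻¹} * generated (sections (J l) (N + n)) p
  have hIb : ∀ l n, I l n ≤ b ^ n := fun l n => by
    refine (mul_le_mul_right (generated_sections_le (J l) (N + n) p) _).trans ?_
    rw [sheafR_add, zero_add, hR N le_rfl]
    refine (mul_le_mul_right (mul_le_mul_left (sheafR_le_span ρ θ hi hj 0 N) _) _).trans_eq ?_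
    rw [← mul_assoc (Submodule.span _ {lamProd ρ θ i j 0 N})]
    exact (congrArg (fun S => _ * (S * b ^ n)) (hadd N n).symm).trans (hcancel' (N + n) (b ^ n))
  have hIs : ∀ l n, I l n * b ≤ I l (n + 1) := fun l n => by
    have h1 := generated_sections_mul_le (J l) (N + n) 1 p
    rw [hR _ (Nat.le_add_right N n), pow_one] at h1
    refine le_trans (le_of_eq ?_) (mul_le_mul_right h1 (Submodule.span (localRing p)
      {(Λ (N + (n + 1)))⁻¹}))
    have e : generated (sections (J l) (N + n)) p *
        (Submodule.span (localRing p) {lamProd ρ θ i j (N + n) 1} * b) =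
        Submodule.span (localRing p) {Λ (N + (n + 1))} * (I l n * b) := by
      rw [← add_assoc, hadd (N + n) 1]
      conv_lhs => rw [← hcancel (N + n) (generated (sections (J l) (N + n)) p)]
      ring
    rw [e, hcancel']
  have := isNoetherianRing_localRing p
  obtain ⟨k, hk⟩ := exists_eq_mul_pow_submodule (B := K 𝕜) (A := localRing p)
    Subtype.val_injective b (baseMod_le_one ρ θ hi hj N) I hIb hIs
    (fun n l l' h => mul_le_mul_right (generated_sections_mono (hJ h) _ _) _)
  refine ⟨N + k, fun n hn ℓ hℓ => ?_⟩
  obtain ⟨n, rfl⟩ := Nat.exists_eq_add_of_le hn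
  have e1 := hk (k + n) (Nat.le_add_right _ _) ℓ (by omega)
  have e2 := hk k le_rfl (N + k) (by omega)
  rw [Nat.sub_self, pow_zero, mul_one] at e2
  rw [← e2, Nat.add_sub_cancel_left] at e1
  rw [hR _ (Nat.le_add_right N k), Nat.add_sub_cancel_left,
    ← hcancel (N + k + n) (generated (sections (J ℓ) (N + k + n)) p),
    ← hcancel (N + k) (generated (sections (J (N + k)) (N + k)) p), hadd (N + k) n, add_assoc N k n]
  change _ * I ℓ (k + n) = Submodule.span (localRing p) {Λ (N + k)} * I (N + k) k * _
  rw [e1]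
  ring

/-- The points outside of the base locus are stable simultaneously. -/
theorem exists_forall_stableAt [Infinite 𝕜] (hJ : Monotone J) :
    ∃ k, ∀ p ∉ baseLocus (ρ : 𝕜) θ, StableAt J p k := by
  have hR : ∀ p ∉ baseLocus (ρ : 𝕜) θ, ∀ (i j : Fin 2), p.1.rep i ≠ 0 → p.2.rep j ≠ 0 →
      ∀ m n, sheafR ρ θ m n p = Submodule.span (localRing p) {lamProd ρ θ i j m n} := by
    intro p hp i j hi hj m n
    rw [sheafR_eq_mul_pow ρ θ hi hj
      (fun m' _ => baseMod_eq_one_of_notMem_baseLocus ρ θ hp hi hj m'), one_pow, mul_one]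
  -- The polynomials which give local sections in degree `k` at all points off the base locus at
  -- once. There `ℛ_n` is invertible, so passing to a higher degree only multiplies by a generator,
  -- and these ideals ascend in a Noetherian ring.
  let 𝔞 : ℕ → Ideal (Coord 𝕜) := fun k =>
    { carrier := {G | ∀ p ∉ baseLocus (ρ : 𝕜) θ, ∀ (i j : Fin 2), p.1.rep i ≠ 0 →
        p.2.rep j ≠ 0 → chart i j G * lamProd ρ θ i j 0 k ∈ generated (sections (J k) k) p}
      add_mem' := fun hF hG p hp i j hi hj => by
        rw [map_add, add_mul]
        exact add_mem (hF p hp i j hi hj) (hG p hp i j hi hj)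
      zero_mem' := fun p hp i j hi hj => by
        rw [map_zero, zero_mul]
        exact zero_mem _
      smul_mem' := fun F G hG p hp i j hi hj => by
        rw [smul_eq_mul, map_mul, mul_assoc]
        exact mul_mem_of_mem_localRing (chart_mem hi hj F) (hG p hp i j hi hj) }
  have hstep : ∀ k n ℓ, k ≤ n → k ≤ ℓ → ∀ p ∉ baseLocus (ρ : 𝕜) θ, ∀ (i j : Fin 2),
      p.1.rep i ≠ 0 → p.2.rep j ≠ 0 → ∀ G, chart i j G * lamProd ρ θ i j 0 k ∈
        generated (sections (J k) k) p → chart i j G * lamProd ρ θ i j 0 n ∈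
          generated (sections (J ℓ) n) p := by
    intro k n ℓ hn hℓ p hp i j hi hj G hG
    obtain ⟨n, rfl⟩ := Nat.exists_eq_add_of_le hn
    refine generated_sections_mul_le (J ℓ) k n p ?_
    rw [hR p hp i j hi hj, lamProd_add, ← mul_assoc, zero_add]
    exact Submodule.mul_mem_mul (generated_sections_mono (hJ hℓ) k p hG)
      (Submodule.mem_span_singleton_self _)
  obtain ⟨k, hk⟩ := monotone_stabilizes_iff_noetherian.mpr
    (inferInstanceAs (IsNoetherian (Coord 𝕜) (Coord 𝕜)))
    ⟨𝔞, fun k k' h G hG p hp i j hi hj => hstep k k' k' h h p hp i j hi hj G (hG p hp i j hi hj)⟩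
  refine ⟨k, fun p hp n hn ℓ hℓ => ?_⟩
  obtain ⟨n, rfl⟩ := Nat.exists_eq_add_of_le hn
  rw [Nat.add_sub_cancel_left]
  apply le_antisymm
  · obtain ⟨i, hi⟩ := exists_rep_ne_zero p.1
    obtain ⟨j, hj⟩ := exists_rep_ne_zero p.2
    rw [hR p hp i j hi hj]
    refine Submodule.span_le.mpr fun a ha => ?_
    obtain ⟨F, d, -, -, hF⟩ := exists_form_of_mem_prodE ρ θ (k + n) (sections_subset _ _ ha)
    -- The form of a section of degree `k + n` belongs to the ideal with index `max ℓ (k + n)`,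
    -- which already equals the one with index `k`.
    have hmax : k ≤ max ℓ (k + n) := hℓ.trans (le_max_left _ _)
    have hF' : F ∈ 𝔞 (max ℓ (k + n)) := by
      intro q hq i j hi hj
      have h1 : chart i j F * lamProd ρ θ i j 0 (k + n) ∈ generated (sections (J ℓ) (k + n)) q := by
        rw [← hF]
        exact Submodule.subset_span ha
      obtain ⟨c, hc⟩ := Nat.exists_eq_add_of_le (le_max_right ℓ (k + n))
      rw [hc]
      refine generated_sections_mul_le _ (k + n) c q ?_
      rw [hR q hq i j hi hj, lamProd_add, ← mul_assoc, zero_add]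
      exact Submodule.mul_mem_mul
        (generated_sections_mono (hJ (hc ▸ le_max_left _ _)) _ _ h1)
        (Submodule.mem_span_singleton_self _)
    have h2 : 𝔞 k = 𝔞 (max ℓ (k + n)) := hk _ hmax
    rw [← h2] at hF'
    have h3 := hF' p hp i j hi hj
    change a ∈ _
    rw [hF i j, lamProd_add, ← mul_assoc, zero_add]
    exact Submodule.mul_mem_mul h3 (Submodule.mem_span_singleton_self _)
  · exact (mul_le_mul_left (generated_sections_mono (hJ hℓ) k p) _).trans
      (generated_sections_mul_le _ _ _ _)

/-- Where `F` does not vanish, the single section `a` generates `ℒ_n`. So in all degrees from `n` on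
the right ideal generates the full sheaf `ℛ` at `p`. -/
theorem stableAt_of_evalAt_ne_zero [Infinite 𝕜] (hJ : Monotone J) {p : T 𝕜} {ℓ n : ℕ} {a : K 𝕜}
    (ha : a ∈ sections (J ℓ) n) {F : Coord 𝕜} {d : ℕ × ℕ} (hF : IsForm F d)
    (hFa : ∀ i j, a = chart i j F * lamProd ρ θ i j 0 n) (hp : evalAt p F ≠ 0) :
    StableAt J p (max ℓ n) := by
  obtain ⟨i, hi⟩ := exists_rep_ne_zero p.1
  obtain ⟨j, hj⟩ := exists_rep_ne_zero p.2
  obtain ⟨h1, h2⟩ := hF.chart_ne_zero_and_inv_mem hi hj hp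
  have key : ∀ ℓ', ℓ ≤ ℓ' → ∀ m, generated (sections (J ℓ') (n + m)) p =
      sheafR ρ θ 0 (n + m) p := by
    intro ℓ' hℓ' m
    apply le_antisymm (generated_sections_le _ _ _)
    rw [sheafR_add, zero_add]
    refine (mul_le_mul_left ?_ _).trans (generated_sections_mul_le _ _ _ _)
    refine (sheafR_le_span ρ θ hi hj 0 n).trans (Submodule.span_le.mpr ?_)
    rintro _ rfl
    have h3 : a ∈ generated (sections (J ℓ') n) p :=
      Submodule.subset_span (sections_mono (hJ hℓ') n ha)
    have h4 := mul_mem_of_mem_localRing h2 h3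
    rwa [hFa i j, inv_mul_cancel_left₀ h1] at h4
  intro n' hn' ℓ' hℓ'
  obtain ⟨c, hc⟩ := Nat.exists_eq_add_of_le (le_max_right ℓ n)
  obtain ⟨m, rfl⟩ := Nat.exists_eq_add_of_le hn'
  have e1 := key ℓ' ((le_max_left _ _).trans hℓ') (c + m)
  have e2 := key (max ℓ n) (le_max_left _ _) c
  rw [← hc] at e2
  rw [← add_assoc, ← hc] at e1
  rw [e1, e2, Nat.add_sub_cancel_left, sheafR_add, zero_add]

/-- Three bounds are combined: one off the base locus, one at base points where a chosen nonzero
section generates, and the maximum over the finitely many base points that are left. -/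
theorem exists_forall_stableAt_of_algebraicIndependent [Infinite 𝕜]
    (hρθ : AlgebraicIndependent (⊥ : Subfield 𝕜) ![(ρ : 𝕜), (θ : 𝕜)]) (hJ : Monotone J) :
    ∃ k, ∀ p, StableAt J p k := by
  have hθ := pow_ne_one_of_algebraicIndependent hρθ
  by_cases h0 : ∀ ℓ n, ∀ a ∈ sections (J ℓ) n, a = 0
  · have h1 : ∀ ℓ n p, generated (sections (J ℓ) n) p = ⊥ := fun ℓ n p =>
      Submodule.span_eq_bot.mpr (h0 ℓ n)
    exact ⟨0, fun p n _ ℓ _ => by rw [h1, h1, Submodule.bot_mul]⟩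
  · push Not at h0
    obtain ⟨ℓ, n, a, ha, ha0⟩ := h0
    obtain ⟨F, d, hF, hF0, hFa⟩ := exists_form_of_mem_prodE ρ θ n (sections_subset _ _ ha)
    have hfin := hF.finite_baseLocus ρ.ne_zero hρθ (hF0 ha0)
    obtain ⟨k₁, hk₁⟩ := exists_forall_stableAt (ρ := ρ) (θ := θ) hJ
    choose κ hκ using exists_stableAt hθ hJ
    obtain ⟨k₂, hk₂⟩ := (hfin.image κ).bddAbove
    refine ⟨max (max ℓ n) (max k₁ k₂), fun p => ?_⟩
    by_cases hp : p ∈ baseLocus (ρ : 𝕜) θ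
    · by_cases hpF : evalAt p F = 0
      · exact (hκ p).mono ((hk₂ ⟨p, ⟨hp, hpF⟩, rfl⟩).trans
          ((le_max_right _ _).trans (le_max_right _ _)))
      · exact (stableAt_of_evalAt_ne_zero hJ ha hF hFa hpF).mono (le_max_left _ _)
    · exact (hk₁ p hp).mono ((le_max_left _ _).trans (le_max_right _ _))

theorem prodE_fg (m n : ℕ) : (prodE ρ θ m n).FG := by
  induction n with
  | zero =>
    rw [prodE_zero, Submodule.one_eq_span]
    exact Submodule.fg_span_singleton _
  | succ n ih =>
    rw [prodE_add, prodE_one]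
    refine ih.mul (Submodule.FG.map _ (Submodule.fg_span ?_))
    simp

/-- `J_n` spans a subspace of a finite-dimensional space over `𝕜`, so one finite set of generators
serves all points; this gives coherence. -/
theorem exists_finset_span_sections (J : Submodule (R ρ θ)ᵐᵒᵖ (R ρ θ)) (n : ℕ) :
    ∃ S : Finset (K 𝕜), ∀ p, Submodule.span (localRing p) (S : Set (K 𝕜)) =
      generated (sections J n) p := by
  obtain ⟨S, hS⟩ := (prodE_fg 0 n).of_le
    (Submodule.span_le.mpr (sections_subset J n) :
      Submodule.span 𝕜 (sections J n) ≤ prodE ρ θ 0 n)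
  refine ⟨S, fun p => ?_⟩
  rw [← Submodule.span_span_of_tower 𝕜, hS, Submodule.span_span_of_tower]
  rfl

/-- The ideal sheaf `M ℒ_k⁻¹`, for `M` the subsheaf generated by `J_k t⁻ᵏ`. -/
def sectionIdeal [IsAlgClosed 𝕜] (hθ : ∀ n, 0 < n → (θ : 𝕜) ^ n ≠ 1)
    (J : Submodule (R ρ θ)ᵐᵒᵖ (R ρ θ)) (k : ℕ) : IdealSheaf 𝕜 where
  toSubsheaf := generated (sections J k) * (1 / sheafL ρ θ 0 k)
  coherent p := by
    classical
    have : Infinite 𝕜 := IsAlgClosed.instInfinite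
    obtain ⟨i, hi⟩ := exists_rep_ne_zero p.1
    obtain ⟨j, hj⟩ := exists_rep_ne_zero p.2
    obtain ⟨S, hS⟩ := exists_finset_span_sections J k
    -- On the whole chart around `p` the function `lamProd` generates `ℒ_k`, so the inverse sheaf is
    -- generated there by its reciprocal.
    refine ⟨_, _, (isForm_X_inl i).mul (isForm_X_inr j), by simpa [evalAt] using ⟨hi, hj⟩,
      S.image fun a => a * (lamProd ρ θ i j 0 k)⁻¹, fun q hq => ?_⟩
    have hq' : q.1.rep i ≠ 0 ∧ q.2.rep j ≠ 0 := by simpa [evalAt] using hq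
    change generated (sections J k) q * (1 / sheafL ρ θ 0 k q) = _
    rw [sheafL_eq ρ θ hq'.1 hq'.2 hθ, one_div_span_singleton (lamProd_ne_zero ρ θ i j 0 k), ← hS,
      Submodule.span_mul_span, generated, Finset.coe_image, Set.mul_singleton]
  le_one p := by
    have : Infinite 𝕜 := IsAlgClosed.instInfinite
    obtain ⟨i, hi⟩ := exists_rep_ne_zero p.1
    obtain ⟨j, hj⟩ := exists_rep_ne_zero p.2
    refine le_trans (mul_le_mul_left ((generated_sections_le J k p).trans
      (sheafR_le_span ρ θ hi hj 0 k)) _) ?_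
    rw [← sheafL_eq ρ θ hi hj hθ]
    exact Submodule.mul_one_div_le_one

theorem sectionIdeal_mul_sheafL [IsAlgClosed 𝕜] (hθ : ∀ n, 0 < n → (θ : 𝕜) ^ n ≠ 1)
    (J : Submodule (R ρ θ)ᵐᵒᵖ (R ρ θ)) (k : ℕ) :
    (sectionIdeal hθ J k).toSubsheaf * sheafL ρ θ 0 k = generated (sections J k) := by
  have : Infinite 𝕜 := IsAlgClosed.instInfinite
  funext p
  obtain ⟨i, hi⟩ := exists_rep_ne_zero p.1
  obtain ⟨j, hj⟩ := exists_rep_ne_zero p.2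
  change generated (sections J k) p * (1 / sheafL ρ θ 0 k p) * sheafL ρ θ 0 k p = _
  rw [sheafL_eq ρ θ hi hj hθ, one_div_span_singleton (lamProd_ne_zero ρ θ i j 0 k), mul_assoc,
    mul_comm (Submodule.span _ {(lamProd ρ θ i j 0 k)⁻¹}),
    span_singleton_mul_span_singleton_inv (lamProd_ne_zero ρ θ i j 0 k), mul_one]

theorem sectionIdeal_le_baseIdeal [IsAlgClosed 𝕜] (hθ : ∀ n, 0 < n → (θ : 𝕜) ^ n ≠ 1)
    (J : Submodule (R ρ θ)ᵐᵒᵖ (R ρ θ)) (k : ℕ) :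
    (sectionIdeal hθ J k).toSubsheaf ≤ baseIdeal ρ θ 0 k :=
  fun p => mul_le_mul_left (generated_sections_le J k p) _

end

end BirP1P1

end

theorem mainTheorem8 {𝕜 : Type*} [Field 𝕜] [IsAlgClosed 𝕜] [Uncountable 𝕜] [NeZero (2 : 𝕜)]
    (ρ θ : 𝕜ˣ) (hρθ : AlgebraicIndependent (⊥ : Subfield 𝕜) ![(ρ : 𝕜), (θ : 𝕜)])
    (J : ℕ → Submodule (BirP1P1.R ρ θ)ᵐᵒᵖ (BirP1P1.R ρ θ)) (hJ : Monotone J)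
    (hgr : ∀ ℓ, BirP1P1.IsGraded (J ℓ)) :
    ∃ (k : ℕ) (𝒥 : BirP1P1.IdealSheaf 𝕜), 𝒥.toSubsheaf ≤ BirP1P1.baseIdeal ρ θ 0 k ∧
      ∃ ℓ₀ : ℕ, ∀ n : ℕ, k ≤ n → ∀ ℓ : ℕ, ℓ₀ ≤ ℓ →
        BirP1P1.generated (BirP1P1.sections (J ℓ) n) =
          𝒥.toSubsheaf * BirP1P1.sheafL ρ θ 0 k * BirP1P1.sheafR ρ θ k (n - k) := by
  have : Infinite 𝕜 := IsAlgClosed.instInfinite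
  have hθ := BirP1P1.pow_ne_one_of_algebraicIndependent hρθ
  obtain ⟨k, hk⟩ := BirP1P1.exists_forall_stableAt_of_algebraicIndependent hρθ hJ
  refine ⟨k, BirP1P1.sectionIdeal hθ (J k) k, BirP1P1.sectionIdeal_le_baseIdeal hθ (J k) k, k,
    fun n hn ℓ hℓ => ?_⟩
  rw [BirP1P1.sectionIdeal_mul_sheafL]
  exact funext fun p => hk p n hn ℓ hℓ
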